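/- Let $N\ge 1$, $m\in\mathbb{C}$, $a=(a_1,\dots,a_N)\in\mathbb{C}^N$, $\epsilon_1,\epsilon_2\in\mathbb{C}\setminus\{0\}$ and $b^2=\epsilon_1/\epsilon_2$. For Young diagrams $\lambda,\mu$ with row lengths $\lambda_i$ and column lengths $\mu'_j$, and for an $N$-tuple $\vec Y=(Y_1,\dots,Y_N)$ of Young diagrams with $|\vec Y|=\sum_I|Y_I|$ boxes in total, set $$Z_{\lambda\mu}(\alpha,m)=\prod_{(i,j)\in\lambda}\Bigl(1-\frac{m}{\alpha-\epsilon_1(\mu'_j-i)+\epsilon_2(\lambda_i-j)}\Bigr),\qquad Z_{\vec Y}=\prod_{I,J=1}^N Z_{Y_IY_J}(a_I-a_J+\epsilon_2,m)\,Z_{Y_IY_J}(a_I-a_J-\epsilon_1,-m).$$ The absolute Nekrasov sum of the 4d $\mathcal{N}=2^*$ $U(N)$ theory is $\sum_{\vec Y}|\mathfrak q|^{|\vec Y|}|Z_{\vec Y}|$, and $R_{\rm abs}\in[0,+\infty]$ denotes its radius of convergence in $|\mathfrak q|$. For irrational $x>0$ the exponential type $B_{\sup}(x)\in[0,+\infty]$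 is the infimum of the $B>0$ such that $\operatorname{dist}(nx,\mathbb{Z})\ge c\,e^{-Bn}$ for some $c>0$ and all large $n$. Assume that neither $m$ nor any $a_I-a_J$ with $I<J$ lies in the closure of $\epsilon_1\mathbb{Z}+\epsilon_2\mathbb{Z}$; if $b^2$ is a negative rational, assume also that no $a_I-a_J+m$ lies in $\epsilon_1\mathbb{Z}+\epsilon_2\mathbb{Z}$. Then the following holds. 1. If $b^2\in\mathbb{C}\setminus[0,+\infty)$, then no denominator in any $Z_{\vec Y}$ vanishes, and $R_{\rm abs}=1$. 2. If $b^2>0$ is irrational, then no denominator in any $Z_{\vec Y}$ vanishes, and $$A_1\,e^{-8B_{\sup}(b^2)/\max(1,b^2)}\le R_{\rm abs}\le\min\bigl(1,\;A_2\,e^{-B_{\sup}(b^2)/(1+b^2)}\bigr)\qquad(e^{-\infty}=0),$$ where $A_1,A_2$ are positive continuous functions of $(m,a,\epsilon_1,\epsilon_2)$, for each $N$, on the set where $\epsilon_1/\epsilon_2$ is real and positive and $m$ and the $a_I-a_J$ with $I<J$ lie outside $\epsilon_2\mathbb{R}$. In particular $R_{\rm abs}>0$ if and only if $B_{\sup}(b^2)<+\infty$;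 if $B_{\sup}(b^2)=+\infty$, then $R_{\rm abs}=0$ and the absolute Nekrasov sum diverges for every $\mathfrak q\ne 0$. 3. If $b^2>0$ is rational, then some term $Z_{\vec Y}$ is singular: there is a tuple $\vec Y$ such that a denominator of $Z_{\vec Y}$ vanishes at $(\epsilon_1,\epsilon_2)$ and, for some $(u,v)\in\mathbb{C}^2$, with $m$ and $a$ fixed, the value of $Z_{\vec Y}$ at $(\epsilon_1+tu,\epsilon_2+tv)$ has all its denominators non-zero for small $t\ne 0$ and tends to infinity in absolute value as $t\to 0$. -/

import Mathlib

open Filter Topology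
open scoped ENNReal NNReal

/-- The lattice `ε₁ ℤ + ε₂ ℤ` in `ℂ`. -/
def epsLattice (ε₁ ε₂ : ℂ) : Set ℂ :=
  {z | ∃ k l : ℤ, z = (k : ℂ) * ε₁ + (l : ℂ) * ε₂}

/-- The denominator `a - ε₁ (μ'_j - i) + ε₂ (λ_i - j)` attached to a box `(i, j)` of `lam`.
Mathlib indexes the boxes `c = (i - 1, j - 1)` of a Young diagram from zero; `rowLen` is `λ_i`
and `colLen` is `μ'_j`. The differences are taken in `ℂ`, so they may be negative. -/
noncomputable def boxDenom (ε₁ ε₂ : ℂ) (lam mu : YoungDiagram) (a : ℂ) (c : ℕ × ℕ) : ℂ :=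
  a - ε₁ * ((mu.colLen c.2 : ℂ) - ((c.1 : ℂ) + 1))
    + ε₂ * ((lam.rowLen c.1 : ℂ) - ((c.2 : ℂ) + 1))

/-- `Z_{λμ}(a, m) = ∏_{(i,j) ∈ λ} (1 - m / (a - ε₁ (μ'_j - i) + ε₂ (λ_i - j)))`. -/
noncomputable def ZLamMu (ε₁ ε₂ : ℂ) (lam mu : YoungDiagram) (a m : ℂ) : ℂ :=
  ∏ c ∈ lam.cells, (1 - m / boxDenom ε₁ ε₂ lam mu a c)

/-- `Z_Y = ∏_{I,J} Z_{Y_I Y_J}(a_I - a_J + ε₂, m) Z_{Y_I Y_J}(a_I - a_J - ε₁, -m)`. -/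
noncomputable def ZTerm {N : ℕ} (m : ℂ) (a : Fin N → ℂ) (ε₁ ε₂ : ℂ)
    (Y : Fin N → YoungDiagram) : ℂ :=
  ∏ I, ∏ J,
    (ZLamMu ε₁ ε₂ (Y I) (Y J) (a I - a J + ε₂) m *
      ZLamMu ε₁ ε₂ (Y I) (Y J) (a I - a J - ε₁) (-m))

/-- No denominator in the product that defines `Z_Y` vanishes. -/
def ZTermDefined {N : ℕ} (a : Fin N → ℂ) (ε₁ ε₂ : ℂ) (Y : Fin N → YoungDiagram) : Prop :=
  ∀ I J, ∀ c ∈ (Y I).cells,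
    boxDenom ε₁ ε₂ (Y I) (Y J) (a I - a J + ε₂) c ≠ 0 ∧
    boxDenom ε₁ ε₂ (Y I) (Y J) (a I - a J - ε₁) c ≠ 0

/-- The total number of boxes `|Y| = |Y_1| + ⋯ + |Y_N|`. -/
def totalSize {N : ℕ} (Y : Fin N → YoungDiagram) : ℕ := ∑ I, (Y I).card

/-- Convergence of the absolute Nekrasov sum `∑_Y |q|^{|Y|} |Z_Y|` at `|q| = r`. -/
def AbsSumConverges {N : ℕ} (m : ℂ) (a : Fin N → ℂ) (ε₁ ε₂ : ℂ) (r : ℝ) : Prop :=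
  Summable fun Y : Fin N → YoungDiagram => r ^ totalSize Y * ‖ZTerm m a ε₁ ε₂ Y‖

/-- The absolute convergence radius, in `[0, ∞]`. -/
noncomputable def Rabs {N : ℕ} (m : ℂ) (a : Fin N → ℂ) (ε₁ ε₂ : ℂ) : ℝ≥0∞ :=
  ⨆ (r : ℝ≥0) (_ : AbsSumConverges m a ε₁ ε₂ (r : ℝ)), (r : ℝ≥0∞)

/-- The distance from a real number to the nearest integer. -/
noncomputable def distInt (x : ℝ) : ℝ := min (Int.fract x) (Int.fract (-x))

/-- The exponential type in `[0, ∞]`: the infimum of the `B > 0` such that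
`dist(n x, ℤ) ≳ e^{-B n}` as `n → ∞` (and `∞` if there is no such `B`). -/
noncomputable def expType (x : ℝ) : ℝ≥0∞ :=
  ⨅ (B : ℝ≥0) (_ : 0 < B ∧ ∃ c : ℝ, 0 < c ∧
      ∀ᶠ n : ℕ in atTop, c * Real.exp (-(B : ℝ) * n) ≤ distInt (n * x)),
    (B : ℝ≥0∞)

/-- The function `t ↦ e^{-t}` on `[0, ∞]`, with `e^{-∞} = 0`. -/
noncomputable def expNeg (t : ℝ≥0∞) : ℝ≥0∞ := EReal.exp (-(t : EReal))

/-- The standing assumptions on the parameters, with `b² = ε₁ / ε₂`. -/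
structure GenericParams {N : ℕ} (m : ℂ) (a : Fin N → ℂ) (ε₁ ε₂ : ℂ) : Prop where
  ne_zero₁ : ε₁ ≠ 0
  ne_zero₂ : ε₂ ≠ 0
  coulomb : ∀ I J, I < J → a I - a J ∉ closure (epsLattice ε₁ ε₂)
  mass : m ∉ closure (epsLattice ε₁ ε₂)
  negRat : ∀ r : ℚ, r < 0 → ε₁ / ε₂ = (r : ℂ) → ∀ I J, a I - a J + m ∉ epsLattice ε₁ ε₂

/-- The parameters `(m, a, ε₁, ε₂)` with `ε₁ / ε₂` real positive and with `m` and the `a_I - a_J`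
outside the real line spanned by `ε₂`. When `ε₁ / ε₂` is positive and irrational, that line is the
closure of `ε₁ ℤ + ε₂ ℤ`. -/
def positiveDomain (N : ℕ) : Set (ℂ × (Fin N → ℂ) × ℂ × ℂ) :=
  {p | p.2.2.2 ≠ 0 ∧ (∃ x : ℝ, 0 < x ∧ p.2.2.1 / p.2.2.2 = (x : ℂ)) ∧
    (∀ t : ℝ, p.1 ≠ (t : ℂ) * p.2.2.2) ∧
    ∀ I J, I < J → ∀ t : ℝ, p.2.1 I - p.2.1 J ≠ (t : ℂ) * p.2.2.2}

/-!
The theorem is about the exponential growth rate of `|Z_Y|` in `|Y|`, since the number of tuples of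
diagrams with `n` boxes grows subexponentially (`summable_pow_totalSize`). Each factor is
`1 - m / d`. In the off-diagonal factors (`I ≠ J`) the denominators `d` are translates of `a I - a J`
by lattice points, hence bounded away from zero; in the diagonal ones they are
`(arm + 1) ε₂ - leg ε₁` and `arm ε₂ - (leg + 1) ε₁`.

*Away from `ε₁ / ε₂ ∈ [0, ∞)`.* All denominators are bounded below, and along each row and each column
they are well separated, so those of bounded size form a sparse subset of the diagram: at most
boundedly many in each row and column. A sparse set has `o(n)` boxes, which makes `|Z_Y|`
subexponential and the radius at least one (`exists_norm_ZLamMu_le`). For the opposite inequality it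
suffices to find tuples of linearly growing size with non-zero terms whose successive ratios tend
to one. A single one-row diagram at a vertex `I` does this unless some off-diagonal numerator
vanishes; if that happens at every vertex, then the vertices are permuted by the relation
`a I - a J - m ∈ ε₁ ℤ + ε₂ ℤ`, and equal one-row diagrams at all vertices work
(`exists_edge_of_obstructed`, `Rabs_le_one`).

*Lower bound for irrational `x = ε₁ / ε₂ > 0`.* The diagonal denominators at a box of leg `q`
or `q - 1` are at least `|ε₂| dist (q x, ℤ)`. In a column the legs are consecutive integers, so the columns reduce the
problem to `∑_{q ≤ l} log (1 / dist (q x, ℤ)) ≤ (4 B + 4) l` if `dist (q x, ℤ) ≥ e^{-B q}`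
eventually. With `n ≤ l` the denominator of the best approximation of `x`, the points `q x` over a
block of `n` consecutive `q` are close to distinct multiples of `1 / n`, so at most two of them per
block are much closer to `ℤ` than the corresponding multiples (`sum_log_distInt_le`). Rows
correspond to `1 / x`, with `B` replaced by `B / x`; the better of the two gives the maximum
`max 1 x`.

*Upper bound for irrational `x > 0`.* If `dist (q x, ℤ) < e^{-B q}` with nearest integer `p` to `q x`,
then boxes with `(arm + 1, leg) = t (p, q)` have denominators of order `t e^{-B q}`.
`slopeDiagram p q` has a proportion of such boxes of at least about `1 / (p + q)`
(`le_two_mul_card_slopeBoxes`). The other factors are bounded below by constants, on the diagonal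
because `Im (m / ε₂) ≠ 0` keeps `1 - m / d` away from zero. Since `q / (p + q)` tends to
`1 / (1 + x)`, the terms are at least `e^{(B / (1 + x) - o(1)) n}` times the `n`-th power of a
constant (`le_of_lt_expType`).

*Rational `ε₁ / ε₂ > 0`.* A large rectangle at one vertex, with empty diagrams elsewhere, has
arbitrarily many vanishing diagonal denominators (`le_card_poles`). Along the direction
`(1, i)` each factor has a pole or zero of order at most one; diagonal factors have no zeros and the
number of off-diagonal zeros is bounded independently of the rectangle, so the poles win
(`exists_singular`).
-/

/-! ### Young diagrams: sums over columns, sparse sets of boxes, enumeration -/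

namespace YoungDiagram

theorem sum_cells_eq_sum_col {β : Type*} [AddCommMonoid β] (lam : YoungDiagram) {w : ℕ}
    (hw : lam.rowLen 0 ≤ w) (f : ℕ × ℕ → β) :
    ∑ c ∈ lam.cells, f c = ∑ j ∈ Finset.range w, ∑ i ∈ Finset.range (lam.colLen j), f (i, j) := by
  rw [← Finset.sum_fiberwise_of_maps_to (s := lam.cells) (t := Finset.range w) (g := Prod.snd)]
  · refine Finset.sum_congr rfl fun j _ => ?_
    have : lam.cells.filter (fun c => c.2 = j) = lam.col j := rfl
    rw [this, col_eq_prod, Finset.sum_product]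
    simp
  · rintro ⟨i, j⟩ hc
    have h0 : (0, j) ∈ lam := lam.up_left_mem (Nat.zero_le i) le_rfl ((mem_cells _).1 hc)
    exact Finset.mem_range.2 ((mem_iff_lt_rowLen.1 h0).trans_le hw)

theorem card_eq_sum_colLen (lam : YoungDiagram) {w : ℕ} (hw : lam.rowLen 0 ≤ w) :
    lam.card = ∑ j ∈ Finset.range w, lam.colLen j := by
  have := sum_cells_eq_sum_col lam hw (fun _ => (1 : ℕ))
  simpa using this

theorem sum_transpose_cells {β : Type*} [AddCommMonoid β] (lam : YoungDiagram) (f : ℕ × ℕ → β) :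
    ∑ c ∈ lam.transpose.cells, f c = ∑ c ∈ lam.cells, f c.swap := by
  refine Finset.sum_bij (fun c _ => c.swap) ?_ ?_ ?_ ?_
  · intro c hc
    exact (mem_cells _).2 (mem_transpose.1 ((mem_cells _).1 hc))
  · intro a _ b _ h
    exact Prod.swap_injective h
  · intro b hb
    exact ⟨b.swap, (mem_cells _).2 (mem_transpose.2 (by simpa using hb)), by simp⟩
  · intro a _
    simp

theorem card_transpose (lam : YoungDiagram) : lam.transpose.card = lam.card := by
  have := sum_transpose_cells lam (fun _ => (1 : ℕ))
  simpa using this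

theorem card_eq_sum_rowLen (lam : YoungDiagram) {h : ℕ} (hh : lam.colLen 0 ≤ h) :
    lam.card = ∑ i ∈ Finset.range h, lam.rowLen i := by
  rw [← card_transpose, card_eq_sum_colLen lam.transpose (w := h) (by simpa using hh)]
  simp

theorem succ_mul_colLen_le_card (lam : YoungDiagram) (s : ℕ) :
    (s + 1) * lam.colLen s ≤ lam.card := by
  rw [card_eq_sum_colLen lam (le_max_left _ (s + 1))]
  calc (s + 1) * lam.colLen s = ∑ _j ∈ Finset.range (s + 1), lam.colLen s := by simp
    _ ≤ ∑ j ∈ Finset.range (s + 1), lam.colLen j :=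
        Finset.sum_le_sum fun j hj =>
          lam.colLen_anti _ _ (Nat.lt_succ_iff.1 (Finset.mem_range.1 hj))
    _ ≤ _ := Finset.sum_le_sum_of_subset
        (Finset.range_subset_range.2 (le_max_right _ _))

/-- A set of boxes with boundedly many elements in every row and every column is a sparse subset of
the diagram: the first `s` columns contain `O(s)` of them, and at most `n / s` rows reach further
right. -/
theorem exists_card_sparse_le (k : ℕ) {η : ℝ} (hη : 0 < η) :
    ∃ K : ℝ, 0 ≤ K ∧ ∀ (lam : YoungDiagram) (S : Finset (ℕ × ℕ)), S ⊆ lam.cells →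
      (∀ i, (S.filter fun c => c.1 = i).card ≤ k) →
      (∀ j, (S.filter fun c => c.2 = j).card ≤ k) → (S.card : ℝ) ≤ K + η * lam.card := by
  obtain ⟨s, hs⟩ := exists_nat_gt (k / η)
  refine ⟨k * s, by positivity, fun lam S hS hrow hcol => ?_⟩
  have h1 : (S.filter fun c => c.2 < s).card ≤ k * s := by
    rw [Finset.card_eq_sum_card_fiberwise (t := Finset.range s) (f := Prod.snd)]
    · calc _ ≤ ∑ _j ∈ Finset.range s, k := Finset.sum_le_sum fun j _ =>
            (Finset.card_le_card (Finset.filter_subset_filter _ (Finset.filter_subset _ _))).trans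
              (hcol j)
        _ = k * s := by simp [mul_comm]
    · intro c hc
      simpa using (Finset.mem_filter.1 hc).2
  have h2 : (S.filter fun c => ¬ c.2 < s).card ≤ k * lam.colLen s := by
    rw [Finset.card_eq_sum_card_fiberwise (t := Finset.range (lam.colLen s)) (f := Prod.fst)]
    · calc _ ≤ ∑ _j ∈ Finset.range (lam.colLen s), k := Finset.sum_le_sum fun j _ =>
            (Finset.card_le_card (Finset.filter_subset_filter _ (Finset.filter_subset _ _))).trans
              (hrow j)
        _ = k * lam.colLen s := by simp [mul_comm]
    · rintro ⟨i, j⟩ hc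
      obtain ⟨hc, hj⟩ := Finset.mem_filter.1 hc
      have := lam.up_left_mem le_rfl (not_lt.1 hj) ((mem_cells _).1 (hS hc))
      simpa using mem_iff_lt_colLen.1 this
  have h3 : S.card ≤ k * s + k * lam.colLen s := by
    rw [← Finset.card_filter_add_card_filter_not (s := S) (fun c => c.2 < s)]
    exact add_le_add h1 h2
  have h4 : ((s : ℝ) + 1) * lam.colLen s ≤ lam.card := by
    exact_mod_cast succ_mul_colLen_le_card lam s
  have hk : (k : ℝ) ≤ η * (s + 1) := by
    rw [div_lt_iff₀ hη] at hs
    nlinarith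
  calc (S.card : ℝ) ≤ k * s + k * lam.colLen s := by exact_mod_cast h3
    _ ≤ k * s + η * (s + 1) * lam.colLen s := by gcongr
    _ ≤ k * s + η * lam.card := by rw [mul_assoc]; gcongr

/-- The rectangular Young diagram with `h` rows of length `w`. -/
def rect (h w : ℕ) : YoungDiagram where
  cells := Finset.range h ×ˢ Finset.range w
  isLowerSet := by
    rintro ⟨i, j⟩ ⟨i', j'⟩ hle hc
    obtain ⟨h1, h2⟩ := Prod.mk_le_mk.1 hle
    simp only [Finset.coe_product, Finset.coe_range, Set.mem_prod, Set.mem_Iio] at hc ⊢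
    exact ⟨h1.trans_lt hc.1, h2.trans_lt hc.2⟩

theorem mem_rect {h w : ℕ} {c : ℕ × ℕ} : c ∈ rect h w ↔ c.1 < h ∧ c.2 < w := by
  rw [← mem_cells]
  simp [rect]

theorem rowLen_rect {h w i : ℕ} (hi : i < h) : (rect h w).rowLen i = w := by
  have key : ∀ j, j < (rect h w).rowLen i ↔ j < w := fun j => by
    rw [← mem_iff_lt_rowLen, mem_rect]
    simp [hi]
  exact le_antisymm (not_lt.1 fun hlt => lt_irrefl _ ((key w).1 hlt))
    (not_lt.1 fun hlt => lt_irrefl _ ((key _).2 hlt))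

theorem colLen_rect {h w j : ℕ} (hj : j < w) : (rect h w).colLen j = h := by
  have key : ∀ i, i < (rect h w).colLen j ↔ i < h := fun i => by
    rw [← mem_iff_lt_colLen, mem_rect]
    simp [hj]
  exact le_antisymm (not_lt.1 fun hlt => lt_irrefl _ ((key h).1 hlt))
    (not_lt.1 fun hlt => lt_irrefl _ ((key _).2 hlt))

theorem card_rect (h w : ℕ) : (rect h w).card = h * w := by
  simp [YoungDiagram.card, rect]

theorem colLen_bot (j : ℕ) : (⊥ : YoungDiagram).colLen j = 0 := by
  by_contra h
  exact notMem_bot _ (mem_iff_lt_colLen.2 (Nat.pos_of_ne_zero h))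

/-- A Young diagram with at most `K` rows is recovered from the numbers
`rowLen k - rowLen (k + 1)` of columns of length `k + 1`. -/
theorem eq_of_rowLen_sub_eq {lam mu : YoungDiagram} {K : ℕ} (hl : lam.colLen 0 ≤ K)
    (hm : mu.colLen 0 ≤ K)
    (h : ∀ k < K, lam.rowLen k - lam.rowLen (k + 1) = mu.rowLen k - mu.rowLen (k + 1)) :
    lam = mu := by
  have zero : ∀ nu : YoungDiagram, nu.colLen 0 ≤ K → ∀ k, K ≤ k → nu.rowLen k = 0 := by
    intro nu hnu k hk
    by_contra h0
    have : (k, 0) ∈ nu := mem_iff_lt_rowLen.2 (Nat.pos_of_ne_zero h0)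
    have := mem_iff_lt_colLen.1 this
    omega
  have key : ∀ d k, K ≤ k + d → lam.rowLen k = mu.rowLen k := by
    intro d
    induction d with
    | zero => intro k hk; rw [zero lam hl k hk, zero mu hm k hk]
    | succ d ih =>
      intro k hk
      rcases lt_or_ge k K with hlt | hge
      · have h1 := ih (k + 1) (by omega)
        have h2 := h k hlt
        have h3 := lam.rowLen_anti k (k + 1) (Nat.le_succ k)
        have h4 := mu.rowLen_anti k (k + 1) (Nat.le_succ k)
        omega
      · rw [zero lam hl k hge, zero mu hm k hge]
  apply SetLike.ext
  rintro ⟨i, j⟩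
  rw [mem_iff_lt_rowLen, mem_iff_lt_rowLen, key K i (by omega)]

theorem card_eq_sum_rowLen_sub (lam : YoungDiagram) {K : ℕ} (hl : lam.colLen 0 ≤ K) :
    lam.card = ∑ k ∈ Finset.range K, (k + 1) * (lam.rowLen k - lam.rowLen (k + 1)) := by
  have key : ∀ n, ∑ k ∈ Finset.range n, (k + 1) * (lam.rowLen k - lam.rowLen (k + 1))
      + n * lam.rowLen n = ∑ k ∈ Finset.range n, lam.rowLen k := by
    intro n
    induction n with
    | zero => simp
    | succ n ih =>
      rw [Finset.sum_range_succ, Finset.sum_range_succ, ← ih]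
      obtain ⟨d, hd⟩ := Nat.exists_eq_add_of_le (lam.rowLen_anti n (n + 1) (Nat.le_succ n))
      rw [hd, Nat.add_sub_cancel_left]
      ring
  have h0 : lam.rowLen K = 0 := by
    by_contra h0
    have : (K, 0) ∈ lam := mem_iff_lt_rowLen.2 (Nat.pos_of_ne_zero h0)
    have := mem_iff_lt_colLen.1 this
    omega
  rw [card_eq_sum_rowLen lam hl, ← key K, h0]
  simp

theorem colLen_zero_le_card (lam : YoungDiagram) : lam.colLen 0 ≤ lam.card := by
  simpa using succ_mul_colLen_le_card lam 0

theorem rowLen_zero_le_card (lam : YoungDiagram) : lam.rowLen 0 ≤ lam.card := by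
  simpa [card_transpose] using colLen_zero_le_card lam.transpose

/-- The generating series of partitions converges in the unit disc. Recording the multiplicities of
the column lengths bounds every partial sum by `∏ k, (1 - r ^ (k + 1))⁻¹`. -/
theorem summable_pow_card {r : ℝ} (hr0 : 0 ≤ r) (hr1 : r < 1) :
    Summable fun lam : YoungDiagram => r ^ lam.card := by
  have h1r : 0 < 1 - r := by linarith
  refine summable_of_sum_le (c := Real.exp ((1 - r)⁻¹ * (1 - r)⁻¹)) (fun _ => by positivity) ?_
  intro F
  obtain ⟨K, hK⟩ : ∃ K, ∀ lam ∈ F, lam.card ≤ K :=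
    ⟨F.sup YoungDiagram.card, fun lam h => Finset.le_sup (f := YoungDiagram.card) h⟩
  let T : Finset (Fin K → ℕ) := Fintype.piFinset fun _ => Finset.range (K + 1)
  let e : YoungDiagram → Fin K → ℕ := fun lam k => lam.rowLen k - lam.rowLen (k + 1)
  have hmaps : ∀ lam ∈ F, e lam ∈ T := by
    intro lam hlam
    refine Fintype.mem_piFinset.2 fun k => Finset.mem_range.2 ?_
    have h1 := lam.rowLen_anti 0 k (Nat.zero_le _)
    have h2 := lam.rowLen_zero_le_card
    have h3 := hK lam hlam
    simp only [e]
    omega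
  have hinj : Set.InjOn e F := by
    intro lam hlam mu hmu h
    refine eq_of_rowLen_sub_eq (K := K) (lam.colLen_zero_le_card.trans (hK _ hlam))
      (mu.colLen_zero_le_card.trans (hK _ hmu)) fun k hk => ?_
    exact congrFun h ⟨k, hk⟩
  have hval : ∀ lam ∈ F, r ^ lam.card = ∏ k : Fin K, (r ^ ((k : ℕ) + 1)) ^ (e lam k) := by
    intro lam hlam
    rw [card_eq_sum_rowLen_sub lam (K := K) (lam.colLen_zero_le_card.trans (hK _ hlam)),
      Finset.sum_range, ← Finset.prod_pow_eq_pow_sum]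
    exact Finset.prod_congr rfl fun k _ => pow_mul _ _ _
  calc ∑ lam ∈ F, r ^ lam.card
      = ∑ lam ∈ F, ∏ k : Fin K, (r ^ ((k : ℕ) + 1)) ^ (e lam k) := Finset.sum_congr rfl hval
    _ = ∑ x ∈ F.image e, ∏ k : Fin K, (r ^ ((k : ℕ) + 1)) ^ (x k) :=
        (Finset.sum_image (f := fun x : Fin K → ℕ =>
          ∏ k : Fin K, (r ^ ((k : ℕ) + 1)) ^ (x k)) hinj).symm
    _ ≤ ∑ x ∈ T, ∏ k : Fin K, (r ^ ((k : ℕ) + 1)) ^ (x k) :=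
        Finset.sum_le_sum_of_subset_of_nonneg (Finset.image_subset_iff.2 hmaps)
          fun _ _ _ => Finset.prod_nonneg fun _ _ => by positivity
    _ = ∏ k : Fin K, ∑ j ∈ Finset.range (K + 1), (r ^ ((k : ℕ) + 1)) ^ j :=
        (Finset.prod_univ_sum _ _).symm
    _ ≤ ∏ k : Fin K, Real.exp (r ^ (k : ℕ) * (1 - r)⁻¹) := by
        refine Finset.prod_le_prod (fun _ _ => Finset.sum_nonneg fun _ _ => by positivity) ?_
        intro k _
        set y := r ^ ((k : ℕ) + 1) with hy
        have hy0 : 0 ≤ y := by positivity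
        have hyr : y ≤ r := by
          rw [hy]; exact pow_le_of_le_one hr0 hr1.le (Nat.succ_ne_zero _)
        have hyk : y ≤ r ^ (k : ℕ) := pow_le_pow_of_le_one hr0 hr1.le (Nat.le_succ _)
        calc ∑ j ∈ Finset.range (K + 1), y ^ j ≤ (1 - y)⁻¹ := by
              rw [← tsum_geometric_of_lt_one hy0 (by linarith)]
              exact (summable_geometric_of_lt_one hy0 (by linarith)).sum_le_tsum _
                fun _ _ => by positivity
          _ = y * (1 - y)⁻¹ + 1 := by
              have : (1 - y) ≠ 0 := by linarith
              field_simp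
              ring
          _ ≤ Real.exp (y * (1 - y)⁻¹) := Real.add_one_le_exp _
          _ ≤ Real.exp (r ^ (k : ℕ) * (1 - r)⁻¹) := by
              refine Real.exp_le_exp.2 (mul_le_mul hyk ?_ ?_ (by positivity))
              · exact inv_anti₀ h1r (by linarith)
              · exact inv_nonneg.2 (by linarith)
    _ = Real.exp ((∑ k : Fin K, r ^ (k : ℕ)) * (1 - r)⁻¹) := by
        rw [← Real.exp_sum, Finset.sum_mul]
    _ ≤ Real.exp ((1 - r)⁻¹ * (1 - r)⁻¹) := by
        refine Real.exp_le_exp.2 (mul_le_mul_of_nonneg_right ?_ (by positivity))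
        rw [← tsum_geometric_of_lt_one hr0 hr1, ← Finset.sum_range (fun k => r ^ k)]
        exact (summable_geometric_of_lt_one hr0 hr1).sum_le_tsum _ fun _ _ => by positivity

end YoungDiagram

theorem summable_pow_totalSize {N : ℕ} {r : ℝ} (hr0 : 0 ≤ r) (hr1 : r < 1) :
    Summable fun Y : Fin N → YoungDiagram => r ^ totalSize Y := by
  have hs := YoungDiagram.summable_pow_card hr0 hr1
  refine summable_of_sum_le (c := (∑' lam : YoungDiagram, r ^ lam.card) ^ N)
    (fun _ => by positivity) fun F => ?_
  classical
  let S : Finset YoungDiagram := F.biUnion fun Y => Finset.univ.image Y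
  calc ∑ Y ∈ F, r ^ totalSize Y
      = ∑ Y ∈ F, ∏ I, r ^ (Y I).card :=
        Finset.sum_congr rfl fun Y _ => by rw [totalSize, Finset.prod_pow_eq_pow_sum]
    _ ≤ ∑ Y ∈ Fintype.piFinset fun _ : Fin N => S, ∏ I, r ^ (Y I).card := by
        refine Finset.sum_le_sum_of_subset_of_nonneg (fun Y hY => ?_)
          fun _ _ _ => Finset.prod_nonneg fun _ _ => by positivity
        refine Fintype.mem_piFinset.2 fun I => Finset.mem_biUnion.2 ⟨Y, hY, ?_⟩
        exact Finset.mem_image_of_mem _ (Finset.mem_univ I)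
    _ = ∏ _I : Fin N, ∑ lam ∈ S, r ^ lam.card :=
        (Finset.prod_univ_sum (fun _ => S) fun _ lam => r ^ lam.card).symm
    _ = (∑ lam ∈ S, r ^ lam.card) ^ N := by simp
    _ ≤ (∑' lam : YoungDiagram, r ^ lam.card) ^ N := by
        refine pow_le_pow_left₀ (Finset.sum_nonneg fun _ _ => by positivity) ?_ _
        exact hs.sum_le_tsum _ fun _ _ => by positivity

/-! ### From bounds on the terms to bounds on the radius -/

/-- Bounds on the factors of all pairs `(I, J)` multiply to a bound in terms of the total size; only
the row sums of the exponents `c` matter because the factor `(I, J)` has `|Y I|` boxes. -/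
theorem norm_ZTerm_le {N : ℕ} {m : ℂ} {a : Fin N → ℂ} {ε₁ ε₂ : ℂ} {K c : Fin N → Fin N → ℝ}
    {C : ℝ} (hK : ∀ I J, 0 ≤ K I J) (hc : ∀ I, ∑ J, c I J ≤ C)
    (h : ∀ I J (Y : Fin N → YoungDiagram),
      ‖ZLamMu ε₁ ε₂ (Y I) (Y J) (a I - a J + ε₂) m *
        ZLamMu ε₁ ε₂ (Y I) (Y J) (a I - a J - ε₁) (-m)‖ ≤
          K I J * Real.exp (c I J * (Y I).card)) (Y : Fin N → YoungDiagram) :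
    ‖ZTerm m a ε₁ ε₂ Y‖ ≤ (∏ I, ∏ J, K I J) * Real.exp (C * totalSize Y) := by
  rw [ZTerm, norm_prod]
  calc _ ≤ ∏ I, ((∏ J, K I J) * Real.exp (C * (Y I).card)) := by
        refine Finset.prod_le_prod (fun _ _ => norm_nonneg _) fun I _ => ?_
        rw [norm_prod]
        calc _ ≤ ∏ J, (K I J * Real.exp (c I J * (Y I).card)) :=
              Finset.prod_le_prod (fun _ _ => norm_nonneg _) fun J _ => h I J Y
          _ = (∏ J, K I J) * Real.exp ((∑ J, c I J) * (Y I).card) := by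
              rw [Finset.prod_mul_distrib, ← Real.exp_sum, Finset.sum_mul]
          _ ≤ _ := by
              have : 0 ≤ ∏ J, K I J := Finset.prod_nonneg fun _ _ => hK _ _
              have := hc I
              gcongr
    _ = _ := by
        rw [Finset.prod_mul_distrib, ← Real.exp_sum, totalSize, ← Finset.mul_sum]
        push_cast
        rfl

theorem exp_neg_le_Rabs {N : ℕ} {m : ℂ} {a : Fin N → ℂ} {ε₁ ε₂ : ℂ} {K C : ℝ}
    (h : ∀ Y : Fin N → YoungDiagram, ‖ZTerm m a ε₁ ε₂ Y‖ ≤ K * Real.exp (C * totalSize Y)) :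
    ENNReal.ofReal (Real.exp (-C)) ≤ Rabs m a ε₁ ε₂ := by
  refine ENNReal.le_of_forall_nnreal_lt fun r hr => ?_
  have hr' : (r : ℝ) < Real.exp (-C) := by
    rw [ENNReal.lt_ofReal_iff_toReal_lt ENNReal.coe_ne_top] at hr
    simpa using hr
  refine le_iSup₂_of_le r ?_ le_rfl
  have hlt : (r : ℝ) * Real.exp C < 1 := by
    calc (r : ℝ) * Real.exp C < Real.exp (-C) * Real.exp C := by gcongr
      _ = 1 := by rw [← Real.exp_add]; simp
  have hs := (summable_pow_totalSize (N := N) (r := r * Real.exp C) (by positivity) hlt).mul_left K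
  refine Summable.of_nonneg_of_le (fun Y => by positivity) (fun Y => ?_) hs
  calc (r : ℝ) ^ totalSize Y * ‖ZTerm m a ε₁ ε₂ Y‖
      ≤ (r : ℝ) ^ totalSize Y * (K * Real.exp (C * totalSize Y)) := by gcongr; exact h Y
    _ = K * (r * Real.exp C) ^ totalSize Y := by
        rw [mul_pow, ← Real.exp_nat_mul, mul_comm C]
        ring

theorem Rabs_le_ofReal {N : ℕ} {m : ℂ} {a : Fin N → ℂ} {ε₁ ε₂ : ℂ} {ρ : ℝ}
    (h : ∀ r : ℝ, 0 ≤ r → AbsSumConverges m a ε₁ ε₂ r → r ≤ ρ) :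
    Rabs m a ε₁ ε₂ ≤ ENNReal.ofReal ρ := by
  refine iSup₂_le fun r hr => ?_
  rw [← ENNReal.ofReal_coe_nnreal]
  exact ENNReal.ofReal_le_ofReal (h r r.2 hr)

theorem norm_one_sub_div_le (m d : ℂ) : ‖1 - m / d‖ ≤ 1 + ‖m‖ / ‖d‖ := by
  calc ‖1 - m / d‖ ≤ ‖(1 : ℂ)‖ + ‖m / d‖ := norm_sub_le _ _
    _ = 1 + ‖m‖ / ‖d‖ := by rw [norm_one, norm_div]

theorem norm_ZLamMu_le_exp_sum (ε₁ ε₂ : ℂ) (lam mu : YoungDiagram) (α m : ℂ) :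
    ‖ZLamMu ε₁ ε₂ lam mu α m‖ ≤
      Real.exp (∑ c ∈ lam.cells, Real.log (1 + ‖m‖ / ‖boxDenom ε₁ ε₂ lam mu α c‖)) := by
  rw [ZLamMu, norm_prod, Real.exp_sum]
  refine Finset.prod_le_prod (fun _ _ => norm_nonneg _) fun c _ => ?_
  rw [Real.exp_log (by positivity)]
  exact norm_one_sub_div_le _ _

theorem norm_ZLamMu_le_of_le {ε₁ ε₂ : ℂ} {lam mu : YoungDiagram} {α m : ℂ} {δ : ℝ} (hδ : 0 < δ)
    (h : ∀ c ∈ lam.cells, δ ≤ ‖boxDenom ε₁ ε₂ lam mu α c‖) :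
    ‖ZLamMu ε₁ ε₂ lam mu α m‖ ≤ Real.exp (Real.log (1 + ‖m‖ / δ) * lam.card) := by
  refine (norm_ZLamMu_le_exp_sum _ _ _ _ _ _).trans (Real.exp_le_exp.2 ?_)
  calc _ ≤ ∑ _c ∈ lam.cells, Real.log (1 + ‖m‖ / δ) := by
        refine Finset.sum_le_sum fun c hc => ?_
        have := h c hc
        gcongr
    _ = _ := by rw [Finset.sum_const, nsmul_eq_mul, mul_comm]

/-! ### Radius at least one away from the positive half-line -/

/-- A point off `[0, ∞)` and the point `1` can be rotated into opposite half-planes. -/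
theorem exists_rotation {w : ℂ} (hw : ¬ ∃ x : ℝ, 0 ≤ x ∧ w = (x : ℂ)) :
    ∃ ζ : ℂ, 1 ≤ ζ.re ∧ (ζ * w).re ≤ -1 := by
  by_cases him : w.im = 0
  · have hneg : w.re < 0 := by
      by_contra hge
      exact hw ⟨w.re, not_lt.1 hge, Complex.ext (by simp) (by simp [him])⟩
    refine ⟨((1 + (-w.re)⁻¹ : ℝ) : ℂ), ?_, ?_⟩
    · have : 0 < (-w.re)⁻¹ := by rw [inv_pos]; linarith
      rw [Complex.ofReal_re]
      linarith
    · rw [Complex.re_ofReal_mul]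
      have : (-w.re)⁻¹ * w.re = -1 := by rw [inv_neg, neg_mul, inv_mul_cancel₀ hneg.ne]
      linarith
  · refine ⟨⟨1, (w.re + 1) / w.im⟩, by simp, ?_⟩
    rw [Complex.mul_re]
    simp only [one_mul]
    rw [div_mul_cancel₀ _ him]
    linarith

section Monotone

variable {ε₁ ε₂ ζ : ℂ}

/-- Away from `ε₁ / ε₂ ∈ [0, ∞)` the denominators are strictly monotone along rows and columns once
projected to a suitable real line. -/
theorem re_boxDenom_row (h0 : ε₂ ≠ 0) (h1 : 1 ≤ ζ.re) (h2 : (ζ * (ε₁ / ε₂)).re ≤ -1)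
    (lam mu : YoungDiagram) (α : ℂ) (i : ℕ) {j j' : ℕ} (hj : j < j') :
    (ζ / ε₂ * boxDenom ε₁ ε₂ lam mu α (i, j')).re + 1 ≤
      (ζ / ε₂ * boxDenom ε₁ ε₂ lam mu α (i, j)).re := by
  have hL : (mu.colLen j' : ℝ) ≤ mu.colLen j := by exact_mod_cast mu.colLen_anti _ _ hj.le
  have hJ : (j : ℝ) + 1 ≤ j' := by exact_mod_cast hj
  have e : ζ / ε₂ * boxDenom ε₁ ε₂ lam mu α (i, j) - ζ / ε₂ * boxDenom ε₁ ε₂ lam mu α (i, j') =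
      (((j' : ℝ) - j : ℝ) : ℂ) * ζ -
        (((mu.colLen j : ℝ) - mu.colLen j' : ℝ) : ℂ) * (ζ * (ε₁ / ε₂)) := by
    simp only [boxDenom]
    push_cast
    field_simp
    ring
  have e' := congrArg Complex.re e
  rw [Complex.sub_re, Complex.sub_re, Complex.re_ofReal_mul, Complex.re_ofReal_mul] at e'
  nlinarith

theorem re_boxDenom_col (h0 : ε₂ ≠ 0) (h1 : 1 ≤ ζ.re) (h2 : (ζ * (ε₁ / ε₂)).re ≤ -1)
    (lam mu : YoungDiagram) (α : ℂ) (j : ℕ) {i i' : ℕ} (hi : i < i') :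
    (ζ / ε₂ * boxDenom ε₁ ε₂ lam mu α (i', j)).re + 1 ≤
      (ζ / ε₂ * boxDenom ε₁ ε₂ lam mu α (i, j)).re := by
  have hL : (lam.rowLen i' : ℝ) ≤ lam.rowLen i := by exact_mod_cast lam.rowLen_anti _ _ hi.le
  have hJ : (i : ℝ) + 1 ≤ i' := by exact_mod_cast hi
  have e : ζ / ε₂ * boxDenom ε₁ ε₂ lam mu α (i, j) - ζ / ε₂ * boxDenom ε₁ ε₂ lam mu α (i', j) =
      (((lam.rowLen i : ℝ) - lam.rowLen i' : ℝ) : ℂ) * ζ -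
        (((i' : ℝ) - i : ℝ) : ℂ) * (ζ * (ε₁ / ε₂)) := by
    simp only [boxDenom]
    push_cast
    field_simp
    ring
  have e' := congrArg Complex.re e
  rw [Complex.sub_re, Complex.sub_re, Complex.re_ofReal_mul, Complex.re_ofReal_mul] at e'
  nlinarith

end Monotone

/-- Finitely many indices take values in `[-V, V]` under a function that drops by at least one at
each step. -/
theorem card_le_of_separated {ι : Type*} (S : Finset ι) (f : ι → ℝ) {V : ℕ}
    (hsep : ∀ x ∈ S, ∀ y ∈ S, x ≠ y → f x + 1 ≤ f y ∨ f y + 1 ≤ f x)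
    (hV : ∀ x ∈ S, |f x| ≤ V) : S.card ≤ 2 * V + 1 := by
  have hcard : (Finset.Icc (-(V : ℤ)) V).card = 2 * V + 1 := by
    rw [Int.card_Icc]; omega
  rw [← hcard]
  refine Finset.card_le_card_of_injOn (fun x => ⌊f x⌋) ?_ ?_
  · intro x hx
    have := abs_le.1 (hV x hx)
    refine Finset.mem_coe.2 (Finset.mem_Icc.2 ⟨Int.le_floor.2 (by push_cast; linarith), ?_⟩)
    have h2 : (⌊f x⌋ : ℝ) ≤ V := (Int.floor_le _).trans this.2
    exact_mod_cast h2
  · intro x hx y hy hxy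
    by_contra hne
    have hxy' : ⌊f x⌋ = ⌊f y⌋ := hxy
    have h1 := Int.floor_le (f x)
    have h2 := Int.lt_floor_add_one (f x)
    have h3 := Int.floor_le (f y)
    have h4 := Int.lt_floor_add_one (f y)
    rw [hxy'] at h1 h2
    rcases hsep x hx y hy hne with h | h <;> linarith

/-- Away from `ε₁ / ε₂ ∈ [0, ∞)` the factor `Z_{λμ}` is subexponential in `|λ|`, since all but a
sparse set of denominators are large. -/
theorem exists_norm_ZLamMu_le {ε₁ ε₂ : ℂ} (h0 : ε₂ ≠ 0)
    (hw : ¬ ∃ x : ℝ, 0 ≤ x ∧ ε₁ / ε₂ = (x : ℂ)) (m : ℂ) {δ η : ℝ} (hδ : 0 < δ) (hη : 0 < η) :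
    ∃ K : ℝ, 0 ≤ K ∧ ∀ (α : ℂ) (lam mu : YoungDiagram),
      (∀ c ∈ lam.cells, δ ≤ ‖boxDenom ε₁ ε₂ lam mu α c‖) →
        ‖ZLamMu ε₁ ε₂ lam mu α m‖ ≤ K * Real.exp (η * lam.card) := by
  obtain ⟨ζ, h1, h2⟩ := exists_rotation hw
  -- Denominators of norm at least `H` contribute at most `η / 2` per box.
  obtain ⟨H, hH0, hH⟩ : ∃ H : ℝ, 0 < H ∧ ‖m‖ / H ≤ η / 2 := by
    refine ⟨‖m‖ / (η / 2) + 1, by positivity, ?_⟩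
    rw [div_le_iff₀ (by positivity)]
    have : η / 2 * (‖m‖ / (η / 2)) = ‖m‖ := by field_simp
    nlinarith
  obtain ⟨V, hV⟩ := exists_nat_ge (‖ζ / ε₂‖ * H)
  set W := Real.log (1 + ‖m‖ / δ) with hWdef
  have hW0 : 0 ≤ W := Real.log_nonneg (by have : 0 ≤ ‖m‖ / δ := by positivity
                                          linarith)
  obtain ⟨K, hK0, hK⟩ := YoungDiagram.exists_card_sparse_le (2 * V + 1)
    (η := η / 2 / (W + 1)) (by positivity)
  refine ⟨Real.exp (W * K), by positivity, fun α lam mu hden => ?_⟩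
  refine (norm_ZLamMu_le_exp_sum _ _ _ _ _ _).trans ?_
  rw [← Real.exp_add]
  refine Real.exp_le_exp.2 ?_
  set S := lam.cells.filter fun c => ‖boxDenom ε₁ ε₂ lam mu α c‖ < H with hS
  have hre : ∀ c ∈ S, |(ζ / ε₂ * boxDenom ε₁ ε₂ lam mu α c).re| ≤ V := by
    intro c hc
    refine (Complex.abs_re_le_norm _).trans ?_
    rw [norm_mul]
    refine le_trans ?_ hV
    have := (Finset.mem_filter.1 hc).2.le
    gcongr
  have hScard : (S.card : ℝ) ≤ K + η / 2 / (W + 1) * lam.card := by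
    refine hK lam S (Finset.filter_subset _ _) (fun i => ?_) (fun j => ?_)
    · refine card_le_of_separated _ (fun c => (ζ / ε₂ * boxDenom ε₁ ε₂ lam mu α c).re) ?_
        fun c hc => hre c (Finset.mem_filter.1 hc).1
      rintro ⟨i1, j1⟩ hx ⟨i2, j2⟩ hy hne
      obtain rfl : i1 = i := (Finset.mem_filter.1 hx).2
      obtain rfl : i2 = i1 := (Finset.mem_filter.1 hy).2
      rcases lt_trichotomy j1 j2 with h | h | h
      · exact Or.inr (re_boxDenom_row h0 h1 h2 lam mu α _ h)
      · exact absurd (by rw [h]) hne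
      · exact Or.inl (re_boxDenom_row h0 h1 h2 lam mu α _ h)
    · refine card_le_of_separated _ (fun c => (ζ / ε₂ * boxDenom ε₁ ε₂ lam mu α c).re) ?_
        fun c hc => hre c (Finset.mem_filter.1 hc).1
      rintro ⟨i1, j1⟩ hx ⟨i2, j2⟩ hy hne
      obtain rfl : j1 = j := (Finset.mem_filter.1 hx).2
      obtain rfl : j2 = j1 := (Finset.mem_filter.1 hy).2
      rcases lt_trichotomy i1 i2 with h | h | h
      · exact Or.inr (re_boxDenom_col h0 h1 h2 lam mu α _ h)
      · exact absurd (by rw [h]) hne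
      · exact Or.inl (re_boxDenom_col h0 h1 h2 lam mu α _ h)
  calc ∑ c ∈ lam.cells, Real.log (1 + ‖m‖ / ‖boxDenom ε₁ ε₂ lam mu α c‖)
      ≤ ∑ c ∈ lam.cells, (η / 2 + if ‖boxDenom ε₁ ε₂ lam mu α c‖ < H then W else 0) := by
        refine Finset.sum_le_sum fun c hc => ?_
        split_ifs with hlt
        · have h3 : Real.log (1 + ‖m‖ / ‖boxDenom ε₁ ε₂ lam mu α c‖) ≤ W := by
            have := hden c hc
            rw [hWdef]
            gcongr
          linarith
        · rw [not_lt] at hlt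
          calc Real.log (1 + ‖m‖ / ‖boxDenom ε₁ ε₂ lam mu α c‖)
              ≤ 1 + ‖m‖ / ‖boxDenom ε₁ ε₂ lam mu α c‖ - 1 :=
                Real.log_le_sub_one_of_pos (by positivity)
            _ = ‖m‖ / ‖boxDenom ε₁ ε₂ lam mu α c‖ := by ring
            _ ≤ ‖m‖ / H := by gcongr
            _ ≤ η / 2 + 0 := by linarith
    _ = η / 2 * lam.card + W * S.card := by
        rw [Finset.sum_add_distrib, ← Finset.sum_filter, Finset.sum_const, Finset.sum_const,
          nsmul_eq_mul, nsmul_eq_mul, ← hS]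
        simp only [YoungDiagram.card]
        ring
    _ ≤ η / 2 * lam.card + W * (K + η / 2 / (W + 1) * lam.card) := by gcongr
    _ ≤ W * K + η * lam.card := by
        have h4 : W * (η / 2 / (W + 1)) ≤ η / 2 := by
          rw [← mul_div_assoc, div_le_iff₀ (by positivity)]
          nlinarith
        have h5 : (0 : ℝ) ≤ lam.card := by positivity
        nlinarith

/-! ### Arms, legs and denominators -/

/-- The arm length of a box: the number of boxes strictly to its right. -/
def YoungDiagram.arm (lam : YoungDiagram) (c : ℕ × ℕ) : ℕ := lam.rowLen c.1 - c.2 - 1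

/-- The leg length of a box: the number of boxes strictly below it. -/
def YoungDiagram.leg (lam : YoungDiagram) (c : ℕ × ℕ) : ℕ := lam.colLen c.2 - c.1 - 1

namespace YoungDiagram

theorem arm_add {lam : YoungDiagram} {c : ℕ × ℕ} (hc : c ∈ lam.cells) :
    lam.arm c + c.2 + 1 = lam.rowLen c.1 := by
  have : c.2 < lam.rowLen c.1 := mem_iff_lt_rowLen.1 ((mem_cells _).1 hc)
  rw [arm]; omega

theorem leg_add {lam : YoungDiagram} {c : ℕ × ℕ} (hc : c ∈ lam.cells) :
    lam.leg c + c.1 + 1 = lam.colLen c.2 := by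
  have : c.1 < lam.colLen c.2 := mem_iff_lt_colLen.1 ((mem_cells _).1 hc)
  rw [leg]; omega

theorem arm_transpose (lam : YoungDiagram) (c : ℕ × ℕ) : lam.transpose.arm c.swap = lam.leg c := by
  simp [arm, leg]

theorem leg_transpose (lam : YoungDiagram) (c : ℕ × ℕ) : lam.transpose.leg c.swap = lam.arm c := by
  simp [arm, leg]

end YoungDiagram

section

variable {ε₁ ε₂ : ℂ}

theorem boxDenom_of_mem {lam mu : YoungDiagram} (α : ℂ) {c : ℕ × ℕ} (hc : c ∈ lam.cells) :
    boxDenom ε₁ ε₂ lam mu α c =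
      α - ((mu.colLen c.2 : ℂ) - c.1 - 1) * ε₁ + (lam.arm c : ℂ) * ε₂ := by
  have h : ((lam.arm c : ℂ) + c.2 + 1) = lam.rowLen c.1 := by
    exact_mod_cast YoungDiagram.arm_add hc
  rw [boxDenom, ← h]
  ring

theorem boxDenom_self_right {lam : YoungDiagram} {c : ℕ × ℕ} (hc : c ∈ lam.cells) (z : ℂ) :
    boxDenom ε₁ ε₂ lam lam (z + ε₂) c = z + (((lam.arm c : ℂ) + 1) * ε₂ - lam.leg c * ε₁) := by
  have h : ((lam.leg c : ℂ) + c.1 + 1) = lam.colLen c.2 := by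
    exact_mod_cast YoungDiagram.leg_add hc
  rw [boxDenom_of_mem _ hc, ← h]
  ring

theorem boxDenom_self_left {lam : YoungDiagram} {c : ℕ × ℕ} (hc : c ∈ lam.cells) (z : ℂ) :
    boxDenom ε₁ ε₂ lam lam (z - ε₁) c = z + (lam.arm c * ε₂ - ((lam.leg c : ℂ) + 1) * ε₁) := by
  have h : ((lam.leg c : ℂ) + c.1 + 1) = lam.colLen c.2 := by
    exact_mod_cast YoungDiagram.leg_add hc
  rw [boxDenom_of_mem _ hc, ← h]
  ring

theorem boxDenom_bot_right {lam : YoungDiagram} {c : ℕ × ℕ} (hc : c ∈ lam.cells) (z : ℂ) :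
    boxDenom ε₁ ε₂ lam ⊥ (z + ε₂) c =
      z + (((lam.arm c : ℂ) + 1) * ε₂ + ((c.1 : ℂ) + 1) * ε₁) := by
  rw [boxDenom_of_mem _ hc, YoungDiagram.colLen_bot]
  push_cast
  ring

theorem boxDenom_bot_left {lam : YoungDiagram} {c : ℕ × ℕ} (hc : c ∈ lam.cells) (z : ℂ) :
    boxDenom ε₁ ε₂ lam ⊥ (z - ε₁) c = z + (lam.arm c * ε₂ + (c.1 : ℂ) * ε₁) := by
  rw [boxDenom_of_mem _ hc, YoungDiagram.colLen_bot]
  push_cast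
  ring

/-- Both kinds of denominators attached to a pair of diagrams are lattice translates of the
Coulomb parameter. -/
theorem exists_boxDenom_eq (lam mu : YoungDiagram) (z : ℂ) (c : ℕ × ℕ) :
    (∃ w ∈ epsLattice ε₁ ε₂, boxDenom ε₁ ε₂ lam mu (z + ε₂) c = z + w) ∧
    ∃ w ∈ epsLattice ε₁ ε₂, boxDenom ε₁ ε₂ lam mu (z - ε₁) c = z + w := by
  refine ⟨⟨_, ⟨(c.1 : ℤ) + 1 - mu.colLen c.2, (lam.rowLen c.1 : ℤ) - c.2, rfl⟩, ?_⟩,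
    ⟨_, ⟨(c.1 : ℤ) - mu.colLen c.2, (lam.rowLen c.1 : ℤ) - c.2 - 1, rfl⟩, ?_⟩⟩
  all_goals
    rw [boxDenom]
    push_cast
    ring

theorem neg_mem_epsLattice {z : ℂ} (h : z ∈ epsLattice ε₁ ε₂) : -z ∈ epsLattice ε₁ ε₂ := by
  obtain ⟨k, l, rfl⟩ := h
  exact ⟨-k, -l, by push_cast; ring⟩

theorem add_mem_epsLattice {z w : ℂ} (h : z ∈ epsLattice ε₁ ε₂) (h' : w ∈ epsLattice ε₁ ε₂) :
    z + w ∈ epsLattice ε₁ ε₂ := by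
  obtain ⟨k, l, rfl⟩ := h
  obtain ⟨k', l', rfl⟩ := h'
  exact ⟨k + k', l + l', by push_cast; ring⟩

theorem sub_mem_epsLattice {z w : ℂ} (h : z ∈ epsLattice ε₁ ε₂) (h' : w ∈ epsLattice ε₁ ε₂) :
    z - w ∈ epsLattice ε₁ ε₂ := by
  rw [sub_eq_add_neg]
  exact add_mem_epsLattice h (neg_mem_epsLattice h')

variable {N : ℕ} {m : ℂ} {a : Fin N → ℂ}

theorem GenericParams.exists_le_norm_add (hg : GenericParams m a ε₁ ε₂) {I J : Fin N}
    (hIJ : I ≠ J) : ∃ δ : ℝ, 0 < δ ∧ ∀ w ∈ epsLattice ε₁ ε₂, δ ≤ ‖a I - a J + w‖ := by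
  have key : ∀ I J, I < J → ∃ δ : ℝ, 0 < δ ∧ ∀ w ∈ epsLattice ε₁ ε₂, δ ≤ ‖a I - a J + w‖ := by
    intro I J h
    have := hg.coulomb I J h
    rw [Metric.mem_closure_iff] at this
    push Not at this
    obtain ⟨δ, hδ, hd⟩ := this
    refine ⟨δ, hδ, fun w hw => ?_⟩
    have := hd _ (neg_mem_epsLattice hw)
    rwa [dist_eq_norm, sub_neg_eq_add] at this
  rcases lt_or_gt_of_ne hIJ with h | h
  · exact key I J h
  · obtain ⟨δ, hδ, hd⟩ := key J I h
    refine ⟨δ, hδ, fun w hw => ?_⟩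
    have := hd _ (neg_mem_epsLattice hw)
    rwa [show a I - a J + w = -(a J - a I + -w) by ring, norm_neg]

theorem GenericParams.sub_notMem_epsLattice (hg : GenericParams m a ε₁ ε₂) {I J : Fin N}
    (hIJ : I ≠ J) : a I - a J ∉ epsLattice ε₁ ε₂ := by
  intro h
  obtain ⟨δ, hδ, hd⟩ := hg.exists_le_norm_add hIJ
  have := hd _ (neg_mem_epsLattice h)
  rw [add_neg_cancel, norm_zero] at this
  linarith

theorem GenericParams.mass_notMem (hg : GenericParams m a ε₁ ε₂) : m ∉ epsLattice ε₁ ε₂ :=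
  fun h => hg.mass (subset_closure h)

theorem GenericParams.mass_ne_zero (hg : GenericParams m a ε₁ ε₂) : m ≠ 0 := fun h =>
  hg.mass_notMem ⟨0, 0, by simp [h]⟩

theorem exists_le_norm_boxDenom_self (h0 : ε₂ ≠ 0)
    (hw : ¬ ∃ x : ℝ, 0 ≤ x ∧ ε₁ / ε₂ = (x : ℂ)) :
    ∃ δ : ℝ, 0 < δ ∧ ∀ (lam : YoungDiagram), ∀ c ∈ lam.cells,
      δ ≤ ‖boxDenom ε₁ ε₂ lam lam (0 + ε₂) c‖ ∧ δ ≤ ‖boxDenom ε₁ ε₂ lam lam (0 - ε₁) c‖ := by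
  obtain ⟨ζ, h1, h2⟩ := exists_rotation hw
  have hζ : ζ ≠ 0 := by
    rintro rfl
    simp at h1
    linarith
  have hpos : 0 < ‖ζ / ε₂‖ := norm_pos_iff.2 (div_ne_zero hζ h0)
  have key : ∀ z : ℂ, 1 ≤ (ζ / ε₂ * z).re → ‖ζ / ε₂‖⁻¹ ≤ ‖z‖ := by
    intro z hz
    rw [inv_le_iff_one_le_mul₀ hpos, mul_comm, ← norm_mul]
    exact hz.trans (Complex.re_le_norm _)
  have lin : ∀ s t : ℝ, (ζ / ε₂ * ((s : ℂ) * ε₂ - (t : ℂ) * ε₁)).re =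
      s * ζ.re - t * (ζ * (ε₁ / ε₂)).re := by
    intro s t
    rw [← Complex.re_ofReal_mul, ← Complex.re_ofReal_mul, ← Complex.sub_re]
    congr 1
    field_simp
  refine ⟨‖ζ / ε₂‖⁻¹, inv_pos.2 hpos, fun lam c hc => ⟨key _ ?_, key _ ?_⟩⟩
  · rw [boxDenom_self_right hc, zero_add]
    have := lin ((lam.arm c : ℝ) + 1) (lam.leg c)
    push_cast at this
    rw [this]
    have hA : (0 : ℝ) ≤ lam.arm c := by positivity
    have hL : (0 : ℝ) ≤ lam.leg c := by positivity
    nlinarith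
  · rw [boxDenom_self_left hc, zero_add]
    have := lin (lam.arm c) ((lam.leg c : ℝ) + 1)
    push_cast at this
    rw [this]
    have hA : (0 : ℝ) ≤ lam.arm c := by positivity
    have hL : (0 : ℝ) ≤ lam.leg c := by positivity
    nlinarith

theorem GenericParams.exists_le_norm_boxDenom (hg : GenericParams m a ε₁ ε₂)
    (hw : ¬ ∃ x : ℝ, 0 ≤ x ∧ ε₁ / ε₂ = (x : ℂ)) (I J : Fin N) :
    ∃ δ : ℝ, 0 < δ ∧ ∀ (Y : Fin N → YoungDiagram), ∀ c ∈ (Y I).cells,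
      δ ≤ ‖boxDenom ε₁ ε₂ (Y I) (Y J) (a I - a J + ε₂) c‖ ∧
      δ ≤ ‖boxDenom ε₁ ε₂ (Y I) (Y J) (a I - a J - ε₁) c‖ := by
  by_cases hIJ : I = J
  · subst hIJ
    obtain ⟨δ, hδ, hd⟩ := exists_le_norm_boxDenom_self hg.ne_zero₂ hw
    refine ⟨δ, hδ, fun Y c hc => ?_⟩
    rw [sub_self]
    exact hd (Y I) c hc
  · obtain ⟨δ, hδ, hd⟩ := hg.exists_le_norm_add hIJ
    refine ⟨δ, hδ, fun Y c _ => ?_⟩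
    obtain ⟨⟨w, hw1, h1⟩, ⟨w', hw2, h2⟩⟩ :=
      exists_boxDenom_eq (ε₁ := ε₁) (ε₂ := ε₂) (Y I) (Y J) (a I - a J) c
    rw [h1, h2]
    exact ⟨hd w hw1, hd w' hw2⟩

theorem GenericParams.ZTermDefined_of_not_nonneg (hg : GenericParams m a ε₁ ε₂)
    (hw : ¬ ∃ x : ℝ, 0 ≤ x ∧ ε₁ / ε₂ = (x : ℂ)) (Y : Fin N → YoungDiagram) :
    ZTermDefined a ε₁ ε₂ Y := by
  intro I J c hc
  obtain ⟨δ, hδ, hd⟩ := hg.exists_le_norm_boxDenom hw I J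
  obtain ⟨h1, h2⟩ := hd Y c hc
  exact ⟨norm_pos_iff.1 (hδ.trans_le h1), norm_pos_iff.1 (hδ.trans_le h2)⟩

theorem GenericParams.one_le_Rabs (hg : GenericParams m a ε₁ ε₂)
    (hw : ¬ ∃ x : ℝ, 0 ≤ x ∧ ε₁ / ε₂ = (x : ℂ)) : 1 ≤ Rabs m a ε₁ ε₂ := by
  have step : ∀ η : ℝ, 0 < η → ENNReal.ofReal (Real.exp (-(N * (2 * η)))) ≤ Rabs m a ε₁ ε₂ := by
    intro η hη
    have key : ∀ I J : Fin N, ∃ K : ℝ, 0 ≤ K ∧ ∀ Y : Fin N → YoungDiagram,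
        ‖ZLamMu ε₁ ε₂ (Y I) (Y J) (a I - a J + ε₂) m *
          ZLamMu ε₁ ε₂ (Y I) (Y J) (a I - a J - ε₁) (-m)‖ ≤
            K * Real.exp (2 * η * (Y I).card) := by
      intro I J
      obtain ⟨δ, hδ, hd⟩ := hg.exists_le_norm_boxDenom hw I J
      obtain ⟨K1, hK1, hb1⟩ := exists_norm_ZLamMu_le hg.ne_zero₂ hw m hδ hη
      obtain ⟨K2, hK2, hb2⟩ := exists_norm_ZLamMu_le hg.ne_zero₂ hw (-m) hδ hη
      refine ⟨K1 * K2, by positivity, fun Y => ?_⟩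
      rw [norm_mul]
      calc _ ≤ (K1 * Real.exp (η * (Y I).card)) * (K2 * Real.exp (η * (Y I).card)) :=
            mul_le_mul (hb1 _ _ _ fun c hc => (hd Y c hc).1) (hb2 _ _ _ fun c hc => (hd Y c hc).2)
              (norm_nonneg _) (by positivity)
        _ = K1 * K2 * Real.exp (2 * η * (Y I).card) := by
            rw [show 2 * η * ((Y I).card : ℝ) = η * (Y I).card + η * (Y I).card by ring,
              Real.exp_add]
            ring
    choose K hK hb using key
    exact exp_neg_le_Rabs fun Y =>
      norm_ZTerm_le (c := fun _ _ => 2 * η) hK (fun I => by simp) hb Y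
  have hlim : Tendsto (fun η : ℝ => ENNReal.ofReal (Real.exp (-(N * (2 * η))))) (𝓝[>] 0) (𝓝 1) := by
    have hc : Continuous fun η : ℝ => ENNReal.ofReal (Real.exp (-(N * (2 * η)))) :=
      ENNReal.continuous_ofReal.comp (by fun_prop)
    have := (hc.tendsto 0).mono_left (nhdsWithin_le_nhds (s := Set.Ioi 0))
    simpa using this
  exact le_of_tendsto hlim (eventually_nhdsWithin_of_forall fun η hη => step η hη)

end

/-! ### Radius at most one: diagrams with a single row -/

/-- The vertex `I` is unobstructed when no box placed in the `I`-th diagram alone makes an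
off-diagonal numerator vanish, whatever the diagram. -/
def Unobstructed {N : ℕ} (m : ℂ) (a : Fin N → ℂ) (ε₁ ε₂ : ℂ) (I : Fin N) : Prop :=
  ∀ J, ∀ k l : ℕ, a I - a J + (((k : ℂ) + 1) * ε₂ + ((l : ℂ) + 1) * ε₁) ≠ m ∧
    a I - a J + (k * ε₂ + l * ε₁) ≠ -m

section

variable {ε₁ ε₂ : ℂ} {N : ℕ} {m : ℂ} {a : Fin N → ℂ}

theorem GenericParams.eq_of_sub_mem (hg : GenericParams m a ε₁ ε₂) {I J : Fin N}
    (h : a I - a J ∈ epsLattice ε₁ ε₂) : I = J := by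
  by_contra hne
  exact hg.sub_notMem_epsLattice hne h

/-- If every vertex is obstructed, then the relation `a I - a J - m ∈ ε₁ ℤ + ε₂ ℤ` permutes the
vertices, and all the corresponding lattice points `k ε₂ + l ε₁` lie in the two opposite quadrants
`k, l < 0` and `k, l ≥ 0`, which the numerators of a tuple of equal one-row diagrams avoid. The relation is a partial injection because distinct `a I` are
distinct modulo the lattice; being nonnegative propagates backwards along it. -/
theorem GenericParams.exists_edge_of_obstructed (hg : GenericParams m a ε₁ ε₂)
    (hlin : ∀ k l : ℤ, (k : ℂ) * ε₂ + l * ε₁ = 0 → k = 0 ∧ l = 0)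
    (hobs : ∀ I, ¬ Unobstructed m a ε₁ ε₂ I) (I : Fin N) :
    ∃ J, (∃ k l : ℕ, a I - a J - m = -(((k : ℂ) + 1) * ε₂ + ((l : ℂ) + 1) * ε₁)) ∨
      ∃ k l : ℕ, a I - a J - m = k * ε₂ + l * ε₁ := by
  have hmem : ∀ k l : ℤ, (k : ℂ) * ε₂ + l * ε₁ ∈ epsLattice ε₁ ε₂ := fun k l => ⟨l, k, add_comm _ _⟩
  have hobs' : ∀ I, (∃ J, ∃ k l : ℕ, a I - a J - m = -(((k : ℂ) + 1) * ε₂ + ((l : ℂ) + 1) * ε₁)) ∨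
      ∃ J, ∃ k l : ℕ, a J - a I - m = k * ε₂ + l * ε₁ := by
    intro I
    have := hobs I
    unfold Unobstructed at this
    push Not at this
    obtain ⟨J, k, l, h⟩ := this
    by_cases h1 : a I - a J + (((k : ℂ) + 1) * ε₂ + ((l : ℂ) + 1) * ε₁) = m
    · exact Or.inl ⟨J, k, l, by rw [← h1]; ring⟩
    · refine Or.inr ⟨J, k, l, ?_⟩
      have h2 := h h1
      linear_combination -h2
  let Q : Type := {I : Fin N // ∃ J, ∃ k l : ℕ, a J - a I - m = k * ε₂ + l * ε₁}
  have hpred : ∀ I : Q, ∃ J : Q, ∃ k l : ℕ, a J.1 - a I.1 - m = k * ε₂ + l * ε₁ := by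
    rintro ⟨I, J, k, l, h⟩
    refine ⟨⟨J, ?_⟩, k, l, h⟩
    rcases hobs' J with ⟨K, k', l', h'⟩ | hJ
    · exfalso
      have hIK : I = K := by
        apply hg.eq_of_sub_mem
        have e : a I - a K = ((-(k' + 1 : ℤ) - k : ℤ) : ℂ) * ε₂ + ((-(l' + 1 : ℤ) - l : ℤ) : ℂ) * ε₁ := by
          push_cast
          linear_combination h' - h
        rw [e]
        exact hmem _ _
      subst hIK
      have := (hlin (k + (k' + 1)) (l + (l' + 1))
        (by push_cast; linear_combination h' - h)).1
      omega
    · exact hJ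
  choose pred hp using hpred
  have hinj : Function.Injective pred := by
    intro I I' h
    obtain ⟨k, l, h1⟩ := hp I
    obtain ⟨k', l', h2⟩ := hp I'
    rw [← h] at h2
    apply Subtype.ext
    apply hg.eq_of_sub_mem
    have e : a I.1 - a I'.1 = ((k' - k : ℤ) : ℂ) * ε₂ + ((l' - l : ℤ) : ℂ) * ε₁ := by
      push_cast
      linear_combination h2 - h1
    rw [e]
    exact hmem _ _
  rcases hobs' I with ⟨J, h⟩ | h
  · exact ⟨J, Or.inl h⟩
  · obtain ⟨I', hI'⟩ := Finite.surjective_of_injective hinj ⟨I, h⟩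
    obtain ⟨k, l, h1⟩ := hp I'
    rw [hI'] at h1
    exact ⟨I'.1, Or.inr ⟨k, l, h1⟩⟩

theorem ZLamMu_bot_left (mu : YoungDiagram) (α m : ℂ) : ZLamMu ε₁ ε₂ ⊥ mu α m = 1 := by
  simp [ZLamMu]

/-- The tuple with the diagram `lam` at `I` and empty diagrams elsewhere. -/
def singleDiagram (I : Fin N) (lam : YoungDiagram) : Fin N → YoungDiagram :=
  Function.update (fun _ => ⊥) I lam

theorem singleDiagram_same (I : Fin N) (lam : YoungDiagram) : singleDiagram I lam I = lam :=
  Function.update_self _ _ _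

theorem singleDiagram_of_ne {I J : Fin N} (h : J ≠ I) (lam : YoungDiagram) :
    singleDiagram I lam J = ⊥ :=
  Function.update_of_ne h _ _

theorem card_bot : (⊥ : YoungDiagram).card = 0 := rfl

theorem totalSize_singleDiagram (I : Fin N) (lam : YoungDiagram) :
    totalSize (singleDiagram I lam) = lam.card := by
  rw [totalSize, Finset.sum_eq_single I]
  · rw [singleDiagram_same]
  · intro J _ hJ
    rw [singleDiagram_of_ne hJ, card_bot]
  · simp

theorem ZTerm_singleDiagram (I : Fin N) (lam : YoungDiagram) :
    ZTerm m a ε₁ ε₂ (singleDiagram I lam) =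
      ∏ J, (ZLamMu ε₁ ε₂ lam (singleDiagram I lam J) (a I - a J + ε₂) m *
        ZLamMu ε₁ ε₂ lam (singleDiagram I lam J) (a I - a J - ε₁) (-m)) := by
  rw [ZTerm, Finset.prod_eq_single I]
  · rw [singleDiagram_same]
  · intro J _ hJ
    refine Finset.prod_eq_one fun K _ => ?_
    rw [singleDiagram_of_ne hJ, ZLamMu_bot_left, ZLamMu_bot_left, mul_one]
  · simp

/-- For a one-row diagram the denominators form an arithmetic progression. -/
theorem ZLamMu_row {mu : YoungDiagram} {n e : ℕ} (he : ∀ j < n, mu.colLen j = e) (α m : ℂ) :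
    ZLamMu ε₁ ε₂ (YoungDiagram.rect 1 n) mu α m =
      ∏ A ∈ Finset.range n, (1 - m / (α - ((e : ℂ) - 1) * ε₁ + A * ε₂)) := by
  have hcells : (YoungDiagram.rect 1 n).cells = Finset.range 1 ×ˢ Finset.range n := rfl
  rw [ZLamMu, hcells, Finset.prod_product, Finset.prod_range_one,
    ← Finset.prod_range_reflect]
  refine Finset.prod_congr rfl fun j hj => ?_
  have hj' := Finset.mem_range.1 hj
  rw [boxDenom, YoungDiagram.rowLen_rect Nat.one_pos, he (n - 1 - j) (by omega)]
  have : ((n - 1 - j : ℕ) : ℂ) = (n : ℂ) - (j + 1) := by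
    rw [Nat.sub_sub, Nat.cast_sub (by omega)]
    push_cast
    ring
  simp only [this]
  congr 2
  push_cast
  ring

/-- Convergence fails beyond `|𝔮| = 1` as soon as some sequence of tuples of linearly growing size
has terms whose successive ratios tend to one. -/
theorem le_one_of_tendsto_ratio {Y : ℕ → Fin N → YoungDiagram} (hY : Function.Injective Y)
    {k : ℕ} (hk : k ≠ 0) (hsize : ∀ n, totalSize (Y n) = k * n) {g : ℕ → ℂ}
    (hZ : ∀ n, ZTerm m a ε₁ ε₂ (Y n) = ∏ A ∈ Finset.range n, g A) (hg0 : ∀ A, g A ≠ 0)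
    (hg1 : Tendsto g atTop (𝓝 1)) {r : ℝ} (hr : 0 ≤ r) (hs : AbsSumConverges m a ε₁ ε₂ r) :
    r ≤ 1 := by
  by_contra hlt
  rw [not_le] at hlt
  have hs' := hs.comp_injective hY
  refine not_summable_of_ratio_test_tendsto_gt_one (l := r ^ k) (one_lt_pow₀ hlt hk) ?_ hs'
  have hlim : Tendsto (fun n => r ^ k * ‖g n‖) atTop (𝓝 (r ^ k)) := by
    simpa using (hg1.norm.const_mul (r ^ k))
  refine hlim.congr fun n => ?_
  have hn : ‖∏ A ∈ Finset.range n, g A‖ ≠ 0 :=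
    norm_ne_zero_iff.2 (Finset.prod_ne_zero_iff.2 fun A _ => hg0 A)
  have hrn : r ^ (k * n) ≠ 0 := by positivity
  simp only [Function.comp_apply, hsize, hZ, norm_mul, norm_pow, Real.norm_eq_abs,
    Finset.prod_range_succ, abs_norm, abs_of_nonneg hr]
  rw [Nat.mul_succ, pow_add]
  field_simp

theorem tendsto_one_sub_div (h0 : ε₂ ≠ 0) (α m : ℂ) :
    Tendsto (fun A : ℕ => 1 - m / (α + A * ε₂)) atTop (𝓝 1) := by
  have h1 : Tendsto (fun A : ℕ => α + (A : ℂ) * ε₂) atTop (Bornology.cobounded ℂ) := by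
    rw [← tendsto_norm_atTop_iff_cobounded]
    have h2 : Tendsto (fun A : ℕ => (A : ℝ) * ‖ε₂‖ + -‖α‖) atTop atTop :=
      tendsto_atTop_add_const_right _ _
        (tendsto_natCast_atTop_atTop.atTop_mul_const (norm_pos_iff.2 h0))
    refine tendsto_atTop_mono (fun A => ?_) h2
    have h3 : ‖(A : ℂ) * ε₂‖ ≤ ‖α + A * ε₂‖ + ‖α‖ := by
      calc ‖(A : ℂ) * ε₂‖ = ‖(α + A * ε₂) - α‖ := by congr 1; ring
        _ ≤ _ := norm_sub_le _ _
    rw [norm_mul, Complex.norm_natCast] at h3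
    linarith
  have h4 := (tendsto_inv₀_cobounded.comp h1).const_mul m
  simpa [div_eq_mul_inv] using h4.const_sub 1

theorem one_sub_div_ne_zero {m d : ℂ} (h : d ≠ m) : 1 - m / d ≠ 0 := by
  intro h0
  by_cases hd : d = 0
  · simp [hd] at h0
  · apply h
    rw [sub_eq_zero, eq_div_iff hd, one_mul] at h0
    exact h0

theorem rect_one_injective : Function.Injective fun n => YoungDiagram.rect 1 n := by
  intro n n' h
  have := congrArg YoungDiagram.card h
  simpa [YoungDiagram.card_rect] using this

theorem GenericParams.le_one_of_unobstructed (hg : GenericParams m a ε₁ ε₂) {I : Fin N}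
    (hI : Unobstructed m a ε₁ ε₂ I) {r : ℝ} (hr : 0 ≤ r) (hs : AbsSumConverges m a ε₁ ε₂ r) :
    r ≤ 1 := by
  let e : Fin N → ℕ := fun J => if J = I then 1 else 0
  have he : ∀ n J, ∀ j < n, (singleDiagram I (YoungDiagram.rect 1 n) J).colLen j = e J := by
    intro n J j hj
    by_cases h : J = I
    · subst h
      rw [singleDiagram_same, YoungDiagram.colLen_rect hj]
      simp [e]
    · rw [singleDiagram_of_ne h, YoungDiagram.colLen_bot]
      simp [e, h]
  refine le_one_of_tendsto_ratio (Y := fun n => singleDiagram I (YoungDiagram.rect 1 n))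
    (k := 1) (g := fun A => ∏ J, ((1 - m / (a I - a J + ε₂ - ((e J : ℂ) - 1) * ε₁ + A * ε₂)) *
      (1 - -m / (a I - a J - ε₁ - ((e J : ℂ) - 1) * ε₁ + A * ε₂)))) ?_ one_ne_zero ?_ ?_ ?_ ?_ hr hs
  · intro n n' h
    apply rect_one_injective
    have := congrFun h I
    simpa only [singleDiagram_same] using this
  · intro n
    rw [totalSize_singleDiagram, YoungDiagram.card_rect]
  · intro n
    rw [ZTerm_singleDiagram, Finset.prod_comm]
    refine Finset.prod_congr rfl fun J _ => ?_
    rw [ZLamMu_row (he n J), ZLamMu_row (he n J), Finset.prod_mul_distrib]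
  · intro A
    refine Finset.prod_ne_zero_iff.2 fun J _ => mul_ne_zero ?_ ?_ <;>
      refine one_sub_div_ne_zero fun h => ?_
    · by_cases hJ : J = I
      · subst hJ
        refine hg.mass_notMem ⟨0, A + 1, ?_⟩
        simp only [e] at h
        rw [← h]
        push_cast
        simp
        ring
      · refine (hI J A 0).1 ?_
        simp only [e, hJ, if_false] at h
        rw [← h]
        push_cast
        ring
    · by_cases hJ : J = I
      · subst hJ
        refine hg.mass_notMem ?_
        rw [← neg_neg m]
        refine neg_mem_epsLattice ⟨-1, A, ?_⟩
        simp only [e] at h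
        rw [← h]
        push_cast
        simp
      · refine (hI J A 0).2 ?_
        simp only [e, hJ, if_false] at h
        rw [← h]
        push_cast
        ring
  · have h := tendsto_finsetProd (Finset.univ : Finset (Fin N)) fun J _ =>
      (tendsto_one_sub_div hg.ne_zero₂ (a I - a J + ε₂ - ((e J : ℂ) - 1) * ε₁) m).mul
        (tendsto_one_sub_div hg.ne_zero₂ (a I - a J - ε₁ - ((e J : ℂ) - 1) * ε₁) (-m))
    simp only [mul_one, Finset.prod_const_one] at h
    exact h

/-- When every vertex has an edge, equal one-row diagrams at all vertices have non-zero terms. -/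
theorem GenericParams.le_one_of_edges (hg : GenericParams m a ε₁ ε₂) (hN : N ≠ 0)
    (hlin : ∀ k l : ℤ, (k : ℂ) * ε₂ + l * ε₁ = 0 → k = 0 ∧ l = 0)
    (hedge : ∀ I, ∃ J, (∃ k l : ℕ, a I - a J - m = -(((k : ℂ) + 1) * ε₂ + ((l : ℂ) + 1) * ε₁)) ∨
      ∃ k l : ℕ, a I - a J - m = k * ε₂ + l * ε₁)
    {r : ℝ} (hr : 0 ≤ r) (hs : AbsSumConverges m a ε₁ ε₂ r) : r ≤ 1 := by
  -- A lattice point `a I - a J - m` with coordinates of strictly opposite type cannot occur.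
  have hno : ∀ I J : Fin N, ∀ k l : ℤ, a I - a J - m = (k : ℂ) * ε₂ + l * ε₁ →
      (k < 0 ∧ l < 0) ∨ (0 ≤ k ∧ 0 ≤ l) := by
    intro I J k l h
    obtain ⟨J', h'⟩ := hedge I
    have hmem : ∀ k l : ℤ, (k : ℂ) * ε₂ + l * ε₁ ∈ epsLattice ε₁ ε₂ :=
      fun k l => ⟨l, k, add_comm _ _⟩
    obtain ⟨k', l', h', hs⟩ : ∃ k' l' : ℤ, a I - a J' - m = (k' : ℂ) * ε₂ + l' * ε₁ ∧
        ((k' < 0 ∧ l' < 0) ∨ (0 ≤ k' ∧ 0 ≤ l')) := by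
      rcases h' with ⟨k', l', h'⟩ | ⟨k', l', h'⟩
      · exact ⟨-(k' + 1), -(l' + 1), by rw [h']; push_cast; ring, Or.inl (by omega)⟩
      · exact ⟨k', l', by rw [h']; push_cast; ring, Or.inr (by omega)⟩
    have hJ : J' = J := by
      apply hg.eq_of_sub_mem
      have : a J' - a J = (a I - a J - m) - (a I - a J' - m) := by ring
      rw [this, h, h']
      exact sub_mem_epsLattice (hmem _ _) (hmem _ _)
    subst hJ
    have := hlin (k - k') (l - l') (by push_cast; linear_combination h' - h)
    omega
  have he : ∀ n, ∀ j < n, (YoungDiagram.rect 1 n).colLen j = 1 := fun n j hj =>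
    YoungDiagram.colLen_rect hj
  refine le_one_of_tendsto_ratio (Y := fun n _ => YoungDiagram.rect 1 n)
    (k := N) (g := fun A => ∏ I, ∏ J,
      ((1 - m / (a I - a J + ε₂ - (((1 : ℕ) : ℂ) - 1) * ε₁ + A * ε₂)) *
      (1 - -m / (a I - a J - ε₁ - (((1 : ℕ) : ℂ) - 1) * ε₁ + A * ε₂)))) ?_ hN ?_ ?_ ?_ ?_ hr hs
  · intro n n' h
    exact rect_one_injective (congrFun h ⟨0, Nat.pos_of_ne_zero hN⟩)
  · intro n
    simp [totalSize, YoungDiagram.card_rect]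
  · intro n
    rw [ZTerm, Finset.prod_comm (s := Finset.range n)]
    refine Finset.prod_congr rfl fun I _ => ?_
    rw [Finset.prod_comm (s := Finset.range n)]
    refine Finset.prod_congr rfl fun J _ => ?_
    rw [ZLamMu_row (he n), ZLamMu_row (he n), Finset.prod_mul_distrib]
  · intro A
    refine Finset.prod_ne_zero_iff.2 fun I _ => Finset.prod_ne_zero_iff.2 fun J _ =>
      mul_ne_zero ?_ ?_ <;> refine one_sub_div_ne_zero fun h => ?_
    · have := hno I J (-(A + 1)) 0 (by push_cast; push_cast at h; linear_combination h)
      omega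
    · have := hno J I A (-1) (by push_cast; push_cast at h; linear_combination -h)
      omega
  · have h := tendsto_finsetProd (Finset.univ : Finset (Fin N)) fun I _ =>
      tendsto_finsetProd (Finset.univ : Finset (Fin N)) fun J _ =>
        (tendsto_one_sub_div hg.ne_zero₂ (a I - a J + ε₂ - (((1 : ℕ) : ℂ) - 1) * ε₁) m).mul
          (tendsto_one_sub_div hg.ne_zero₂ (a I - a J - ε₁ - (((1 : ℕ) : ℂ) - 1) * ε₁) (-m))
    simp only [mul_one, Finset.prod_const_one] at h
    exact h

theorem lattice_relation_eq_zero (h0 : ε₂ ≠ 0) (hw : ∀ r : ℚ, ε₁ / ε₂ ≠ (r : ℂ)) (k l : ℤ)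
    (h : (k : ℂ) * ε₂ + l * ε₁ = 0) : k = 0 ∧ l = 0 := by
  have hl : l = 0 := by
    by_contra hl
    have hl' : (l : ℂ) ≠ 0 := Int.cast_ne_zero.2 hl
    refine hw (-k / l) ?_
    push_cast
    field_simp
    linear_combination h
  subst hl
  simpa [h0] using h

/-- The radius is at most one unless `ε₁ / ε₂` is a nonnegative rational. -/
theorem GenericParams.Rabs_le_one (hg : GenericParams m a ε₁ ε₂) (hN : 1 ≤ N)
    (hw : ∀ r : ℚ, 0 ≤ r → ε₁ / ε₂ ≠ (r : ℂ)) : Rabs m a ε₁ ε₂ ≤ 1 := by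
  rw [← ENNReal.ofReal_one]
  refine Rabs_le_ofReal fun r hr hs => ?_
  by_cases hneg : ∃ r : ℚ, ε₁ / ε₂ = (r : ℂ)
  · obtain ⟨b, hb⟩ := hneg
    have hb0 : b < 0 := not_le.1 fun h => hw b h hb
    refine hg.le_one_of_unobstructed (I := ⟨0, hN⟩) (fun J k l => ⟨fun h => ?_, fun h => ?_⟩) hr hs
    · refine hg.negRat b hb0 hb J ⟨0, hN⟩ ⟨l + 1, k + 1, ?_⟩
      rw [← h]
      push_cast
      ring
    · refine hg.negRat b hb0 hb ⟨0, hN⟩ J ⟨-l, -k, ?_⟩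
      rw [← neg_neg m, ← h]
      push_cast
      ring
  · push Not at hneg
    have hlin := lattice_relation_eq_zero hg.ne_zero₂ hneg
    by_cases hobs : ∃ I, Unobstructed m a ε₁ ε₂ I
    · obtain ⟨I, hI⟩ := hobs
      exact hg.le_one_of_unobstructed hI hr hs
    · push Not at hobs
      exact hg.le_one_of_edges (by omega) hlin (hg.exists_edge_of_obstructed hlin hobs) hr hs

end

/-! ### Sums of logarithms of distances to the integers -/

theorem distInt_eq_abs_sub_round (y : ℝ) : distInt y = |y - round y| := by
  rw [abs_sub_round_eq_min, distInt]
  by_cases h : Int.fract y = 0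
  · have h' : Int.fract (-y) = 0 := by rwa [Int.fract_neg_eq_zero]
    simp [h, h']
  · rw [Int.fract_neg h]

theorem distInt_le_abs_sub (y : ℝ) (n : ℤ) : distInt y ≤ |y - n| := by
  rw [distInt_eq_abs_sub_round]
  exact round_le y n

theorem distInt_neg (y : ℝ) : distInt (-y) = distInt y := by
  rw [distInt, distInt, neg_neg, min_comm]

theorem distInt_le_half (y : ℝ) : distInt y ≤ 1 / 2 := by
  rw [distInt_eq_abs_sub_round]
  exact abs_sub_round y

theorem distInt_nonneg (y : ℝ) : 0 ≤ distInt y := by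
  rw [distInt_eq_abs_sub_round]
  exact abs_nonneg _

theorem distInt_pos {x : ℝ} (hx : Irrational x) {q : ℕ} (hq : q ≠ 0) : 0 < distInt (q * x) := by
  rw [distInt_eq_abs_sub_round, abs_pos, sub_ne_zero]
  exact (hx.natCast_mul hq).ne_int _

/-- Multiplication by a unit modulo `q` followed by a shift permutes the residues. -/
theorem sum_residues {β : Type*} [AddCommMonoid β] {p : ℤ} {q : ℕ} (hq : 0 < q)
    (h : IsCoprime p (q : ℤ)) (c : ℤ) (G : ℤ → β) :
    ∑ s ∈ Finset.range q, G ((p * s + c) % q) = ∑ r ∈ Finset.range q, G r := by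
  have hq' : (0 : ℤ) < q := by exact_mod_cast hq
  have hnn : ∀ s : ℕ, 0 ≤ (p * s + c) % (q : ℤ) := fun s => Int.emod_nonneg _ hq'.ne'
  have hmaps : Set.MapsTo (fun s : ℕ => ((p * s + c) % (q : ℤ)).toNat)
      (Finset.range q) (Finset.range q) := by
    intro s _
    have h1 := Int.emod_lt_of_pos (p * s + c) hq'
    have h2 := hnn s
    simp only [Finset.coe_range, Set.mem_Iio]
    omega
  have hinj : Set.InjOn (fun s : ℕ => ((p * s + c) % (q : ℤ)).toNat) (Finset.range q) := by
    intro s hs t ht hst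
    have e : (p * s + c) % (q : ℤ) = (p * t + c) % (q : ℤ) := by
      have h1 := hnn s
      have h2 := hnn t
      simp only at hst
      omega
    have hd : (q : ℤ) ∣ p * ((s : ℤ) - t) := by
      have h3 := Int.sub_emod (p * s + c) (p * t + c) q
      rw [e, sub_self, Int.zero_emod] at h3
      have h4 := Int.dvd_of_emod_eq_zero h3
      convert h4 using 1
      ring
    have hd' := h.symm.dvd_of_dvd_mul_left hd
    have hs' : s < q := by simpa using hs
    have ht' : t < q := by simpa using ht
    have : (s : ℤ) - t = 0 := by
      apply Int.eq_zero_of_abs_lt_dvd hd'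
      rw [abs_lt]
      constructor <;> omega
    omega
  refine Finset.sum_nbij (fun s : ℕ => ((p * s + c) % (q : ℤ)).toNat) hmaps hinj
    (Finset.surjOn_of_injOn_of_card_le _ hmaps hinj le_rfl) fun s _ => ?_
  rw [Int.toNat_of_nonneg (hnn s)]

theorem sum_range_mul_eq {β : Type*} [AddCommMonoid β] (F : ℕ → β) (k n : ℕ) :
    ∑ q ∈ Finset.range (k * n), F q =
      ∑ b ∈ Finset.range k, ∑ s ∈ Finset.range n, F (b * n + s) := by
  induction k with
  | zero => simp
  | succ k ih => rw [Nat.succ_mul, Finset.sum_range_add, ih, Finset.sum_range_succ]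

/-- The term `r = 0` is the junk value `log (n / 0) = 0`; the rest is `log (n ^ (n - 1) / (n - 1)!)`. -/
theorem sum_log_div_le (n : ℕ) : ∑ r ∈ Finset.range n, Real.log ((n : ℝ) / r) ≤ n := by
  cases n with
  | zero => simp
  | succ k =>
    rw [Finset.sum_range_succ']
    simp only [Nat.cast_zero, div_zero, Real.log_zero, add_zero]
    rw [← Real.log_prod (fun r _ => by positivity), Finset.prod_div_distrib, Finset.prod_const,
      Finset.card_range]
    have h1 : (∏ r ∈ Finset.range k, ((r + 1 : ℕ) : ℝ)) = (k.factorial : ℝ) := by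
      rw [← Finset.prod_range_add_one_eq_factorial]
      push_cast
      rfl
    rw [h1, Real.log_le_iff_le_exp (by positivity)]
    exact Real.pow_div_factorial_le_exp _ (by positivity) _

/-- With `δ = n θ - p > 0` small, the points `q θ` with `q` in a block of length `n` lie just to the
right of distinct multiples of `1 / n`, so only two of them per block may be very close to an
integer. -/
theorem sum_log_distInt_le {θ δ : ℝ} {p : ℤ} {n l : ℕ} (hn : 0 < n) (hnl : n ≤ l)
    (hp : IsCoprime p (n : ℤ)) (hδ : n * θ - p = δ) (hδ0 : 0 < δ) (hlδ : l * δ < 1)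
    (hmin : ∀ q : ℕ, 1 ≤ q → q ≤ l → δ ≤ distInt (q * θ)) :
    ∑ q ∈ Finset.Icc 1 l, Real.log (1 / distInt (q * θ)) ≤
      4 * (l / n) * (Real.log (1 / δ) + n) := by
  have hnR : (0 : ℝ) < n := by exact_mod_cast hn
  have hl1 : (1 : ℝ) ≤ l := by exact_mod_cast hn.trans_le hnl
  set D := Real.log (1 / δ) with hD
  have hδ1 : δ < 1 := by nlinarith
  have hD0 : 0 ≤ D := Real.log_nonneg (by rw [le_div_iff₀ hδ0]; linarith)
  let G : ℤ → ℝ := fun r => (if r = 0 then D else 0) + (if r = n - 1 then D else 0) +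
    Real.log (n / (r : ℝ)) + Real.log (n / ((n - 1 - r : ℤ) : ℝ))
  have hlog : ∀ r : ℤ, 0 ≤ r → r ≤ n → 0 ≤ Real.log (n / (r : ℝ)) := by
    intro r h0 h1
    rcases h0.eq_or_lt with rfl | h0
    · simp
    · refine Real.log_nonneg ?_
      rw [le_div_iff₀ (by exact_mod_cast h0), one_mul]
      exact_mod_cast h1
  have hG0 : ∀ q : ℕ, 0 ≤ G (p * q % n) := by
    intro q
    have h0 := Int.emod_nonneg (p * q) (by omega : (n : ℤ) ≠ 0)
    have h1 := Int.emod_lt_of_pos (p * q) (by omega : (0 : ℤ) < n)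
    have h2 := hlog (p * q % n) h0 h1.le
    have h3 := hlog (n - 1 - p * q % n) (by omega) (by omega)
    simp only [G]
    split_ifs <;> positivity
  have hterm : ∀ q ∈ Finset.Icc 1 l, Real.log (1 / distInt (q * θ)) ≤ G (p * q % n) := by
    intro q hq
    obtain ⟨hq1, hql⟩ := Finset.mem_Icc.1 hq
    have hd := hmin q hq1 hql
    have hd0 : 0 < distInt (q * θ) := hδ0.trans_le hd
    have hle : Real.log (1 / distInt (q * θ)) ≤ D := by
      rw [hD]; gcongr
    have h0 := Int.emod_nonneg (p * q) (by omega : (n : ℤ) ≠ 0)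
    have h1 := Int.emod_lt_of_pos (p * q) (by omega : (0 : ℤ) < n)
    have hdm : p * q = n * (p * q / n) + p * q % n := (Int.mul_ediv_add_emod _ _).symm
    -- `q θ` exceeds `p q / n` by `q δ / n < 1 / n`, so it lies between two multiples of `1 / n`.
    have hGdef : G (p * q % n) = (if p * q % n = 0 then D else 0) +
      (if p * q % n = n - 1 then D else 0) + Real.log (n / ((p * q % n : ℤ) : ℝ)) +
        Real.log (n / ((n - 1 - p * q % n : ℤ) : ℝ)) := rfl
    rw [hGdef]
    generalize p * q % n = r at *
    generalize p * q / (n : ℤ) = u at *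
    have h2 := hlog r h0 h1.le
    have h3 := hlog (n - 1 - r) (by omega) (by omega)
    by_cases hr0 : r = 0
    · rw [if_pos hr0]
      split_ifs <;> linarith
    by_cases hr1 : r = n - 1
    · rw [if_pos hr1]
      split_ifs
      linarith
    rw [if_neg hr0, if_neg hr1]
    have hrR : (1 : ℝ) ≤ r := by exact_mod_cast (by omega : (1 : ℤ) ≤ r)
    have hrR' : (1 : ℝ) ≤ ((n - 1 - r : ℤ) : ℝ) := by
      exact_mod_cast (by omega : (1 : ℤ) ≤ n - 1 - r)
    have hq0 : (1 : ℝ) ≤ q := by exact_mod_cast hq1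
    have hqδ : (q : ℝ) * δ < 1 := by
      have : (q : ℝ) ≤ l := by exact_mod_cast hql
      nlinarith
    have hqδ0 : 0 < (q : ℝ) * δ := by positivity
    have hdmR : (p : ℝ) * q = n * u + r := by exact_mod_cast hdm
    have hval : (q : ℝ) * θ = u + (r + q * δ) / n := by
      rw [← hδ]
      field_simp
      linear_combination hdmR
    have hcase : (r : ℝ) / n ≤ distInt (q * θ) ∨
        ((n - 1 - r : ℤ) : ℝ) / n ≤ distInt (q * θ) := by
      rw [distInt_eq_abs_sub_round]
      set k := round ((q : ℝ) * θ)
      rcases le_or_gt k u with hk | hk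
      · left
        have hk' : (k : ℝ) ≤ u := by exact_mod_cast hk
        refine le_trans ?_ (le_abs_self _)
        rw [hval, add_div]
        have : 0 ≤ q * δ / n := by positivity
        linarith
      · right
        have hk' : (u : ℝ) + 1 ≤ k := by exact_mod_cast hk
        refine le_trans ?_ (neg_le_abs _)
        rw [hval]
        push_cast
        have e : ((n : ℝ) - 1 - r) / n = 1 - (r + 1) / n := by
          field_simp
          ring
        have : (r + q * δ) / n ≤ (r + 1) / n := by gcongr
        rw [e]
        linarith
    rcases hcase with h | h
    · have : Real.log (1 / distInt (q * θ)) ≤ Real.log (n / (r : ℝ)) := by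
        have h4 : 1 / distInt (q * θ) ≤ n / (r : ℝ) := by
          rw [← one_div_div (r : ℝ) n]
          exact one_div_le_one_div_of_le (by positivity) h
        gcongr
      linarith
    · have : Real.log (1 / distInt (q * θ)) ≤ Real.log (n / ((n - 1 - r : ℤ) : ℝ)) := by
        have h4 : 1 / distInt (q * θ) ≤ n / ((n - 1 - r : ℤ) : ℝ) := by
          rw [← one_div_div ((n - 1 - r : ℤ) : ℝ) n]
          exact one_div_le_one_div_of_le (by positivity) h
        gcongr
      linarith
  have hsumG : ∑ r ∈ Finset.range n, G r ≤ 2 * (D + n) := by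
    have e1 : ∑ r ∈ Finset.range n, (if (r : ℤ) = 0 then D else 0) = D := by
      rw [Finset.sum_eq_single 0]
      · simp
      · intro b _ hb
        rw [if_neg (by exact_mod_cast hb)]
      · intro h
        exact absurd (Finset.mem_range.2 hn) h
    have e2 : ∑ r ∈ Finset.range n, (if (r : ℤ) = n - 1 then D else 0) = D := by
      rw [Finset.sum_eq_single (n - 1)]
      · rw [if_pos (by omega)]
      · intro b _ hb
        rw [if_neg (by omega)]
      · intro h
        exact absurd (Finset.mem_range.2 (by omega)) h
    have e3 : ∑ r ∈ Finset.range n, Real.log (n / (((n - 1 - (r : ℤ) : ℤ)) : ℝ)) =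
        ∑ r ∈ Finset.range n, Real.log ((n : ℝ) / r) := by
      rw [← Finset.sum_range_reflect]
      refine Finset.sum_congr rfl fun j hj => ?_
      have := Finset.mem_range.1 hj
      have e : ((n : ℤ) - 1 - ((n - 1 - j : ℕ) : ℤ)) = j := by omega
      rw [e]
      simp
    have e4 := sum_log_div_le n
    simp only [G]
    rw [Finset.sum_add_distrib, Finset.sum_add_distrib, Finset.sum_add_distrib, e1, e2, e3]
    simp only [Int.cast_natCast]
    linarith
  have hm : l < (l / n + 1) * n := by
    have := Nat.lt_div_mul_add hn (a := l)
    rw [Nat.succ_mul]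
    exact this
  calc ∑ q ∈ Finset.Icc 1 l, Real.log (1 / distInt (q * θ))
      ≤ ∑ q ∈ Finset.Icc 1 l, G (p * q % n) := Finset.sum_le_sum hterm
    _ ≤ ∑ q ∈ Finset.range ((l / n + 1) * n), G (p * q % n) := by
        refine Finset.sum_le_sum_of_subset_of_nonneg (fun q hq => ?_) fun q _ _ => hG0 q
        exact Finset.mem_range.2 ((Finset.mem_Icc.1 hq).2.trans_lt hm)
    _ = ∑ _b ∈ Finset.range (l / n + 1), ∑ r ∈ Finset.range n, G r := by
        rw [sum_range_mul_eq]
        refine Finset.sum_congr rfl fun b _ => ?_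
        rw [← sum_residues hn hp (p * (b * n : ℕ)) G]
        refine Finset.sum_congr rfl fun s _ => ?_
        congr 2
        push_cast
        ring
    _ = ((l / n + 1 : ℕ) : ℝ) * ∑ r ∈ Finset.range n, G r := by simp
    _ ≤ (2 * (l / n)) * (2 * (D + n)) := by
        have h1 : ((l / n + 1 : ℕ) : ℝ) ≤ 2 * (l / n) := by
          have h2 : ((l / n : ℕ) : ℝ) ≤ l / n := Nat.cast_div_le
          have h3 : (1 : ℝ) ≤ l / n := by
            rw [le_div_iff₀ hnR, one_mul]
            exact_mod_cast hnl
          push_cast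
          linarith
        have h2 : 0 ≤ 2 * (D + n) := by positivity
        calc _ ≤ ((l / n + 1 : ℕ) : ℝ) * (2 * (D + n)) := by gcongr
          _ ≤ _ := by gcongr
    _ = 4 * (l / n) * (D + n) := by ring

/-- If `q θ` stays at distance at least `e^{-B q}` from the integers, then the logarithms of the
inverse distances have average at most `4 B + 4`. The best approximation denominator `n ≤ l` governs
the sum up to `l`. -/
theorem eventually_sum_log_distInt_le {θ B : ℝ} (hθ : Irrational θ)
    (hB : ∀ᶠ q : ℕ in atTop, Real.exp (-B * q) ≤ distInt (q * θ)) :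
    ∀ᶠ l : ℕ in atTop,
      ∑ q ∈ Finset.Icc 1 l, Real.log (1 / distInt (q * θ)) ≤ (4 * B + 4) * l := by
  obtain ⟨q₀, hq₀⟩ := eventually_atTop.1 hB
  have hsmall : ∀ᶠ l : ℕ in atTop, ∀ q ∈ Finset.range q₀, q ≠ 0 →
      1 / ((l : ℝ) + 1) < distInt (q * θ) := by
    rw [Filter.eventually_all_finset]
    intro q _
    by_cases hq : q = 0
    · simp [hq]
    · filter_upwards [tendsto_one_div_add_atTop_nhds_zero_nat.eventually_lt_const
        (distInt_pos hθ hq)] with l hl _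
      exact hl
  filter_upwards [hsmall, eventually_ge_atTop 1] with l hl hl1
  obtain ⟨n, hn, hmin⟩ := Finset.exists_min_image (Finset.Icc 1 l) (fun q : ℕ => distInt (q * θ))
    ⟨1, Finset.mem_Icc.2 ⟨le_rfl, hl1⟩⟩
  obtain ⟨hn1, hnl⟩ := Finset.mem_Icc.1 hn
  have hmin' : ∀ q : ℕ, 1 ≤ q → q ≤ l → distInt (n * θ) ≤ distInt (q * θ) :=
    fun q h1 h2 => hmin q (Finset.mem_Icc.2 ⟨h1, h2⟩)
  have hnR : (0 : ℝ) < n := by exact_mod_cast hn1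
  set δ := distInt (n * θ) with hδ
  have hδ0 : 0 < δ := distInt_pos hθ (by omega)
  have hδl : δ ≤ 1 / ((l : ℝ) + 1) := by
    obtain ⟨k, hk0, hkl, hk⟩ := Real.exists_nat_abs_mul_sub_round_le θ (n := l) (by omega)
    rw [← distInt_eq_abs_sub_round] at hk
    exact (hmin' k hk0 hkl).trans hk
  have hlδ : l * δ < 1 := by
    rw [le_div_iff₀ (by positivity)] at hδl
    linarith
  have hnq : q₀ ≤ n := by
    by_contra hlt
    exact absurd (hl n (Finset.mem_range.2 (by omega)) (by omega)) (not_lt.2 hδl)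
  set p := round ((n : ℝ) * θ) with hp
  have hδp : δ = |n * θ - p| := distInt_eq_abs_sub_round _
  have hcop : IsCoprime p (n : ℤ) := by
    rw [Int.isCoprime_iff_gcd_eq_one]
    obtain ⟨p', hp'⟩ : ((Int.gcd p n : ℕ) : ℤ) ∣ p := Int.gcd_dvd_left _ _
    obtain ⟨n', hn'⟩ : Int.gcd p n ∣ n := by
      exact_mod_cast Int.gcd_dvd_right p n
    set g := Int.gcd p n with hg
    have hg0 : g ≠ 0 := by
      rintro h0
      rw [h0] at hn'
      omega
    have hn'0 : n' ≠ 0 := by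
      rintro rfl
      omega
    have h1 : δ ≤ distInt (n' * θ) := by
      refine hmin' n' (by omega) (le_trans ?_ hnl)
      rw [hn']
      exact Nat.le_mul_of_pos_left _ (Nat.pos_of_ne_zero hg0)
    have h2 := distInt_le_abs_sub (n' * θ) p'
    have h3 : δ = g * |n' * θ - p'| := by
      have e1 : (n : ℝ) = g * n' := by exact_mod_cast hn'
      have e2 : (p : ℝ) = g * p' := by exact_mod_cast hp'
      rw [hδp, e1, e2, ← abs_of_nonneg (by positivity : (0 : ℝ) ≤ (g : ℝ)), ← abs_mul,
        abs_of_nonneg (by positivity : (0 : ℝ) ≤ (g : ℝ))]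
      congr 1
      ring
    by_contra hne
    have hg2 : (2 : ℝ) ≤ g := by
      exact_mod_cast (by omega : 2 ≤ g)
    have h4 : 0 < |n' * θ - p'| := hδ0.trans_le (h1.trans h2)
    nlinarith
  have hlog : Real.log (1 / δ) ≤ B * n := by
    rw [one_div, Real.log_inv]
    have := (Real.le_log_iff_exp_le hδ0).2 (hq₀ n hnq)
    linarith
  have main : ∑ q ∈ Finset.Icc 1 l, Real.log (1 / distInt (q * θ)) ≤
      4 * (l / n) * (Real.log (1 / δ) + n) := by
    rcases le_or_gt 0 ((n : ℝ) * θ - p) with h | h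
    · exact sum_log_distInt_le hn1 hnl hcop (by rw [hδp, abs_of_nonneg h]) hδ0 hlδ hmin'
    · have hneg : ∀ q : ℕ, distInt (q * -θ) = distInt (q * θ) := fun q => by
        rw [mul_neg, distInt_neg]
      have := sum_log_distInt_le (θ := -θ) (p := -p) hn1 hnl hcop.neg_left
        (by rw [hδp, abs_of_neg h]; push_cast; ring) hδ0 hlδ
        (fun q h1 h2 => by rw [hneg]; exact hmin' q h1 h2)
      simpa only [hneg] using this
  calc _ ≤ 4 * (l / n) * (Real.log (1 / δ) + n) := main
    _ ≤ 4 * (l / n) * (B * n + n) := by gcongr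
    _ = (4 * B + 4) * l := by field_simp

/-! ### Irrational `b² > 0`: lower bound on the radius -/

/-- In a column of length `l` the legs are `0, …, l - 1`, so a bound on initial sums bounds the sum
over the diagram. -/
theorem sum_col_log_le {θ B : ℝ} {q₁ : ℕ} (hq₁ : 1 ≤ q₁)
    (h : ∀ l ≥ q₁, ∑ q ∈ Finset.Icc 1 l, Real.log (1 / distInt (q * θ)) ≤ (4 * B + 4) * l)
    (hB : 0 ≤ B) (lam : YoungDiagram) {t : ℕ} (ht : t ≤ 1) :
    ∑ c ∈ lam.cells, (if q₁ ≤ lam.leg c + t then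
      Real.log (1 / distInt ((lam.leg c + t : ℕ) * θ)) else 0) ≤ (4 * B + 4) * lam.card := by
  let g : ℕ → ℝ := fun q => if q₁ ≤ q then Real.log (1 / distInt (q * θ)) else 0
  have hlog0 : ∀ q : ℕ, 0 ≤ Real.log (1 / distInt (q * θ)) := by
    intro q
    rcases (distInt_nonneg (q * θ)).eq_or_lt with h0 | h0
    · simp [← h0]
    · refine Real.log_nonneg ?_
      rw [le_div_iff₀ h0]
      linarith [distInt_le_half (q * θ)]
  have hg0 : ∀ q, 0 ≤ g q := by
    intro q
    simp only [g]
    split_ifs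
    · exact hlog0 q
    · exact le_rfl
  have hgle : ∀ q, g q ≤ Real.log (1 / distInt (q * θ)) := by
    intro q
    simp only [g]
    split_ifs
    · exact le_rfl
    · exact hlog0 q
  have hg00 : g 0 = 0 := if_neg (by omega)
  have hcol : ∀ l : ℕ, ∑ q ∈ Finset.range (l + 1), g q ≤ (4 * B + 4) * l := by
    intro l
    rcases le_or_gt q₁ l with hl | hl
    · refine le_trans ?_ (h l hl)
      have hsub : Finset.Icc 1 l ⊆ Finset.range (l + 1) := fun q hq =>
        Finset.mem_range.2 (by have := (Finset.mem_Icc.1 hq).2; omega)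
      rw [← Finset.sum_subset hsub]
      · exact Finset.sum_le_sum fun q _ => hgle q
      · intro q hq hq'
        have : q = 0 := by
          by_contra h0
          have := Finset.mem_range.1 hq
          exact hq' (Finset.mem_Icc.2 ⟨by omega, by omega⟩)
        rw [this, hg00]
    · rw [Finset.sum_eq_zero fun q hq => if_neg (by have := Finset.mem_range.1 hq; omega)]
      positivity
  have hshift : ∀ l : ℕ, ∑ q ∈ Finset.range l, g (q + t) ≤ ∑ q ∈ Finset.range (l + 1), g q := by
    intro l
    obtain rfl | rfl : t = 0 ∨ t = 1 := by omega
    · rw [Finset.sum_range_succ]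
      have := hg0 l
      simp only [add_zero]
      linarith
    · rw [Finset.sum_range_succ', hg00, add_zero]
  calc _ = ∑ j ∈ Finset.range (lam.rowLen 0), ∑ i ∈ Finset.range (lam.colLen j),
          g (lam.leg (i, j) + t) := YoungDiagram.sum_cells_eq_sum_col lam le_rfl
            fun c => g (lam.leg c + t)
    _ ≤ ∑ j ∈ Finset.range (lam.rowLen 0), (4 * B + 4) * (lam.colLen j : ℝ) := by
        refine Finset.sum_le_sum fun j _ => ?_
        refine le_trans (le_of_eq ?_) ((hshift (lam.colLen j)).trans (hcol _))
        rw [← Finset.sum_range_reflect]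
        refine Finset.sum_congr rfl fun i hi => ?_
        have := Finset.mem_range.1 hi
        congr 2
        simp only [YoungDiagram.leg]
        omega
    _ = (4 * B + 4) * lam.card := by
        rw [← Finset.mul_sum, YoungDiagram.card_eq_sum_colLen lam le_rfl]
        push_cast
        rfl

/-- Boxes with a large (shifted) leg are controlled column by column by the sums of
`log (1 / dist (q x, ℤ))`; boxes with a small leg and a large arm have a large denominator; the
remaining ones are sparse. The two kinds of denominators are `(s, t) = (1, 0)` and `(0, 1)`. -/
theorem exists_sum_log_diag_le {x B M : ℝ} (hx : Irrational x) (hx0 : 0 < x) (hM : 0 ≤ M)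
    (hB0 : 0 ≤ B) (hB : ∀ᶠ q : ℕ in atTop, Real.exp (-B * q) ≤ distInt (q * x)) (s : ℕ) {t : ℕ}
    (ht : t ≤ 1) :
    ∃ K : ℝ, ∀ lam : YoungDiagram,
      ∑ c ∈ lam.cells, Real.log (1 + M / |((lam.arm c + s : ℕ) : ℝ) - x * (lam.leg c + t : ℕ)|) ≤
        K + (Real.log (1 + M) + 5 + 4 * B) * lam.card := by
  obtain ⟨q₀, hq₀⟩ := eventually_atTop.1 (eventually_sum_log_distInt_le hx hB)
  set q₁ := max q₀ 1 with hq₁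
  have hq₁1 : 1 ≤ q₁ := le_max_right _ _
  obtain ⟨P, hP⟩ := exists_nat_ge (x * q₁ + 1)
  let w : ℕ → ℕ → ℝ := fun p q => Real.log (1 + M / |(p : ℝ) - x * q|)
  have hw0 : ∀ p q, 0 ≤ w p q := fun p q => Real.log_nonneg (by
    have : 0 ≤ M / |(p : ℝ) - x * q| := by positivity
    linarith)
  set W := ∑ p ∈ Finset.range P, ∑ q ∈ Finset.range q₁, w p q with hW
  have hW0 : 0 ≤ W := Finset.sum_nonneg fun _ _ => Finset.sum_nonneg fun _ _ => hw0 _ _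
  have hwW : ∀ p q, p < P → q < q₁ → w p q ≤ W := by
    intro p q hp hq
    calc w p q ≤ ∑ q ∈ Finset.range q₁, w p q :=
          Finset.single_le_sum (f := fun q => w p q) (fun _ _ => hw0 _ _) (Finset.mem_range.2 hq)
      _ ≤ W := Finset.single_le_sum (f := fun p => ∑ q ∈ Finset.range q₁, w p q)
          (fun _ _ => Finset.sum_nonneg fun _ _ => hw0 _ _) (Finset.mem_range.2 hp)
  have hlogM : 0 ≤ Real.log (1 + M) := Real.log_nonneg (by linarith)
  obtain ⟨K, hK0, hK⟩ := YoungDiagram.exists_card_sparse_le (P + q₁) (η := 1 / (W + 1))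
    (by positivity)
  have hlarge : ∀ p q, q₁ ≤ q → w p q ≤ Real.log (1 + M) + Real.log (1 / distInt (q * x)) := by
    intro p q hq
    have hd0 := distInt_pos hx (q := q) (by omega)
    have hd1 := distInt_le_half (q * x)
    have hd := distInt_le_abs_sub (q * x) p
    rw [Int.cast_natCast, abs_sub_comm, mul_comm (q : ℝ) x] at hd
    rw [mul_comm x] at hd
    rw [← Real.log_mul (by positivity) (by positivity)]
    refine Real.log_le_log (by positivity) ?_
    calc 1 + M / |(p : ℝ) - x * q| ≤ 1 / distInt (q * x) + M / distInt (q * x) := by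
          rw [mul_comm x]
          have : 1 ≤ 1 / distInt (q * x) := by
            rw [le_div_iff₀ hd0]; linarith
          gcongr
      _ = (1 + M) * (1 / distInt (q * x)) := by ring
  have hmid : ∀ p q, P ≤ p → q < q₁ → w p q ≤ Real.log (1 + M) := by
    intro p q hp hq
    have h1 : (1 : ℝ) ≤ |(p : ℝ) - x * q| := by
      refine le_trans ?_ (le_abs_self _)
      have h2 : (P : ℝ) ≤ p := by exact_mod_cast hp
      have h3 : (q : ℝ) ≤ q₁ := by exact_mod_cast hq.le
      nlinarith
    have h2 : M / |(p : ℝ) - x * q| ≤ M := div_le_self hM h1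
    simp only [w]
    gcongr
  refine ⟨W * K, fun lam => ?_⟩
  set S := lam.cells.filter fun c => lam.arm c + s < P ∧ lam.leg c + t < q₁ with hS
  have hScard : (S.card : ℝ) ≤ K + 1 / (W + 1) * lam.card := by
    refine hK lam S (Finset.filter_subset _ _) (fun i => ?_) (fun j => ?_)
    · rw [← Finset.card_range (P + q₁)]
      refine Finset.card_le_card_of_injOn lam.arm ?_ ?_
      · intro c hc
        have := (Finset.mem_filter.1 (Finset.mem_filter.1 hc).1).2.1
        exact Finset.mem_coe.2 (Finset.mem_range.2 (by omega))
      · rintro ⟨i1, j1⟩ hc ⟨i2, j2⟩ hc' heq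
        obtain ⟨hS1, rfl⟩ := Finset.mem_filter.1 hc
        obtain ⟨hS2, h12⟩ := Finset.mem_filter.1 hc'
        simp only at h12
        subst h12
        have h1 := YoungDiagram.arm_add (Finset.mem_filter.1 hS1).1
        have h2 := YoungDiagram.arm_add (Finset.mem_filter.1 hS2).1
        simp only at h1 h2
        rw [Prod.mk.injEq]
        exact ⟨rfl, by omega⟩
    · rw [← Finset.card_range (P + q₁)]
      refine Finset.card_le_card_of_injOn lam.leg ?_ ?_
      · intro c hc
        have := (Finset.mem_filter.1 (Finset.mem_filter.1 hc).1).2.2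
        exact Finset.mem_coe.2 (Finset.mem_range.2 (by omega))
      · rintro ⟨i1, j1⟩ hc ⟨i2, j2⟩ hc' heq
        obtain ⟨hS1, rfl⟩ := Finset.mem_filter.1 hc
        obtain ⟨hS2, h12⟩ := Finset.mem_filter.1 hc'
        simp only at h12
        subst h12
        have h1 := YoungDiagram.leg_add (Finset.mem_filter.1 hS1).1
        have h2 := YoungDiagram.leg_add (Finset.mem_filter.1 hS2).1
        simp only at h1 h2
        rw [Prod.mk.injEq]
        exact ⟨by omega, rfl⟩
  have hcolsum := sum_col_log_le hq₁1 (fun l hl => hq₀ l ((le_max_left _ _).trans hl)) hB0 lam ht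
  calc ∑ c ∈ lam.cells, w (lam.arm c + s) (lam.leg c + t)
      ≤ ∑ c ∈ lam.cells, (Real.log (1 + M) + (if q₁ ≤ lam.leg c + t then
          Real.log (1 / distInt ((lam.leg c + t : ℕ) * x)) else 0) +
          if lam.arm c + s < P ∧ lam.leg c + t < q₁ then W else 0) := by
        refine Finset.sum_le_sum fun c _ => ?_
        by_cases h1 : q₁ ≤ lam.leg c + t
        · rw [if_pos h1, if_neg (by omega), add_zero]
          exact hlarge _ _ h1
        · rw [if_neg h1, add_zero]
          rw [not_le] at h1
          by_cases h2 : lam.arm c + s < P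
          · rw [if_pos ⟨h2, h1⟩]
            have := hwW _ _ h2 h1
            linarith
          · rw [if_neg (by omega), add_zero]
            exact hmid _ _ (not_lt.1 h2) h1
    _ = Real.log (1 + M) * lam.card + ∑ c ∈ lam.cells, (if q₁ ≤ lam.leg c + t then
          Real.log (1 / distInt ((lam.leg c + t : ℕ) * x)) else 0) + W * S.card := by
        rw [Finset.sum_add_distrib, Finset.sum_add_distrib, ← Finset.sum_filter (fun c =>
          lam.arm c + s < P ∧ lam.leg c + t < q₁), Finset.sum_const, Finset.sum_const,
          nsmul_eq_mul, nsmul_eq_mul, ← hS, mul_comm (S.card : ℝ), mul_comm (lam.cells.card : ℝ)]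
    _ ≤ Real.log (1 + M) * lam.card + (4 * B + 4) * lam.card +
          W * (K + 1 / (W + 1) * lam.card) := by gcongr
    _ ≤ W * K + (Real.log (1 + M) + 5 + 4 * B) * lam.card := by
        have h4 : W * (1 / (W + 1)) ≤ 1 := by
          rw [mul_one_div, div_le_iff₀ (by positivity)]
          linarith
        have h5 : (0 : ℝ) ≤ lam.card := by positivity
        nlinarith

/-- Exponential lower bounds on `dist (q x, ℤ)` transfer to `1 / x` with the exponent divided by
`x`, up to an arbitrarily small loss. -/
theorem eventually_le_distInt_inv {x β β' : ℝ} (hx0 : 0 < x) (hβ0 : 0 ≤ β) (hβ : β < β')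
    (hB : ∀ᶠ q : ℕ in atTop, Real.exp (-β * q) ≤ distInt (q * x)) :
    ∀ᶠ p : ℕ in atTop, Real.exp (-(β' / x) * p) ≤ distInt (p * x⁻¹) := by
  obtain ⟨q₀, hq₀⟩ := eventually_atTop.1 hB
  have h1 : Tendsto (fun p : ℕ => (p : ℝ) * x⁻¹) atTop atTop :=
    tendsto_natCast_atTop_atTop.atTop_mul_const (inv_pos.2 hx0)
  filter_upwards [h1.eventually_ge_atTop (q₀ + 1), h1.eventually_ge_atTop
    ((β / 2 + Real.log x) / (β' - β))] with p hp hp'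
  set k := round ((p : ℝ) * x⁻¹) with hk
  have hround := abs_sub_round ((p : ℝ) * x⁻¹)
  rw [← hk] at hround
  obtain ⟨hr1, hr2⟩ := abs_le.1 hround
  have hkq : (q₀ : ℝ) ≤ k := by linarith
  obtain ⟨q, hq⟩ : ∃ q : ℕ, k = q := Int.eq_ofNat_of_zero_le (by
    have : (0 : ℝ) ≤ k := by
      have : (0 : ℝ) ≤ q₀ := by positivity
      linarith
    exact_mod_cast this)
  have hkqR : (k : ℝ) = q := by exact_mod_cast hq
  rw [hkqR] at hkq hr1 hr2
  have hq0 : q₀ ≤ q := by exact_mod_cast hkq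
  have hd : distInt (p * x⁻¹) = |(p : ℝ) - q * x| / x := by
    rw [distInt_eq_abs_sub_round, ← hk, hkqR, ← abs_of_pos hx0, ← abs_div, abs_of_pos hx0]
    congr 1
    field_simp
  have hle : distInt (q * x) ≤ |(p : ℝ) - q * x| := by
    rw [abs_sub_comm]
    exact_mod_cast distInt_le_abs_sub (q * x) p
  rw [div_le_iff₀ (by linarith)] at hp'
  rw [hd, le_div_iff₀ hx0]
  calc Real.exp (-(β' / x) * p) * x = Real.exp (-(β' / x) * p + Real.log x) := by
        rw [Real.exp_add, Real.exp_log hx0]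
    _ ≤ Real.exp (-β * q) := by
        refine Real.exp_le_exp.2 ?_
        rw [div_eq_mul_inv, show -(β' * x⁻¹) * (p : ℝ) = -β' * (p * x⁻¹) by ring]
        nlinarith
    _ ≤ _ := (hq₀ q hq0).trans hle

/-- Transposing the diagram exchanges `x` and `1 / x`, so that the better of the two bounds
applies. -/
theorem exists_sum_log_diag_le_max {x β β' M : ℝ} (hx : Irrational x) (hx0 : 0 < x) (hM : 0 ≤ M)
    (hβ0 : 0 ≤ β) (hβ : β < β')
    (hB : ∀ᶠ q : ℕ in atTop, Real.exp (-β * q) ≤ distInt (q * x)) {s t : ℕ} (hs : s ≤ 1)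
    (ht : t ≤ 1) :
    ∃ K : ℝ, ∀ lam : YoungDiagram,
      ∑ c ∈ lam.cells, Real.log (1 + M / |((lam.arm c + s : ℕ) : ℝ) - x * (lam.leg c + t : ℕ)|) ≤
        K + (Real.log (1 + M) + 5 + 4 * (β' / max 1 x)) * lam.card := by
  rcases le_or_gt x 1 with h1 | h1
  · obtain ⟨K, hK⟩ := exists_sum_log_diag_le hx hx0 hM hβ0 hB s ht
    refine ⟨K, fun lam => (hK lam).trans ?_⟩
    rw [max_eq_left h1, div_one]
    gcongr
  · obtain ⟨K, hK⟩ := exists_sum_log_diag_le hx.inv (inv_pos.2 hx0) hM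
      (div_nonneg (hβ0.trans hβ.le) hx0.le) (eventually_le_distInt_inv hx0 hβ0 hβ hB) t hs
    refine ⟨K, fun lam => ?_⟩
    rw [max_eq_right h1.le]
    have h2 := hK lam.transpose
    rw [YoungDiagram.card_transpose, YoungDiagram.sum_transpose_cells] at h2
    refine le_trans (Finset.sum_le_sum fun c _ => ?_) h2
    rw [YoungDiagram.arm_transpose, YoungDiagram.leg_transpose]
    generalize lam.arm c + s = p
    generalize lam.leg c + t = q
    have h3 : |(p : ℝ) - x * q| = x * |(q : ℝ) - x⁻¹ * p| := by
      rw [← abs_of_pos hx0, ← abs_mul, abs_of_pos hx0, abs_sub_comm]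
      congr 1
      field_simp
    have h4 : M / |(p : ℝ) - x * q| ≤ M / |(q : ℝ) - x⁻¹ * p| := by
      rw [h3, mul_comm, ← div_div]
      exact div_le_self (by positivity) h1.le
    gcongr

section

variable {ε₁ ε₂ : ℂ} {N : ℕ} {m : ℂ} {a : Fin N → ℂ} {x : ℝ}

/-- The additive group generated by `1` and an irrational number is dense in `ℝ`. -/
theorem ofReal_mul_mem_closure (h0 : ε₂ ≠ 0) (hx : Irrational x) (he : ε₁ / ε₂ = (x : ℂ)) (t : ℝ) :
    (t : ℂ) * ε₂ ∈ closure (epsLattice ε₁ ε₂) := by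
  have hd : Dense ((AddSubgroup.closure {x, 1} : AddSubgroup ℝ) : Set ℝ) :=
    dense_addSubgroupClosure_pair_iff.2 (by simpa using hx)
  have hcont : Continuous fun s : ℝ => (s : ℂ) * ε₂ := by fun_prop
  refine map_mem_closure (f := fun s : ℝ => (s : ℂ) * ε₂) hcont (hd t) ?_
  intro s hs
  obtain ⟨k, l, rfl⟩ := AddSubgroup.mem_closure_pair.1 hs
  refine ⟨k, l, ?_⟩
  rw [div_eq_iff h0] at he
  rw [he]
  push_cast
  simp
  ring

theorem im_div_ne_zero_of_notMem_closure (h0 : ε₂ ≠ 0) (hx : Irrational x)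
    (he : ε₁ / ε₂ = (x : ℂ)) {z : ℂ} (hz : z ∉ closure (epsLattice ε₁ ε₂)) : (z / ε₂).im ≠ 0 := by
  intro him
  apply hz
  have : z = ((z / ε₂).re : ℂ) * ε₂ := by
    rw [← div_eq_iff h0]
    exact Complex.ext (by simp) (by simp [him])
  rw [this]
  exact ofReal_mul_mem_closure h0 hx he _

theorem GenericParams.im_mass_ne_zero (hg : GenericParams m a ε₁ ε₂) (hx : Irrational x)
    (he : ε₁ / ε₂ = (x : ℂ)) : (m / ε₂).im ≠ 0 :=
  im_div_ne_zero_of_notMem_closure hg.ne_zero₂ hx he hg.mass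

theorem GenericParams.im_coulomb_ne_zero (hg : GenericParams m a ε₁ ε₂) (hx : Irrational x)
    (he : ε₁ / ε₂ = (x : ℂ)) {I J : Fin N} (hIJ : I ≠ J) : ((a I - a J) / ε₂).im ≠ 0 := by
  rcases lt_or_gt_of_ne hIJ with h | h
  · exact im_div_ne_zero_of_notMem_closure hg.ne_zero₂ hx he (hg.coulomb I J h)
  · have := im_div_ne_zero_of_notMem_closure hg.ne_zero₂ hx he (hg.coulomb J I h)
    rwa [← neg_sub, neg_div, Complex.neg_im, neg_ne_zero] at this

theorem im_div_eq_zero_of_mem_epsLattice (h0 : ε₂ ≠ 0) (he : ε₁ / ε₂ = (x : ℂ)) {w : ℂ}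
    (hw : w ∈ epsLattice ε₁ ε₂) : (w / ε₂).im = 0 := by
  obtain ⟨k, l, rfl⟩ := hw
  have : ((k : ℂ) * ε₁ + l * ε₂) / ε₂ = ((k * x + l : ℝ) : ℂ) := by
    rw [add_div, mul_div_assoc, he, mul_div_assoc, div_self h0]
    push_cast
    ring
  rw [this, Complex.ofReal_im]

theorem im_mul_norm_le_norm_add (h0 : ε₂ ≠ 0) (he : ε₁ / ε₂ = (x : ℂ)) {z w : ℂ}
    (hw : w ∈ epsLattice ε₁ ε₂) : |(z / ε₂).im| * ‖ε₂‖ ≤ ‖z + w‖ := by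
  have h1 : ((z + w) / ε₂).im = (z / ε₂).im := by
    rw [add_div, Complex.add_im, im_div_eq_zero_of_mem_epsLattice h0 he hw, add_zero]
  rw [← h1, ← le_div_iff₀ (norm_pos_iff.2 h0), ← norm_div]
  exact Complex.abs_im_le_norm _

theorem norm_boxDenom_self_right (h0 : ε₂ ≠ 0) (he : ε₁ / ε₂ = (x : ℂ)) {lam : YoungDiagram}
    {c : ℕ × ℕ} (hc : c ∈ lam.cells) : ‖boxDenom ε₁ ε₂ lam lam (0 + ε₂) c‖ =
      ‖ε₂‖ * |((lam.arm c + 1 : ℕ) : ℝ) - x * (lam.leg c + 0 : ℕ)| := by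
  rw [boxDenom_self_right hc, zero_add, ← Real.norm_eq_abs, ← Complex.norm_real, ← norm_mul]
  rw [div_eq_iff h0] at he
  rw [he]
  push_cast
  congr 1
  ring

theorem norm_boxDenom_self_left (h0 : ε₂ ≠ 0) (he : ε₁ / ε₂ = (x : ℂ)) {lam : YoungDiagram}
    {c : ℕ × ℕ} (hc : c ∈ lam.cells) : ‖boxDenom ε₁ ε₂ lam lam (0 - ε₁) c‖ =
      ‖ε₂‖ * |((lam.arm c + 0 : ℕ) : ℝ) - x * (lam.leg c + 1 : ℕ)| := by
  rw [boxDenom_self_left hc, zero_add, ← Real.norm_eq_abs, ← Complex.norm_real, ← norm_mul]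
  rw [div_eq_iff h0] at he
  rw [he]
  push_cast
  congr 1
  ring

theorem natCast_sub_mul_ne_zero (hx : Irrational x) {p q : ℕ} (h : p + q ≠ 0) :
    (p : ℝ) - x * q ≠ 0 := by
  intro h0
  by_cases hq : q = 0
  · subst hq
    simp at h0
    omega
  · refine (hx.mul_natCast hq).ne_nat p ?_
    linarith

theorem GenericParams.ZTermDefined_of_irrational (hg : GenericParams m a ε₁ ε₂)
    (hx : Irrational x) (he : ε₁ / ε₂ = (x : ℂ)) (Y : Fin N → YoungDiagram) :
    ZTermDefined a ε₁ ε₂ Y := by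
  intro I J c hc
  by_cases hIJ : I = J
  · subst hIJ
    have hn := norm_pos_iff.2 hg.ne_zero₂
    rw [sub_self, ← norm_pos_iff, ← norm_pos_iff (a := boxDenom _ _ _ _ (0 - ε₁) _),
      norm_boxDenom_self_right hg.ne_zero₂ he hc, norm_boxDenom_self_left hg.ne_zero₂ he hc]
    exact ⟨mul_pos hn (abs_pos.2 (natCast_sub_mul_ne_zero hx (by omega))),
      mul_pos hn (abs_pos.2 (natCast_sub_mul_ne_zero hx (by omega)))⟩
  · obtain ⟨⟨w, hw1, h1⟩, ⟨w', hw2, h2⟩⟩ :=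
      exists_boxDenom_eq (ε₁ := ε₁) (ε₂ := ε₂) (Y I) (Y J) (a I - a J) c
    obtain ⟨δ, hδ, hd⟩ := hg.exists_le_norm_add hIJ
    rw [h1, h2]
    exact ⟨norm_pos_iff.1 (hδ.trans_le (hd w hw1)), norm_pos_iff.1 (hδ.trans_le (hd w' hw2))⟩

/-- The logarithm of the inverse of the constant in the lower bound on the radius: the diagonal
factors contribute `2 (log (1 + |m / ε₂|) + 5)` per box, and an off-diagonal denominator is at least
the distance of `a I - a J` to the line `ε₂ ℝ`. -/
noncomputable def lowerExponent (N : ℕ) (p : ℂ × (Fin N → ℂ) × ℂ × ℂ) : ℝ :=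
  2 * Real.log (1 + ‖p.1 / p.2.2.2‖) + 10 + ∑ I, ∑ J, if I = J then 0 else
    2 * Real.log (1 + ‖p.1‖ / (|((p.2.1 I - p.2.1 J) / p.2.2.2).im| * ‖p.2.2.2‖))

theorem GenericParams.exp_lowerExponent_le_Rabs (hg : GenericParams m a ε₁ ε₂)
    (hx : Irrational x) (hx0 : 0 < x) (he : ε₁ / ε₂ = (x : ℂ)) {β β' : ℝ} (hβ0 : 0 ≤ β)
    (hβ : β < β') (hB : ∀ᶠ q : ℕ in atTop, Real.exp (-β * q) ≤ distInt (q * x)) :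
    ENNReal.ofReal (Real.exp (-(lowerExponent N (m, a, ε₁, ε₂) + 8 * (β' / max 1 x)))) ≤
      Rabs m a ε₁ ε₂ := by
  set M := ‖m / ε₂‖ with hM
  let D : Fin N → Fin N → ℝ := fun I J => |((a I - a J) / ε₂).im| * ‖ε₂‖
  let c : Fin N → Fin N → ℝ := fun I J => if I = J then
    2 * (Real.log (1 + M) + 5 + 4 * (β' / max 1 x)) else 2 * Real.log (1 + ‖m‖ / D I J)
  have key : ∀ I J : Fin N, ∃ K : ℝ, 0 ≤ K ∧ ∀ Y : Fin N → YoungDiagram,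
      ‖ZLamMu ε₁ ε₂ (Y I) (Y J) (a I - a J + ε₂) m *
        ZLamMu ε₁ ε₂ (Y I) (Y J) (a I - a J - ε₁) (-m)‖ ≤
          K * Real.exp (c I J * (Y I).card) := by
    intro I J
    by_cases hIJ : I = J
    · subst hIJ
      obtain ⟨K1, hK1⟩ := exists_sum_log_diag_le_max hx hx0 (norm_nonneg (m / ε₂)) hβ0 hβ hB
        (s := 1) (t := 0) le_rfl zero_le_one
      obtain ⟨K2, hK2⟩ := exists_sum_log_diag_le_max hx hx0 (norm_nonneg (m / ε₂)) hβ0 hβ hB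
        (s := 0) (t := 1) zero_le_one le_rfl
      refine ⟨Real.exp (K1 + K2), by positivity, fun Y => ?_⟩
      rw [sub_self, norm_mul]
      have e1 := norm_ZLamMu_le_exp_sum ε₁ ε₂ (Y I) (Y I) (0 + ε₂) m
      have e2 := norm_ZLamMu_le_exp_sum ε₁ ε₂ (Y I) (Y I) (0 - ε₁) (-m)
      rw [Finset.sum_congr rfl fun c hc => by
        rw [norm_boxDenom_self_right hg.ne_zero₂ he hc, ← div_div, ← norm_div]] at e1
      rw [Finset.sum_congr rfl fun c hc => by
        rw [norm_boxDenom_self_left hg.ne_zero₂ he hc, norm_neg, ← div_div, ← norm_div]] at e2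
      refine (mul_le_mul (e1.trans (Real.exp_le_exp.2 (hK1 (Y I))))
        (e2.trans (Real.exp_le_exp.2 (hK2 (Y I)))) (norm_nonneg _) (by positivity)).trans ?_
      rw [← Real.exp_add, ← Real.exp_add]
      simp only [c, if_true]
      refine Real.exp_le_exp.2 (le_of_eq ?_)
      ring
    · have hD : 0 < D I J := mul_pos (abs_pos.2 (hg.im_coulomb_ne_zero hx he hIJ))
        (norm_pos_iff.2 hg.ne_zero₂)
      refine ⟨1, zero_le_one, fun Y => ?_⟩
      have hb : ∀ b ∈ (Y I).cells, D I J ≤ ‖boxDenom ε₁ ε₂ (Y I) (Y J) (a I - a J + ε₂) b‖ ∧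
          D I J ≤ ‖boxDenom ε₁ ε₂ (Y I) (Y J) (a I - a J - ε₁) b‖ := by
        intro b _
        obtain ⟨⟨w, hw1, h1⟩, ⟨w', hw2, h2⟩⟩ :=
          exists_boxDenom_eq (ε₁ := ε₁) (ε₂ := ε₂) (Y I) (Y J) (a I - a J) b
        rw [h1, h2]
        exact ⟨im_mul_norm_le_norm_add hg.ne_zero₂ he hw1,
          im_mul_norm_le_norm_add hg.ne_zero₂ he hw2⟩
      have e1 := norm_ZLamMu_le_of_le (m := m) hD fun b hb' => (hb b hb').1
      have e2 := norm_ZLamMu_le_of_le (m := -m) hD fun b hb' => (hb b hb').2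
      rw [norm_mul, one_mul]
      refine (mul_le_mul e1 e2 (norm_nonneg _) (by positivity)).trans ?_
      rw [← Real.exp_add, norm_neg]
      simp only [c, if_neg hIJ]
      refine Real.exp_le_exp.2 (le_of_eq ?_)
      ring
  choose K hK hb using key
  refine exp_neg_le_Rabs (K := ∏ I, ∏ J, K I J) fun Y => norm_ZTerm_le hK (fun I => ?_) hb Y
  let d : Fin N → Fin N → ℝ := fun I J => if I = J then 0 else 2 * Real.log (1 + ‖m‖ / D I J)
  have hd0 : ∀ I J, 0 ≤ d I J := by
    intro I J
    simp only [d]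
    split_ifs
    · exact le_rfl
    · have : 0 ≤ ‖m‖ / D I J := by positivity
      have := Real.log_nonneg (by linarith : 1 ≤ 1 + ‖m‖ / D I J)
      linarith
  have hcd : ∀ J, c I J = (if I = J then 2 * (Real.log (1 + M) + 5 + 4 * (β' / max 1 x)) else 0) +
      d I J := by
    intro J
    simp only [c, d]
    split_ifs <;> ring
  calc ∑ J, c I J = 2 * (Real.log (1 + M) + 5 + 4 * (β' / max 1 x)) + ∑ J, d I J := by
        rw [Finset.sum_congr rfl fun J _ => hcd J, Finset.sum_add_distrib]
        simp
    _ ≤ 2 * (Real.log (1 + M) + 5 + 4 * (β' / max 1 x)) + ∑ I, ∑ J, d I J := by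
        exact add_le_add le_rfl (Finset.single_le_sum (f := fun I => ∑ J, d I J)
          (fun I _ => Finset.sum_nonneg fun J _ => hd0 I J) (Finset.mem_univ I))
    _ = _ := by
        simp only [lowerExponent, d, D, M]
        ring

theorem continuousOn_lowerExponent (N : ℕ) :
    ContinuousOn (lowerExponent N) (positiveDomain N) := by
  have h2 : ∀ p ∈ positiveDomain N, p.2.2.2 ≠ 0 := fun p hp => hp.1
  have him : ∀ p ∈ positiveDomain N, ∀ I J, I ≠ J → ((p.2.1 I - p.2.1 J) / p.2.2.2).im ≠ 0 := by
    intro p hp I J hIJ h0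
    have e : ∀ z : ℂ, (z / p.2.2.2).im = 0 → z = ((z / p.2.2.2).re : ℂ) * p.2.2.2 := by
      intro z hz
      rw [← div_eq_iff (h2 p hp)]
      exact Complex.ext (by simp) (by simp [hz])
    rcases lt_or_gt_of_ne hIJ with h | h
    · exact hp.2.2.2 I J h _ (e _ h0)
    · refine hp.2.2.2 J I h _ (e _ ?_)
      rw [← neg_sub, neg_div, Complex.neg_im, h0, neg_zero]
  unfold lowerExponent
  refine ContinuousOn.add (ContinuousOn.add (ContinuousOn.mul continuousOn_const
    (ContinuousOn.log ?_ fun p _ => by positivity)) continuousOn_const) ?_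
  · exact continuousOn_const.add (ContinuousOn.norm
      (ContinuousOn.div (by fun_prop) (by fun_prop) h2))
  · refine continuousOn_finsetSum _ fun I _ => continuousOn_finsetSum _ fun J _ => ?_
    by_cases hIJ : I = J
    · simp only [hIJ, if_true]
      exact continuousOn_const
    · simp only [hIJ, if_false]
      refine ContinuousOn.mul continuousOn_const (ContinuousOn.log (continuousOn_const.add
        (ContinuousOn.div (by fun_prop) ?_ ?_)) ?_)
      · refine ContinuousOn.mul (ContinuousOn.abs ?_) (by fun_prop)
        exact Complex.continuous_im.comp_continuousOn
          (ContinuousOn.div (by fun_prop) (by fun_prop) h2)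
      · intro p hp
        exact mul_ne_zero (abs_ne_zero.2 (him p hp I J hIJ)) (norm_ne_zero_iff.2 (h2 p hp))
      · intro p _
        positivity

end

/-! ### A diagram with many boxes of slope exactly `p / q` -/

namespace YoungDiagram

/-- The Young diagram with `h` rows of lengths `f 0 ≥ f 1 ≥ ⋯`. -/
def ofRowFn (h : ℕ) (f : ℕ → ℕ) (hf : Antitone f) : YoungDiagram where
  cells := (Finset.range h ×ˢ Finset.range (f 0)).filter fun c => c.2 < f c.1
  isLowerSet := by
    rintro ⟨i, j⟩ ⟨i', j'⟩ hle hc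
    obtain ⟨h1, h2⟩ := Prod.mk_le_mk.1 hle
    simp only [Finset.coe_filter, Finset.mem_product, Finset.mem_range, Set.mem_ofPred_eq] at hc ⊢
    have := hf h1
    have := hf (Nat.zero_le i')
    omega

theorem mem_ofRowFn {h : ℕ} {f : ℕ → ℕ} {hf : Antitone f} {i j : ℕ} :
    (i, j) ∈ ofRowFn h f hf ↔ i < h ∧ j < f i := by
  rw [← mem_cells]
  simp only [ofRowFn, Finset.mem_filter, Finset.mem_product, Finset.mem_range]
  have := hf (Nat.zero_le i)
  omega

theorem rowLen_ofRowFn {h : ℕ} {f : ℕ → ℕ} {hf : Antitone f} {i : ℕ} (hi : i < h) :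
    (ofRowFn h f hf).rowLen i = f i := by
  have key : ∀ j, j < (ofRowFn h f hf).rowLen i ↔ j < f i := fun j => by
    rw [← mem_iff_lt_rowLen, mem_ofRowFn]
    simp [hi]
  exact le_antisymm (not_lt.1 fun hlt => lt_irrefl _ ((key _).1 hlt))
    (not_lt.1 fun hlt => lt_irrefl _ ((key _).2 hlt))

theorem leg_eq_of_mem {lam : YoungDiagram} {i j l : ℕ} (h1 : (i + l, j) ∈ lam)
    (h2 : (i + l + 1, j) ∉ lam) : lam.leg (i, j) = l := by
  rw [mem_iff_lt_colLen] at h1 h2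
  simp only [leg]
  omega

theorem card_ofRowFn (h : ℕ) (f : ℕ → ℕ) (hf : Antitone f) :
    (ofRowFn h f hf).card = ∑ i ∈ Finset.range h, f i := by
  rw [card_eq_sum_rowLen _ (h := h)]
  · exact Finset.sum_congr rfl fun i hi => rowLen_ofRowFn (Finset.mem_range.1 hi)
  · by_contra hlt
    rw [not_le, ← mem_iff_lt_colLen, mem_ofRowFn] at hlt
    omega

end YoungDiagram

/-- The length of the `s`-th row from the bottom in `slopeDiagram p q`. -/
def slopeRow (p q s : ℕ) : ℕ := (p * s + (p + q - 1 - s / q)) / q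

theorem slopeRow_mono {p q : ℕ} (hp : 0 < p) : Monotone (slopeRow p q) := by
  refine monotone_nat_of_le_succ fun s => Nat.div_le_div_right ?_
  have h1 : (s + 1) / q ≤ s / q + 1 := by
    rcases Nat.eq_zero_or_pos q with rfl | hq
    · simp
    · rw [← Nat.add_div_right s hq]
      exact Nat.div_le_div_right (by omega)
  rw [Nat.mul_succ]
  omega

theorem slopeRow_antitone {p : ℕ} (q : ℕ) (hp : 0 < p) :
    Antitone fun i => slopeRow p q ((p + q) * q - 1 - i) :=
  fun _ _ h => slopeRow_mono hp (by omega)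

/-- A discrete triangle of slope close to `p / q`: row `s = r q + σ` from the bottom has length
`p r + ⌊(p σ + (p + q - 1 - r)) / q⌋` for `0 ≤ r < p + q` and `0 ≤ σ < q`. The offset
`p + q - 1 - r` takes every value below `p + q`, so that the rows `s` and `s - t q` have lengths
differing by about `p t`, with an error whose sign depends on `σ`: for a positive proportion of `σ`
this produces boxes with `(arm + 1, leg) = t (p, q)`. -/
def slopeDiagram (p q : ℕ) (hp : 0 < p) : YoungDiagram :=
  YoungDiagram.ofRowFn ((p + q) * q) _ (slopeRow_antitone q hp)

theorem slopeRow_eq {p q r s : ℕ} (hs : s < q) :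
    slopeRow p q (r * q + s) = p * r + (p * s + (p + q - 1 - r)) / q := by
  have hq : 0 < q := by omega
  have h1 : (r * q + s) / q = r := by
    rw [mul_comm, Nat.mul_add_div hq, Nat.div_eq_of_lt hs, add_zero]
  rw [slopeRow, h1, show p * (r * q + s) + (p + q - 1 - r) =
    q * (p * r) + (p * s + (p + q - 1 - r)) by ring, Nat.mul_add_div hq]

theorem two_mul_card_slopeDiagram_le {p q : ℕ} (hp : 0 < p) (hq : 0 < q) :
    2 * (slopeDiagram p q hp).card ≤ (p + q) ^ 2 * (p * q + 2) := by
  set h := p + q with hh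
  have h1 : (slopeDiagram p q hp).card = ∑ s ∈ Finset.range (h * q), slopeRow p q s := by
    rw [slopeDiagram, YoungDiagram.card_ofRowFn]
    exact Finset.sum_range_reflect (slopeRow p q) _
  have h2 : q * (slopeDiagram p q hp).card ≤ ∑ s ∈ Finset.range (h * q), (p * s + h) := by
    rw [h1, Finset.mul_sum]
    refine Finset.sum_le_sum fun s _ => ?_
    refine (Nat.mul_div_le _ _).trans ?_
    generalize s / q = u
    omega
  have h3 : (∑ s ∈ Finset.range (h * q), s) * 2 = (h * q) * (h * q - 1) :=
    Finset.sum_range_id_mul_two _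
  have h4 : (h * q) * (h * q - 1) ≤ (h * q) * (h * q) := Nat.mul_le_mul_left _ (Nat.sub_le _ _)
  rw [Finset.sum_add_distrib, ← Finset.mul_sum, Finset.sum_const, Finset.card_range,
    smul_eq_mul] at h2
  have h5 : q * (2 * (slopeDiagram p q hp).card) ≤ q * (h ^ 2 * (p * q + 2)) := by
    nlinarith
  exact Nat.le_of_mul_le_mul_left h5 hq

open Classical in
/-- The boxes of `slopeDiagram p q` at which `(arm + 1, leg)` is a multiple of `(p, q)`. -/
noncomputable def slopeBoxes (p q : ℕ) (hp : 0 < p) : Finset (ℕ × ℕ) :=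
  (slopeDiagram p q hp).cells.filter fun c => ∃ t : ℕ, 0 < t ∧ t < p + q ∧
    (slopeDiagram p q hp).arm c + 1 = t * p ∧ (slopeDiagram p q hp).leg c = t * q

/-- Rows `r q + s` and `r' q + s` from the bottom produce a box of slope `p / q` under two floor
conditions on their offsets. -/
theorem mem_slopeBoxes {p q : ℕ} (hp : 0 < p) {r r' s : ℕ} (hr : r < p + q) (hr' : r' < r)
    (hs : s < q) (hs0 : 0 < s)
    (h1 : (p * s + (p + q - 1 - r)) / q < (p * s + (p + q - 1 - r')) / q)
    (h2 : (p * s + (p + q - 1 - r') - p) / q ≤ (p * s + (p + q - 1 - r)) / q) :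
    ((p + q) * q - 1 - (r * q + s), p * r' + (p * s + (p + q - 1 - r)) / q) ∈
      slopeBoxes p q hp := by
  obtain ⟨t, rfl⟩ := Nat.exists_eq_add_of_lt hr'
  have hlt : (r' + t + 1) * q + s < (p + q) * q := by
    calc (r' + t + 1) * q + s < (r' + t + 1) * q + q := by omega
      _ = (r' + t + 1 + 1) * q := by ring
      _ ≤ (p + q) * q := Nat.mul_le_mul_right _ (by omega)
  have hrow : ∀ k, k < (p + q) * q →
      (p + q) * q - 1 - ((p + q) * q - 1 - k) = k := fun k hk => by omega
  set i := (p + q) * q - 1 - ((r' + t + 1) * q + s) with hi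
  set y := (p * s + (p + q - 1 - (r' + t + 1))) / q with hy
  have hexp : (r' + t + 1) * q + s = r' * q + s + (t + 1) * q := by ring
  have hrowLen : (slopeDiagram p q hp).rowLen i = p * (r' + t + 1) + y := by
    rw [slopeDiagram, YoungDiagram.rowLen_ofRowFn (by omega), hrow _ hlt, slopeRow_eq hs]
  have hpt : p * (r' + t + 1) = p * r' + (t + 1) * p := by ring
  have htp : 0 < (t + 1) * p := by positivity
  have hmem : (i, p * r' + y) ∈ slopeDiagram p q hp := by
    rw [YoungDiagram.mem_iff_lt_rowLen, hrowLen]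
    omega
  classical
  rw [slopeBoxes, Finset.mem_filter]
  refine ⟨(YoungDiagram.mem_cells _).2 hmem, t + 1, by omega, by omega, ?_, ?_⟩
  · simp only [YoungDiagram.arm]
    rw [hrowLen]
    omega
  · apply YoungDiagram.leg_eq_of_mem
    · rw [slopeDiagram, YoungDiagram.mem_ofRowFn]
      refine ⟨by omega, ?_⟩
      rw [show (p + q) * q - 1 - (i + (t + 1) * q) = r' * q + s by omega, slopeRow_eq hs]
      omega
    · rw [slopeDiagram, YoungDiagram.mem_ofRowFn]
      rintro ⟨-, h⟩
      rw [show (p + q) * q - 1 - (i + (t + 1) * q + 1) = r' * q + (s - 1) by omega,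
        slopeRow_eq (by omega)] at h
      have hps : p * (s - 1) = p * s - p := by rw [Nat.mul_sub, mul_one]
      have hps' : p ≤ p * s := Nat.le_mul_of_pos_right _ hs0
      rw [show p * (s - 1) + (p + q - 1 - r') = p * s + (p + q - 1 - r') - p by omega] at h
      omega

/-- A lower bound, up to one, for the number of residues `σ` modulo `q` for which rows with offset
difference `d` give a box of slope `p / q`. -/
def slopeCount (p q d : ℕ) : ℤ := min (d : ℤ) q - max ((d : ℤ) - p) 0

/-- Adding `d` to the numerator crosses a multiple of `q` for exactly `d` of the `q` residues. -/
theorem card_floor_lt {p q : ℕ} (hq : 0 < q) (hpq : IsCoprime (p : ℤ) (q : ℤ)) (c : ℤ) {d : ℤ}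
    (hd0 : 0 ≤ d) (hdq : d ≤ q) :
    (((Finset.range q).filter fun s : ℕ => (p * s + c) / (q : ℤ) < (p * s + c + d) / q).card : ℤ) =
      d := by
  have hq' : (0 : ℤ) < q := by exact_mod_cast hq
  have key : ∀ z : ℤ, z / q < (z + d) / q ↔ q - d ≤ z % q := by
    intro z
    have h0 := Int.emod_nonneg z hq'.ne'
    have h1 := Int.emod_lt_of_pos z hq'
    have h2 : z + d = (z % q + d) + q * (z / q) := by
      have := Int.mul_ediv_add_emod z q
      linarith
    rw [h2, Int.add_mul_ediv_left _ _ hq'.ne']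
    constructor
    · intro h
      by_contra hlt
      have h3 : (z % q + d) / q = 0 := Int.ediv_eq_zero_of_lt (by linarith) (by linarith)
      rw [h3] at h
      linarith
    · intro h
      have : 1 ≤ (z % q + d) / q := by
        rw [Int.le_ediv_iff_mul_le hq']
        linarith
      linarith
  have h1 := sum_residues hq hpq c (fun r : ℤ => if (q : ℤ) - d ≤ r then (1 : ℤ) else 0)
  rw [Finset.card_filter]
  push_cast
  have h4 : ∀ s ∈ Finset.range q,
      (if (p * (s : ℤ) + c) / (q : ℤ) < (p * s + c + d) / q then (1 : ℤ) else 0) =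
        if (q : ℤ) - d ≤ (p * s + c) % q then 1 else 0 :=
    fun s _ => if_congr (key (p * s + c)) rfl rfl
  rw [Finset.sum_congr rfl h4, h1, ← Finset.sum_range_reflect]
  obtain ⟨e, rfl⟩ := Int.eq_ofNat_of_zero_le hd0
  have h2 : ∀ j ∈ Finset.range q, (if (q : ℤ) - e ≤ ((q - 1 - j : ℕ) : ℤ) then (1 : ℤ) else 0) =
      if j < e then 1 else 0 := by
    intro j hj
    have := Finset.mem_range.1 hj
    refine if_congr ?_ rfl rfl
    omega
  rw [Finset.sum_congr rfl h2, ← Finset.sum_filter, Finset.sum_const, nsmul_eq_mul, mul_one]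
  have h3 : (Finset.range q).filter (fun j => j < e) = Finset.range e := by
    ext j
    simp only [Finset.mem_filter, Finset.mem_range]
    omega
  rw [h3, Finset.card_range]

/-- The residues `σ` giving a box of slope `p / q` from the row pair `(r q + σ, r' q + σ)`. The
residue `0` is left out because there the row just below `r' q + σ` has a different offset. -/
def slopeResidues (p q r r' : ℕ) : Finset ℕ :=
  (Finset.range q).filter fun s => 0 < s ∧
    (p * s + (p + q - 1 - r)) / q < (p * s + (p + q - 1 - r')) / q ∧
    (p * s + (p + q - 1 - r') - p) / q ≤ (p * s + (p + q - 1 - r)) / q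

theorem slopeCount_le_card {p q r r' : ℕ} (hq : 0 < q) (hpq : IsCoprime (p : ℤ) (q : ℤ))
    (hr : r < p + q) (hr' : r' < r) :
    slopeCount p q (r - r') - 1 ≤ (slopeResidues p q r r').card := by
  set c : ℤ := (p : ℤ) + q - 1 - r with hc
  set d : ℤ := (r : ℤ) - r' with hd
  have hd0 : 0 < d := by omega
  have hq' : (0 : ℤ) < q := by exact_mod_cast hq
  set A := (Finset.range q).filter fun s : ℕ =>
    (p * s + c) / (q : ℤ) < (p * s + c + min d q) / q with hA
  set B := (Finset.range q).filter fun s : ℕ =>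
    (p * s + c) / (q : ℤ) < (p * s + c + max (d - p) 0) / q with hB
  have hAc : (A.card : ℤ) = min d q := card_floor_lt hq hpq c (by omega) (by omega)
  have hBc : (B.card : ℤ) = max (d - p) 0 := card_floor_lt hq hpq c (by omega) (by omega)
  have hsub : A ⊆ insert 0 (B ∪ slopeResidues p q r r') := by
    intro s hs
    obtain ⟨hs1, hs2⟩ := Finset.mem_filter.1 hs
    rw [Finset.mem_insert, Finset.mem_union]
    by_cases h0 : s = 0
    · exact Or.inl h0
    right
    by_cases hb : s ∈ B
    · exact Or.inl hb
    right
    refine Finset.mem_filter.2 ⟨hs1, Nat.pos_of_ne_zero h0, ?_, ?_⟩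
    · zify
      have e1 : ((p + q - 1 - r : ℕ) : ℤ) = c := by omega
      have e2 : ((p + q - 1 - r' : ℕ) : ℤ) = c + d := by omega
      rw [e1, e2, ← add_assoc]
      exact hs2.trans_le (Int.ediv_le_ediv hq' (by omega))
    · have hps : p ≤ p * s := Nat.le_mul_of_pos_right _ (Nat.pos_of_ne_zero h0)
      have e1 : ((p + q - 1 - r : ℕ) : ℤ) = c := by omega
      have e2 : ((p * s + (p + q - 1 - r') - p : ℕ) : ℤ) = p * s + c + (d - p) := by
        rw [Nat.cast_sub (by omega)]
        push_cast [e1]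
        omega
      have hb' : (p * s + c + max (d - p) 0) / (q : ℤ) ≤ (p * s + c) / q := by
        by_contra hlt
        exact hb (Finset.mem_filter.2 ⟨hs1, not_le.1 hlt⟩)
      zify
      rw [e1]
      rw [show ((p * s + (p + q - 1 - r') - p : ℕ) : ℤ) = p * s + c + (d - p) from e2]
      exact (Int.ediv_le_ediv hq' (by omega)).trans hb'
  have hcard := (Finset.card_le_card hsub).trans ((Finset.card_insert_le _ _).trans
    (Nat.add_le_add_right (Finset.card_union_le _ _) 1))
  have hcard' : (A.card : ℤ) ≤ B.card + (slopeResidues p q r r').card + 1 := by exact_mod_cast hcard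
  rw [slopeCount, show (((r - r' : ℕ) : ℤ)) = d by omega]
  omega

/-- The symmetry `d ↦ p + q - d` of `slopeCount` evaluates its double sums. -/
theorem two_mul_sum_slopeCount (p q : ℕ) :
    2 * ∑ r ∈ Finset.range (p + q), ∑ d ∈ Finset.range (r + 1), slopeCount p q d =
      (p + q) * (p * q) := by
  have htot : ∑ d ∈ Finset.range (p + q + 1), slopeCount p q d = p * q := by
    have h1 : ∑ d ∈ Finset.range (q + p), min (d : ℤ) q = ∑ d ∈ Finset.range q, (d : ℤ) + p * q := by
      rw [Finset.sum_range_add]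
      congr 1
      · refine Finset.sum_congr rfl fun d hd => ?_
        have := Finset.mem_range.1 hd
        omega
      · rw [Finset.sum_congr rfl fun d _ => show min ((q + d : ℕ) : ℤ) q = q by omega]
        simp
    have h2 : ∑ d ∈ Finset.range (p + q), max ((d : ℤ) - p) 0 = ∑ d ∈ Finset.range q, (d : ℤ) := by
      rw [Finset.sum_range_add, Finset.sum_eq_zero, zero_add]
      · refine Finset.sum_congr rfl fun d _ => ?_
        omega
      · intro d hd
        have := Finset.mem_range.1 hd
        omega
    have h3 : slopeCount p q (p + q) = 0 := by
      simp only [slopeCount]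
      omega
    rw [Finset.sum_range_succ, h3, add_zero]
    simp only [slopeCount]
    rw [Finset.sum_sub_distrib, h2, add_comm p q, h1]
    ring
  have hpair : ∀ r ∈ Finset.range (p + q), ∑ d ∈ Finset.range (r + 1), slopeCount p q d +
      ∑ d ∈ Finset.range (p + q - 1 - r + 1), slopeCount p q d = p * q := by
    intro r hr
    have := Finset.mem_range.1 hr
    rw [← htot, show p + q + 1 = (r + 1) + (p + q - 1 - r + 1) by omega,
      Finset.sum_range_add (n := r + 1)]
    congr 1
    rw [← Finset.sum_range_reflect]
    refine Finset.sum_congr rfl fun d hd => ?_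
    have := Finset.mem_range.1 hd
    simp only [slopeCount]
    omega
  have hrefl := Finset.sum_range_reflect
    (fun r => ∑ d ∈ Finset.range (r + 1), slopeCount p q d) (p + q)
  rw [two_mul]
  nth_rewrite 2 [← hrefl]
  rw [← Finset.sum_add_distrib, Finset.sum_congr rfl hpair]
  simp

/-- At least about `p q (p + q) / 2` boxes of `slopeDiagram p q` have slope `p / q`, out of about
`p q (p + q) ^ 2 / 2`. -/
theorem le_two_mul_card_slopeBoxes {p q : ℕ} (hp : 0 < p) (hq : 0 < q)
    (hpq : IsCoprime (p : ℤ) (q : ℤ)) :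
    ((p : ℤ) + q) * (p * q - (p + q)) ≤ 2 * (slopeBoxes p q hp).card := by
  set T := (Finset.range (p + q)).sigma fun r => (Finset.range r).sigma fun r' =>
    slopeResidues p q r r' with hT
  have hle : T.card ≤ (slopeBoxes p q hp).card := by
    refine Finset.card_le_card_of_injOn (fun z : (Σ _ : ℕ, Σ _ : ℕ, ℕ) =>
      ((p + q) * q - 1 - (z.1 * q + z.2.2),
        p * z.2.1 + (p * z.2.2 + (p + q - 1 - z.1)) / q)) ?_ ?_
    · rintro ⟨r, r', s⟩ hz
      obtain ⟨hr, hz⟩ := Finset.mem_sigma.1 hz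
      obtain ⟨hr', hz⟩ := Finset.mem_sigma.1 hz
      obtain ⟨hs, hs0, h1, h2⟩ := Finset.mem_filter.1 hz
      exact mem_slopeBoxes hp (Finset.mem_range.1 hr) (Finset.mem_range.1 hr')
        (Finset.mem_range.1 hs) hs0 h1 h2
    · rintro ⟨r, r', s⟩ hz ⟨u, u', v⟩ hz' heq
      obtain ⟨hr, hz⟩ := Finset.mem_sigma.1 hz
      obtain ⟨hr', hz⟩ := Finset.mem_sigma.1 hz
      have hs := Finset.mem_range.1 (Finset.mem_filter.1 hz).1
      obtain ⟨hu, hz'⟩ := Finset.mem_sigma.1 hz'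
      obtain ⟨hu', hz'⟩ := Finset.mem_sigma.1 hz'
      have hv := Finset.mem_range.1 (Finset.mem_filter.1 hz').1
      simp only [Finset.mem_range] at hr hr' hu hu' hs hv
      simp only [Prod.mk.injEq] at heq
      have hlt : ∀ r s, r < p + q → s < q → r * q + s < (p + q) * q := fun r s hr hs => by
        calc r * q + s < r * q + q := by omega
          _ = (r + 1) * q := by ring
          _ ≤ (p + q) * q := Nat.mul_le_mul_right _ hr
      have h1 := hlt r s hr hs
      have h2 := hlt u v hu hv
      have h3 : r * q + s = u * q + v := by omega
      have hdiv : ∀ r s, s < q → (r * q + s) / q = r := fun r s hs => by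
        rw [mul_comm, Nat.mul_add_div hq, Nat.div_eq_of_lt hs, add_zero]
      have h4 : r = u := by rw [← hdiv r s hs, h3, hdiv u v hv]
      subst h4
      have h5 : s = v := by omega
      subst h5
      have h6 : p * r' = p * u' := by omega
      have h7 : r' = u' := Nat.eq_of_mul_eq_mul_left hp h6
      rw [h7]
  have hcard : (T.card : ℤ) = ∑ r ∈ Finset.range (p + q), ∑ r' ∈ Finset.range r,
      ((slopeResidues p q r r').card : ℤ) := by
    rw [hT, Finset.card_sigma]
    push_cast
    refine Finset.sum_congr rfl fun r _ => ?_
    rw [Finset.card_sigma]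
    push_cast
    rfl
  have hinner : ∀ r ∈ Finset.range (p + q), ∑ d ∈ Finset.range (r + 1), slopeCount p q d - r ≤
      ∑ r' ∈ Finset.range r, ((slopeResidues p q r r').card : ℤ) := by
    intro r hr
    have h0 : slopeCount p q 0 = 0 := by
      simp only [slopeCount]
      omega
    rw [Finset.sum_range_succ', h0, add_zero, ← Finset.sum_range_reflect]
    calc ∑ j ∈ Finset.range r, slopeCount p q (r - 1 - j + 1) - (r : ℤ)
        = ∑ j ∈ Finset.range r, (slopeCount p q (r - j) - 1) := by
          rw [Finset.sum_sub_distrib]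
          simp only [Finset.sum_const, Finset.card_range, nsmul_eq_mul, mul_one]
          congr 1
          refine Finset.sum_congr rfl fun j hj => ?_
          have := Finset.mem_range.1 hj
          congr 1
          omega
      _ ≤ _ := Finset.sum_le_sum fun r' hr' =>
          slopeCount_le_card hq hpq (Finset.mem_range.1 hr) (Finset.mem_range.1 hr')
  have hsum := Finset.sum_le_sum hinner
  rw [← hcard, Finset.sum_sub_distrib] at hsum
  have h2 := two_mul_sum_slopeCount p q
  have h3 : 2 * ∑ r ∈ Finset.range (p + q), (r : ℤ) ≤ ((p : ℤ) + q) * (p + q) := by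
    have h4 := Finset.sum_range_id_mul_two (p + q)
    have h5 : (p + q) * (p + q - 1) ≤ (p + q) * (p + q) := Nat.mul_le_mul_left _ (Nat.sub_le _ _)
    rw [← h4] at h5
    have : (((∑ i ∈ Finset.range (p + q), i) * 2 : ℕ) : ℤ) ≤ (((p + q) * (p + q) : ℕ) : ℤ) := by
      exact_mod_cast h5
    push_cast at this
    linarith
  have hle' : (T.card : ℤ) ≤ (slopeBoxes p q hp).card := by exact_mod_cast hle
  rw [mul_sub]
  linarith

/-! ### Irrational `b² > 0`: upper bound on the radius -/

section

variable {ε₁ ε₂ : ℂ} {N : ℕ} {m : ℂ} {a : Fin N → ℂ} {x : ℝ}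

/-- If every vertex were obstructed, each would have an edge `a I - a J - m ∈ ε₁ ℤ + ε₂ ℤ`; along an
edge `Im (a I / ε₂)` drops by the non-zero number `Im (m / ε₂)`, which finitely many vertices do not
allow. -/
theorem GenericParams.exists_unobstructed (hg : GenericParams m a ε₁ ε₂) (hN : 1 ≤ N)
    (hx : Irrational x) (he : ε₁ / ε₂ = (x : ℂ)) : ∃ I, Unobstructed m a ε₁ ε₂ I := by
  by_contra hobs
  push Not at hobs
  have hlin := lattice_relation_eq_zero (ε₁ := ε₁) hg.ne_zero₂ (fun r h => by
    rw [he] at h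
    exact hx.ne_rat r (by exact_mod_cast h))
  have hstep : ∀ I : Fin N, ∃ J, (a J / ε₂).im = (a I / ε₂).im - (m / ε₂).im := by
    intro I
    obtain ⟨J, hJ⟩ := hg.exists_edge_of_obstructed hlin hobs I
    refine ⟨J, ?_⟩
    have hmem : a I - a J - m ∈ epsLattice ε₁ ε₂ := by
      rcases hJ with ⟨k, l, h⟩ | ⟨k, l, h⟩
      · exact ⟨-(l + 1), -(k + 1), by rw [h]; push_cast; ring⟩
      · exact ⟨l, k, by rw [h]; push_cast; ring⟩
    have := im_div_eq_zero_of_mem_epsLattice hg.ne_zero₂ he hmem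
    rw [sub_div, sub_div, Complex.sub_im, Complex.sub_im] at this
    linarith
  have : Nonempty (Fin N) := ⟨⟨0, hN⟩⟩
  obtain ⟨I, hI⟩ := Finite.exists_min fun I : Fin N => (a I / ε₂).im * (m / ε₂).im
  obtain ⟨J, hJ⟩ := hstep I
  have h1 := hI J
  rw [hJ] at h1
  have h2 := mul_self_pos.2 (hg.im_mass_ne_zero hx he)
  nlinarith

/-- The map from boxes to pairs (arm, row) is injective, so a function of it that is at least `ρ`
away from finitely many pairs has product at least a constant times `ρ ^ |λ|`. -/
theorem exists_mul_pow_le_prod (φ : ℕ → ℕ → ℝ) {ρ : ℝ} (hρ0 : 0 < ρ) (hρ1 : ρ ≤ 1)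
    (hφ : ∀ A i, 0 < φ A i) {n₀ : ℕ} (hlarge : ∀ A i, n₀ ≤ A ∨ n₀ ≤ i → ρ ≤ φ A i) :
    ∃ c : ℝ, 0 < c ∧ ∀ lam : YoungDiagram,
      c * ρ ^ lam.card ≤ ∏ b ∈ lam.cells, φ (lam.arm b) b.1 := by
  classical
  set E := Finset.range n₀ ×ˢ Finset.range n₀ with hE
  let ψ : ℕ × ℕ → ℝ := fun z => if z ∈ E then min (φ z.1 z.2) 1 else 1
  have hψ0 : ∀ z, 0 < ψ z := by
    intro z
    simp only [ψ]
    split_ifs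
    · exact lt_min (hφ _ _) one_pos
    · exact one_pos
  have hψ1 : ∀ z, ψ z ≤ 1 := by
    intro z
    simp only [ψ]
    split_ifs
    · exact min_le_right _ _
    · exact le_rfl
  have hψφ : ∀ z : ℕ × ℕ, ψ z * ρ ≤ φ z.1 z.2 := by
    intro z
    have h0 := hφ z.1 z.2
    by_cases hz : z ∈ E
    · have h1 : ψ z ≤ φ z.1 z.2 := by
        simp only [ψ, if_pos hz]
        exact min_le_left _ _
      have := hψ0 z
      nlinarith
    · simp only [ψ, if_neg hz, one_mul]
      apply hlarge
      by_contra hcon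
      push Not at hcon
      exact hz (Finset.mem_product.2 ⟨Finset.mem_range.2 hcon.1, Finset.mem_range.2 hcon.2⟩)
  refine ⟨∏ z ∈ E, ψ z, Finset.prod_pos fun z _ => hψ0 z, fun lam => ?_⟩
  have hinj : Set.InjOn (fun b : ℕ × ℕ => (lam.arm b, b.1)) lam.cells := by
    rintro ⟨i, j⟩ hb ⟨i', j'⟩ hb' h
    obtain ⟨h1, h2⟩ := Prod.mk.inj h
    simp only at h2
    subst h2
    have e1 := YoungDiagram.arm_add (Finset.mem_coe.1 hb)
    have e2 := YoungDiagram.arm_add (Finset.mem_coe.1 hb')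
    simp only at h1 e1 e2
    rw [Prod.mk.injEq]
    exact ⟨rfl, by omega⟩
  have hprod : ∏ z ∈ E, ψ z ≤ ∏ b ∈ lam.cells, ψ (lam.arm b, b.1) := by
    rw [← Finset.prod_image hinj]
    set T := lam.cells.image fun b => (lam.arm b, b.1)
    have h1 : ∏ z ∈ T, ψ z = ∏ z ∈ T ∩ E, ψ z := by
      refine (Finset.prod_subset Finset.inter_subset_left fun z hz hz' => ?_).symm
      have : z ∉ E := fun h => hz' (Finset.mem_inter.2 ⟨hz, h⟩)
      simp only [ψ, if_neg this]
    rw [h1, ← Finset.prod_sdiff (Finset.inter_subset_right : T ∩ E ⊆ E)]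
    exact mul_le_of_le_one_left (Finset.prod_nonneg fun z _ => (hψ0 z).le)
      (Finset.prod_le_one (fun z _ => (hψ0 z).le) fun z _ => hψ1 z)
  calc (∏ z ∈ E, ψ z) * ρ ^ lam.card
      ≤ (∏ b ∈ lam.cells, ψ (lam.arm b, b.1)) * ρ ^ lam.card := by gcongr
    _ = ∏ b ∈ lam.cells, ψ (lam.arm b, b.1) * ρ := by
        rw [Finset.prod_mul_distrib, Finset.prod_const]
    _ ≤ _ := Finset.prod_le_prod (fun b _ => mul_nonneg (hψ0 _).le hρ0.le) fun b _ => hψφ _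

theorem exp_neg_one_le_norm_one_sub_div {m d : ℂ} (h : 2 * ‖m‖ ≤ ‖d‖) (hd : 0 < ‖d‖) :
    Real.exp (-1) ≤ ‖1 - m / d‖ := by
  have h1 : ‖m / d‖ ≤ 1 / 2 := by
    rw [norm_div, div_le_iff₀ hd]
    linarith
  have h2 : 1 - ‖m / d‖ ≤ ‖1 - m / d‖ := by
    have := norm_sub_norm_le (1 : ℂ) (m / d)
    rwa [norm_one] at this
  have h3 : Real.exp (-1) ≤ 1 / 2 := by
    rw [Real.exp_neg, ← one_div]
    refine one_div_le_one_div_of_le (by norm_num) ?_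
    have := Real.add_one_le_exp (1 : ℝ)
    linarith
  linarith

/-- Against an empty diagram, the factor `Z_{λ∅}` is not much smaller than `1`: there all steps go
in the same direction and only finitely many denominators are bounded. -/
theorem exists_mul_exp_le_norm_prod (h0 : ε₂ ≠ 0) (hx0 : 0 < x) (he : ε₁ / ε₂ = (x : ℂ))
    (z m : ℂ) (s : ℕ)
    (hne : ∀ k l : ℕ, z + (((k : ℂ) + s) * ε₂ + ((l : ℂ) + s) * ε₁) ≠ m) :
    ∃ c : ℝ, 0 < c ∧ ∀ lam : YoungDiagram, c * Real.exp (-1) ^ lam.card ≤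
      ∏ b ∈ lam.cells,
        ‖1 - m / (z + (((lam.arm b : ℂ) + s) * ε₂ + ((b.1 : ℂ) + s) * ε₁))‖ := by
  have hn := norm_pos_iff.2 h0
  obtain ⟨n₁, hn₁⟩ := exists_nat_gt ((2 * ‖m‖ + ‖z‖) / ‖ε₂‖)
  obtain ⟨n₂, hn₂⟩ := exists_nat_gt ((2 * ‖m‖ + ‖z‖) / ‖ε₂‖ / x)
  refine exists_mul_pow_le_prod
    (fun A i => ‖1 - m / (z + (((A : ℂ) + s) * ε₂ + ((i : ℂ) + s) * ε₁))‖)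
    (Real.exp_pos _) (by rw [Real.exp_le_one_iff]; norm_num)
    (fun A i => norm_pos_iff.2 (one_sub_div_ne_zero (hne A i))) (n₀ := max n₁ n₂) ?_
  intro A i hAi
  rw [div_eq_iff h0] at he
  have e : ((A : ℂ) + s) * ε₂ + ((i : ℂ) + s) * ε₁ = (((A + s : ℝ) + x * (i + s) : ℝ) : ℂ) * ε₂ := by
    rw [he]
    push_cast
    ring
  have hA : (0 : ℝ) ≤ A := by positivity
  have hi : (0 : ℝ) ≤ x * i := by positivity
  have hs : (0 : ℝ) ≤ s := by positivity
  have hs' : (0 : ℝ) ≤ x * s := by positivity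
  have hbig : (2 * ‖m‖ + ‖z‖) / ‖ε₂‖ < (A + s : ℝ) + x * (i + s) := by
    rcases hAi with h | h
    · have : (n₁ : ℝ) ≤ A := by exact_mod_cast (le_max_left _ _).trans h
      linarith
    · have h1 : (n₂ : ℝ) ≤ i := by exact_mod_cast (le_max_right _ _).trans h
      rw [div_lt_iff₀ hx0] at hn₂
      nlinarith
  rw [div_lt_iff₀ hn] at hbig
  have h1 : 2 * ‖m‖ < ‖z + (((A : ℂ) + s) * ε₂ + ((i : ℂ) + s) * ε₁)‖ := by
    rw [e]
    have h2 := norm_sub_norm_le ((((A + s : ℝ) + x * (i + s) : ℝ) : ℂ) * ε₂) (-z)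
    rw [norm_neg, sub_neg_eq_add, norm_mul, Complex.norm_real, Real.norm_eq_abs,
      abs_of_nonneg (by nlinarith), add_comm _ z] at h2
    linarith
  exact exp_neg_one_le_norm_one_sub_div h1.le (lt_of_le_of_lt (by positivity) h1)

/-- The distance from `1` to the line through `0` and `1 / μ` bounds the diagonal factors below. -/
theorem abs_im_div_norm_le (μ : ℂ) (d : ℝ) : |μ.im| / ‖μ‖ ≤ ‖1 - μ / d‖ := by
  by_cases hμ : μ = 0
  · simp [hμ]
  have hμ' := norm_pos_iff.2 hμ
  by_cases hd : d = 0
  · subst hd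
    simp only [Complex.ofReal_zero, div_zero, sub_zero, norm_one]
    rw [div_le_one hμ']
    exact Complex.abs_im_le_norm _
  have hd' : (d : ℂ) ≠ 0 := Complex.ofReal_ne_zero.2 hd
  have h1 : |μ.im| * |d| ≤ ‖μ‖ * ‖(d : ℂ) - μ‖ := by
    have h2 : (starRingEnd ℂ μ * ((d : ℂ) - μ)).im = -(μ.im * d) := by
      simp only [Complex.mul_im, Complex.conj_re, Complex.conj_im, Complex.sub_re, Complex.sub_im,
        Complex.ofReal_re, Complex.ofReal_im]
      ring
    rw [← abs_mul, ← abs_neg, ← h2, ← Complex.norm_conj μ, ← norm_mul]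
    exact Complex.abs_im_le_norm _
  have h3 : 1 - μ / d = ((d : ℂ) - μ) / d := by
    field_simp
  rw [h3, norm_div, Complex.norm_real, Real.norm_eq_abs, div_le_div_iff₀ hμ' (abs_pos.2 hd)]
  linarith

theorem boxDenom_self_right_eq (h0 : ε₂ ≠ 0) (he : ε₁ / ε₂ = (x : ℂ)) {lam : YoungDiagram}
    {c : ℕ × ℕ} (hc : c ∈ lam.cells) (m : ℂ) : m / boxDenom ε₁ ε₂ lam lam (0 + ε₂) c =
      (m / ε₂) / ((((lam.arm c : ℝ) + 1) - x * lam.leg c : ℝ) : ℂ) := by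
  rw [boxDenom_self_right hc, zero_add, div_div]
  rw [div_eq_iff h0] at he
  rw [he]
  push_cast
  congr 1
  ring

theorem boxDenom_self_left_eq (h0 : ε₂ ≠ 0) (he : ε₁ / ε₂ = (x : ℂ)) {lam : YoungDiagram}
    {c : ℕ × ℕ} (hc : c ∈ lam.cells) (m : ℂ) : m / boxDenom ε₁ ε₂ lam lam (0 - ε₁) c =
      (m / ε₂) / (((lam.arm c : ℝ) - x * (lam.leg c + 1) : ℝ) : ℂ) := by
  rw [boxDenom_self_left hc, zero_add, div_div]
  rw [div_eq_iff h0] at he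
  rw [he]
  push_cast
  congr 1
  ring

/-- The constant in the upper bound on the radius. Each box loses at most a factor `e` in each of the
two factors attached to an empty diagram, and at most `|m / ε₂| / |Im (m / ε₂)|` in each of its two
diagonal factors. -/
noncomputable def upperConstant (N : ℕ) (p : ℂ × (Fin N → ℂ) × ℂ × ℂ) : ℝ :=
  Real.exp (2 * N) * (‖p.1 / p.2.2.2‖ / |(p.1 / p.2.2.2).im|) ^ 2

/-- If the diagonal factors at the boxes of `S` are at least `L`, then the term of the tuple with the
single diagram `lam` is at least `L ^ |S|` up to an exponential in `|λ|`. -/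
theorem GenericParams.exists_le_norm_ZTerm (hg : GenericParams m a ε₁ ε₂) (hx : Irrational x)
    (hx0 : 0 < x) (he : ε₁ / ε₂ = (x : ℂ)) {I : Fin N} (hI : Unobstructed m a ε₁ ε₂ I) :
    ∃ c : ℝ, 0 < c ∧ ∀ (lam : YoungDiagram) (S : Finset (ℕ × ℕ)) (L : ℝ), S ⊆ lam.cells → 0 ≤ L →
      (∀ b ∈ S, L ≤ ‖1 - (m / ε₂) / ((((lam.arm b : ℝ) + 1) - x * lam.leg b : ℝ) : ℂ)‖) →
        c * (upperConstant N (m, a, ε₁, ε₂))⁻¹ ^ lam.card * L ^ S.card ≤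
          ‖ZTerm m a ε₁ ε₂ (singleDiagram I lam)‖ := by
  set κ := |(m / ε₂).im| / ‖m / ε₂‖ with hκ
  have him := hg.im_mass_ne_zero hx he
  have hκ0 : 0 < κ := by
    refine div_pos (abs_pos.2 him) (norm_pos_iff.2 fun h => him ?_)
    rw [h, Complex.zero_im]
  have hκ1 : κ ≤ 1 := div_le_one_of_le₀ (Complex.abs_im_le_norm _) (norm_nonneg _)
  have key : ∀ J : Fin N, ∃ c : ℝ, 0 < c ∧ ∀ (lam : YoungDiagram) (S : Finset (ℕ × ℕ)) (L : ℝ),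
      S ⊆ lam.cells → 0 ≤ L →
      (∀ b ∈ S, L ≤ ‖1 - (m / ε₂) / ((((lam.arm b : ℝ) + 1) - x * lam.leg b : ℝ) : ℂ)‖) →
        c * (Real.exp (-1) ^ lam.card) ^ 2 *
          (if J = I then (κ ^ lam.card) ^ 2 * L ^ S.card else 1) ≤
          ‖ZLamMu ε₁ ε₂ lam (singleDiagram I lam J) (a I - a J + ε₂) m *
            ZLamMu ε₁ ε₂ lam (singleDiagram I lam J) (a I - a J - ε₁) (-m)‖ := by
    intro J
    by_cases hJ : J = I
    · subst hJ
      refine ⟨1, one_pos, fun lam S L hS hL hb => ?_⟩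
      rw [singleDiagram_same, if_pos rfl, sub_self, norm_mul]
      have h1 : κ ^ lam.card * L ^ S.card ≤ ‖ZLamMu ε₁ ε₂ lam lam (0 + ε₂) m‖ := by
        rw [ZLamMu, norm_prod, ← Finset.prod_sdiff hS]
        have e1 : κ ^ (lam.cells \ S).card ≤
            ∏ c ∈ lam.cells \ S, ‖1 - m / boxDenom ε₁ ε₂ lam lam (0 + ε₂) c‖ := by
          rw [← Finset.prod_const]
          refine Finset.prod_le_prod (fun _ _ => hκ0.le) fun c hc => ?_
          rw [boxDenom_self_right_eq hg.ne_zero₂ he (Finset.mem_sdiff.1 hc).1]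
          exact abs_im_div_norm_le _ _
        have e2 : L ^ S.card ≤ ∏ c ∈ S, ‖1 - m / boxDenom ε₁ ε₂ lam lam (0 + ε₂) c‖ := by
          rw [← Finset.prod_const]
          refine Finset.prod_le_prod (fun _ _ => hL) fun c hc => ?_
          rw [boxDenom_self_right_eq hg.ne_zero₂ he (hS hc)]
          exact hb c hc
        refine mul_le_mul (le_trans ?_ e1) e2 (by positivity)
          (Finset.prod_nonneg fun _ _ => norm_nonneg _)
        exact pow_le_pow_of_le_one hκ0.le hκ1 (Finset.card_le_card Finset.sdiff_subset)
      have h2 : κ ^ lam.card ≤ ‖ZLamMu ε₁ ε₂ lam lam (0 - ε₁) (-m)‖ := by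
        rw [ZLamMu, norm_prod, YoungDiagram.card, ← Finset.prod_const]
        refine Finset.prod_le_prod (fun _ _ => hκ0.le) fun c hc => ?_
        rw [boxDenom_self_left_eq hg.ne_zero₂ he hc, hκ, ← abs_neg, ← norm_neg, ← Complex.neg_im,
          ← neg_div]
        exact abs_im_div_norm_le _ _
      have h3 : (Real.exp (-1) ^ lam.card) ^ 2 ≤ 1 :=
        pow_le_one₀ (by positivity) (pow_le_one₀ (by positivity)
          (by rw [Real.exp_le_one_iff]; norm_num))
      calc 1 * (Real.exp (-1) ^ lam.card) ^ 2 * ((κ ^ lam.card) ^ 2 * L ^ S.card)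
          ≤ 1 * ((κ ^ lam.card) ^ 2 * L ^ S.card) := by
            rw [one_mul]
            gcongr
        _ = (κ ^ lam.card * L ^ S.card) * κ ^ lam.card := by ring
        _ ≤ _ := mul_le_mul h1 h2 (by positivity) (norm_nonneg _)
    · obtain ⟨c1, hc1, hb1⟩ := exists_mul_exp_le_norm_prod hg.ne_zero₂ hx0 he (a I - a J) m 1
        (fun k l => by simpa using (hI J k l).1)
      obtain ⟨c2, hc2, hb2⟩ := exists_mul_exp_le_norm_prod hg.ne_zero₂ hx0 he (a I - a J) (-m) 0
        (fun k l => by simpa using (hI J k l).2)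
      refine ⟨c1 * c2, by positivity, fun lam S L _ _ _ => ?_⟩
      rw [singleDiagram_of_ne hJ, if_neg hJ, mul_one, norm_mul]
      have h1 : c1 * Real.exp (-1) ^ lam.card ≤ ‖ZLamMu ε₁ ε₂ lam ⊥ (a I - a J + ε₂) m‖ := by
        refine (hb1 lam).trans (le_of_eq ?_)
        rw [ZLamMu, norm_prod]
        refine Finset.prod_congr rfl fun c hc => ?_
        rw [boxDenom_bot_right hc]
        simp
      have h2 : c2 * Real.exp (-1) ^ lam.card ≤ ‖ZLamMu ε₁ ε₂ lam ⊥ (a I - a J - ε₁) (-m)‖ := by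
        refine (hb2 lam).trans (le_of_eq ?_)
        rw [ZLamMu, norm_prod]
        refine Finset.prod_congr rfl fun c hc => ?_
        rw [boxDenom_bot_left hc]
        simp
      calc c1 * c2 * (Real.exp (-1) ^ lam.card) ^ 2 =
            (c1 * Real.exp (-1) ^ lam.card) * (c2 * Real.exp (-1) ^ lam.card) := by ring
        _ ≤ _ := mul_le_mul h1 h2 (by positivity) (norm_nonneg _)
  choose c hc hb using key
  refine ⟨∏ J, c J, Finset.prod_pos fun J _ => hc J, fun lam S L hS hL hL' => ?_⟩
  rw [ZTerm_singleDiagram, norm_prod]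
  refine le_trans (le_of_eq ?_) (Finset.prod_le_prod (fun J _ => ?_)
    fun J _ => hb J lam S L hS hL hL')
  · rw [Finset.prod_mul_distrib, Finset.prod_mul_distrib, Finset.prod_const, Finset.card_univ,
      Fintype.card_fin, Finset.prod_ite_eq' Finset.univ I, if_pos (Finset.mem_univ I)]
    have e : (upperConstant N (m, a, ε₁, ε₂))⁻¹ = Real.exp (-1) ^ (2 * N) * κ ^ 2 := by
      rw [upperConstant, hκ, mul_inv, ← Real.exp_neg, ← Real.exp_nat_mul, ← inv_pow, inv_div]
      push_cast
      ring_nf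
    rw [e, mul_pow]
    ring
  · have := (hc J).le
    split_ifs <;> positivity

end

/-! ### Exponentially good rational approximations -/

theorem frequently_distInt_lt {x B : ℝ} (hB : 0 < B) (h : ENNReal.ofReal B < expType x) :
    ∃ᶠ q : ℕ in atTop, distInt (q * x) < Real.exp (-B * q) := by
  by_contra hcon
  rw [not_frequently] at hcon
  refine absurd h (not_lt.2 ?_)
  refine iInf₂_le_of_le B.toNNReal ⟨Real.toNNReal_pos.2 hB, 1, one_pos, ?_⟩ le_rfl
  filter_upwards [hcon] with q hq
  rw [Real.coe_toNNReal _ hB.le, one_mul]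
  exact not_lt.1 hq

theorem eventually_le_distInt {x B : ℝ} (h : expType x < ENNReal.ofReal B) :
    ∀ᶠ q : ℕ in atTop, Real.exp (-B * q) ≤ distInt (q * x) := by
  rw [expType, iInf_lt_iff] at h
  obtain ⟨b, hb⟩ := h
  rw [iInf_lt_iff] at hb
  obtain ⟨⟨_, c, hc, hev⟩, hbB⟩ := hb
  have hbB' : (b : ℝ) < B := by
    rw [ENNReal.lt_ofReal_iff_toReal_lt ENNReal.coe_ne_top] at hbB
    simpa using hbB
  have hlim : Tendsto (fun q : ℕ => (q : ℝ) * (B - b)) atTop atTop :=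
    tendsto_natCast_atTop_atTop.atTop_mul_const (by linarith)
  filter_upwards [hev, hlim.eventually_ge_atTop (-Real.log c)] with q hq hq'
  refine le_trans ?_ hq
  calc Real.exp (-B * q) ≤ Real.exp (Real.log c + -b * q) := Real.exp_le_exp.2 (by nlinarith)
    _ = c * Real.exp (-b * q) := by rw [Real.exp_add, Real.exp_log hc]

theorem tendsto_exp_neg_mul_nat {B : ℝ} (hB : 0 < B) :
    Tendsto (fun q : ℕ => Real.exp (-B * q)) atTop (𝓝 0) := by
  refine Real.tendsto_exp_atBot.comp ?_
  exact tendsto_natCast_atTop_atTop.const_mul_atTop_of_neg (by linarith)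

/-- Exponentially good approximations may be taken in lowest terms: dividing numerator and
denominator by their gcd improves both sides of the inequality. -/
theorem frequently_distInt_lt_coprime {x B : ℝ} (hx : Irrational x) (hB : 0 < B)
    (h : ENNReal.ofReal B < expType x) :
    ∃ᶠ q : ℕ in atTop, distInt (q * x) < Real.exp (-B * q) ∧
      IsCoprime (round ((q : ℝ) * x)) (q : ℤ) := by
  rw [frequently_atTop]
  intro Q
  have hsmall : ∀ᶠ q : ℕ in atTop, ∀ k ∈ Finset.range Q, k ≠ 0 →
      Real.exp (-B * q) < distInt (k * x) := by
    rw [Filter.eventually_all_finset]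
    intro k _
    by_cases hk : k = 0
    · simp [hk]
    · filter_upwards [(tendsto_exp_neg_mul_nat hB).eventually_lt_const (distInt_pos hx hk)]
        with q hq _
      exact hq
  have hhalf : ∀ᶠ q : ℕ in atTop, Real.exp (-B * q) < 1 / 2 :=
    (tendsto_exp_neg_mul_nat hB).eventually_lt_const (by norm_num)
  obtain ⟨q, hq, ⟨hsm, hha⟩, hq1⟩ := ((frequently_distInt_lt hB h).and_eventually
    ((hsmall.and hhalf).and (eventually_ge_atTop 1))).exists
  set p := round ((q : ℝ) * x) with hp
  set g := Int.gcd p q with hg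
  obtain ⟨p', hp'⟩ : ((g : ℕ) : ℤ) ∣ p := Int.gcd_dvd_left _ _
  obtain ⟨q', hq'⟩ : g ∣ q := by exact_mod_cast Int.gcd_dvd_right p q
  have hg0 : 0 < g := Nat.pos_of_ne_zero fun h0 => by
    rw [h0] at hq'
    omega
  have hq'0 : q' ≠ 0 := by
    rintro rfl
    omega
  have hg1 : (1 : ℝ) ≤ g := by exact_mod_cast hg0
  have hdist : distInt (q * x) = g * |q' * x - p'| := by
    have e1 : (q : ℝ) = g * q' := by exact_mod_cast hq'
    have e2 : (p : ℝ) = g * p' := by exact_mod_cast hp'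
    rw [distInt_eq_abs_sub_round, ← hp, e1, e2, ← abs_of_nonneg (by positivity : (0 : ℝ) ≤ (g : ℝ)),
      ← abs_mul, abs_of_nonneg (by positivity : (0 : ℝ) ≤ (g : ℝ))]
    congr 1
    ring
  have hle : |q' * x - p'| < Real.exp (-B * q) := by
    have := abs_nonneg (q' * x - p')
    nlinarith
  have hround : round ((q' : ℝ) * x) = p' := by
    have h1 := round_le ((q' : ℝ) * x) p'
    have h2 : |((round ((q' : ℝ) * x) - p' : ℤ) : ℝ)| < 1 := by
      push_cast
      calc |(round ((q' : ℝ) * x) : ℝ) - p'|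
          ≤ |(round ((q' : ℝ) * x) : ℝ) - q' * x| + |q' * x - p'| := abs_sub_le _ _ _
        _ < 1 := by rw [abs_sub_comm]; linarith
    have h3 : |round ((q' : ℝ) * x) - p'| < 1 := by exact_mod_cast h2
    have := Int.abs_lt_one_iff.1 h3
    omega
  have hqq : q' ≤ q := by
    rw [hq']
    exact Nat.le_mul_of_pos_left _ hg0
  refine ⟨q', ?_, ?_, ?_⟩
  · by_contra hlt
    have h1 := hsm q' (Finset.mem_range.2 (by omega)) hq'0
    have h2 := distInt_le_abs_sub (q' * x) p'
    linarith
  · refine (distInt_le_abs_sub (q' * x) p').trans_lt (hle.trans_le (Real.exp_le_exp.2 ?_))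
    have : (q' : ℝ) ≤ q := by exact_mod_cast hqq
    nlinarith
  · rw [hround, Int.isCoprime_iff_gcd_eq_one]
    have h1 : g = g * Int.gcd p' q' := by
      have e : Int.gcd p q = Int.gcd (g * p') (g * q') := by
        rw [← hp']
        congr 1
        exact_mod_cast hq'
      rw [Int.gcd_mul_left, Int.natAbs_natCast] at e
      exact e
    exact Nat.eq_of_mul_eq_mul_left hg0 (by omega)

/-- The numerators used along the denominators `q` approximating `x`. -/
noncomputable def nearestNat (x : ℝ) (q : ℕ) : ℕ := (round ((q : ℝ) * x)).toNat

theorem nearestNat_cast {x : ℝ} (hx0 : 0 < x) (q : ℕ) :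
    ((nearestNat x q : ℕ) : ℤ) = round ((q : ℝ) * x) := by
  refine Int.toNat_of_nonneg ?_
  rw [round_eq]
  exact Int.floor_nonneg.2 (by positivity)

theorem abs_nearestNat_sub {x : ℝ} (hx0 : 0 < x) (q : ℕ) :
    |(q : ℝ) * x - nearestNat x q| = distInt (q * x) := by
  have : ((nearestNat x q : ℕ) : ℝ) = ((nearestNat x q : ℤ) : ℝ) := by push_cast; rfl
  rw [this, nearestNat_cast hx0, distInt_eq_abs_sub_round]

theorem tendsto_nearestNat_div {x : ℝ} (hx0 : 0 < x) :
    Tendsto (fun q : ℕ => (nearestNat x q : ℝ) / q) atTop (𝓝 x) := by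
  rw [tendsto_iff_norm_sub_tendsto_zero]
  have h1 : Tendsto (fun q : ℕ => (1 / 2 : ℝ) / q) atTop (𝓝 0) :=
    tendsto_const_div_atTop_nhds_zero_nat _
  refine squeeze_zero' (Eventually.of_forall fun q => norm_nonneg _) ?_ h1
  filter_upwards [eventually_gt_atTop 0] with q hq
  have hq' : (0 : ℝ) < q := by exact_mod_cast hq
  have h2 : (nearestNat x q : ℝ) / q - x = (nearestNat x q - q * x) / q := by
    field_simp
  rw [h2, norm_div, Real.norm_eq_abs, Real.norm_eq_abs, abs_of_pos hq', abs_sub_comm,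
    abs_nearestNat_sub hx0]
  have := distInt_le_half (q * x)
  gcongr

/-- The exponential rate obtained from `slopeDiagram p q` tends to `B / (1 + x)`. -/
theorem tendsto_slope_rate {x : ℝ} (hx0 : 0 < x) (B : ℝ) {M : ℝ} (hM : 0 < M) :
    Tendsto (fun q : ℕ => (B * q - Real.log (2 * (nearestNat x q + q) / M)) *
      ((nearestNat x q * q - (nearestNat x q + q)) /
        ((nearestNat x q + q) * (nearestNat x q * q + 2)))) atTop (𝓝 (B / (1 + x))) := by
  have hq : Tendsto (fun q : ℕ => (q : ℝ)) atTop atTop := tendsto_natCast_atTop_atTop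
  have hinv : Tendsto (fun q : ℕ => (1 : ℝ) / q) atTop (𝓝 0) := tendsto_one_div_atTop_nhds_zero_nat
  have hp := tendsto_nearestNat_div hx0
  have hp1 := hp.add_const 1
  have hlogq : Tendsto (fun q : ℕ => Real.log q / q) atTop (𝓝 0) := by
    exact (Real.isLittleO_log_id_atTop.tendsto_div_nhds_zero).comp hq
  have hlog : Tendsto (fun q : ℕ => Real.log (2 * (nearestNat x q + q) / M) / q) atTop (𝓝 0) := by
    have h1 : Tendsto (fun q : ℕ => Real.log (2 / M * ((nearestNat x q : ℝ) / q + 1)) * (1 / q) +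
        Real.log q / q) atTop (𝓝 (Real.log (2 / M * (x + 1)) * 0 + 0)) := by
      refine Tendsto.add (Tendsto.mul ?_ hinv) hlogq
      exact (hp1.const_mul (2 / M)).log (by positivity)
    rw [mul_zero, add_zero] at h1
    refine h1.congr' ?_
    filter_upwards [eventually_gt_atTop 0] with q hq0
    have hq' : (0 : ℝ) < q := by exact_mod_cast hq0
    have e : 2 * ((nearestNat x q : ℝ) + q) / M =
        2 / M * ((nearestNat x q : ℝ) / q + 1) * q := by
      field_simp
    rw [e, Real.log_mul (by positivity) hq'.ne']
    field_simp
  have hmain : Tendsto (fun q : ℕ => (B - Real.log (2 * (nearestNat x q + q) / M) / q) *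
      (((nearestNat x q : ℝ) / q - ((nearestNat x q : ℝ) / q + 1) * (1 / q)) /
        (((nearestNat x q : ℝ) / q + 1) * ((nearestNat x q : ℝ) / q + 2 * ((1 / q) * (1 / q))))))
      atTop (𝓝 ((B - 0) * ((x - (x + 1) * 0) / ((x + 1) * (x + 2 * (0 * 0)))))) := by
    refine (hlog.const_sub B).mul ((hp.sub (hp1.mul hinv)).div
      (hp1.mul (hp.add ((hinv.mul hinv).const_mul 2))) ?_)
    have : 0 < (x + 1) * (x + 2 * (0 * 0)) := by positivity
    exact this.ne'
  have hval : (B - 0) * ((x - (x + 1) * 0) / ((x + 1) * (x + 2 * (0 * 0)))) = B / (1 + x) := by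
    field_simp
    ring
  rw [hval] at hmain
  refine hmain.congr' ?_
  filter_upwards [eventually_gt_atTop 0] with q hq0
  have hq' : (0 : ℝ) < q := by exact_mod_cast hq0
  have hp0 : (0 : ℝ) ≤ nearestNat x q := by positivity
  generalize (nearestNat x q : ℝ) = p at *
  field_simp

section

variable {ε₁ ε₂ : ℂ} {N : ℕ} {m : ℂ} {a : Fin N → ℂ} {x : ℝ}

theorem GenericParams.mem_positiveDomain (hg : GenericParams m a ε₁ ε₂) (hx : Irrational x)
    (hx0 : 0 < x) (he : ε₁ / ε₂ = (x : ℂ)) : (m, a, ε₁, ε₂) ∈ positiveDomain N :=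
  have hmem := ofReal_mul_mem_closure hg.ne_zero₂ hx he
  ⟨hg.ne_zero₂, ⟨x, hx0, he⟩, fun t (h : m = t * ε₂) => hg.mass (h ▸ hmem t),
    fun I J hIJ t (h : a I - a J = t * ε₂) => hg.coulomb I J hIJ (h ▸ hmem t)⟩

theorem continuousOn_upperConstant (N : ℕ) :
    ContinuousOn (upperConstant N) (positiveDomain N) := by
  have h2 : ∀ p ∈ positiveDomain N, p.2.2.2 ≠ 0 := fun p hp => hp.1
  have hdiv : ContinuousOn (fun p : ℂ × (Fin N → ℂ) × ℂ × ℂ => p.1 / p.2.2.2)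
      (positiveDomain N) := ContinuousOn.div (by fun_prop) (by fun_prop) h2
  refine continuousOn_const.mul (ContinuousOn.pow (ContinuousOn.div hdiv.norm
    (Complex.continuous_im.comp_continuousOn hdiv).abs ?_) 2)
  intro p hp h0
  rw [Function.comp_apply, abs_eq_zero] at h0
  refine hp.2.2.1 (p.1 / p.2.2.2).re ?_
  rw [← div_eq_iff (h2 p hp)]
  exact Complex.ext (by simp) (by simp [h0])

theorem one_le_upperConstant {p : ℂ × (Fin N → ℂ) × ℂ × ℂ} (hp : p ∈ positiveDomain N) :
    1 ≤ upperConstant N p := by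
  have him : (p.1 / p.2.2.2).im ≠ 0 := by
    intro h0
    refine hp.2.2.1 (p.1 / p.2.2.2).re ?_
    rw [← div_eq_iff hp.1]
    exact Complex.ext (by simp) (by simp [h0])
  have h1 : 1 ≤ ‖p.1 / p.2.2.2‖ / |(p.1 / p.2.2.2).im| := by
    rw [one_le_div (abs_pos.2 him)]
    exact Complex.abs_im_le_norm _
  rw [upperConstant]
  exact one_le_mul_of_one_le_of_one_le (Real.one_le_exp (by positivity)) (one_le_pow₀ h1)

/-- Since `dist (q x, ℤ)` is frequently less than `e^{-B q}`, the diagrams `slopeDiagram p q` have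
terms of size at least `e^{(B / (1 + x) - o(1)) n}` up to the constant. -/
theorem GenericParams.le_of_lt_expType (hg : GenericParams m a ε₁ ε₂) (hN : 1 ≤ N)
    (hx : Irrational x) (hx0 : 0 < x) (he : ε₁ / ε₂ = (x : ℂ)) {B : ℝ} (hB : 0 < B)
    (hBx : ENNReal.ofReal B < expType x) {r : ℝ}
    (hs : AbsSumConverges m a ε₁ ε₂ r) :
    r ≤ upperConstant N (m, a, ε₁, ε₂) * Real.exp (-(B / (1 + x))) := by
  by_contra hlt
  rw [not_le] at hlt
  set U := upperConstant N (m, a, ε₁, ε₂) with hU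
  have hU0 : 0 < U := one_pos.trans_le (one_le_upperConstant (hg.mem_positiveDomain hx hx0 he))
  have hr0 : 0 < r := lt_trans (by positivity) hlt
  obtain ⟨γ, hγ0, hγ⟩ : ∃ γ : ℝ, 0 < γ ∧ Real.log r - Real.log U = γ - B / (1 + x) := by
    refine ⟨Real.log r - Real.log U + B / (1 + x), ?_, by ring⟩
    have := Real.log_lt_log (by positivity) hlt
    rw [Real.log_mul hU0.ne' (Real.exp_pos _).ne', Real.log_exp] at this
    linarith
  obtain ⟨I, hI⟩ := hg.exists_unobstructed hN hx he
  obtain ⟨c, hc, hlow⟩ := hg.exists_le_norm_ZTerm hx hx0 he hI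
  set M := ‖m / ε₂‖ with hMdef
  have hM : 0 < M := norm_pos_iff.2 (div_ne_zero hg.mass_ne_zero hg.ne_zero₂)
  -- The terms of a convergent series are bounded by its sum `C`.
  obtain ⟨C, hC⟩ : ∃ C : ℝ, ∀ Y : Fin N → YoungDiagram,
      r ^ totalSize Y * ‖ZTerm m a ε₁ ε₂ Y‖ ≤ C :=
    ⟨_, fun Y => hs.le_tsum Y fun _ _ => by positivity⟩
  have hp := tendsto_nearestNat_div hx0
  have hq : Tendsto (fun q : ℕ => (q : ℝ)) atTop atTop := tendsto_natCast_atTop_atTop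
  have hrate := (tendsto_slope_rate hx0 B hM).eventually_const_lt
    (show B / (1 + x) - γ / 2 < B / (1 + x) by linarith)
  have hlogpos : ∀ᶠ q : ℕ in atTop,
      (nearestNat x q + q : ℝ) * Real.exp (-B * q) ≤ M / 2 := by
    have h1 : Tendsto (fun q : ℕ => ((nearestNat x q : ℝ) / q + 1) *
        ((q : ℝ) * Real.exp (-B * q))) atTop (𝓝 ((x + 1) * 0)) := by
      refine (hp.add_const 1).mul ?_
      have h2 := (Real.tendsto_pow_mul_exp_neg_atTop_nhds_zero 1).comp
        (hq.const_mul_atTop hB)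
      have h3 := h2.const_mul B⁻¹
      rw [mul_zero] at h3
      refine h3.congr fun q => ?_
      simp only [Function.comp_apply, pow_one]
      rw [← mul_assoc, ← mul_assoc, inv_mul_cancel₀ hB.ne', one_mul, neg_mul]
    rw [mul_zero] at h1
    filter_upwards [h1.eventually_lt_const (show (0 : ℝ) < M / 2 by positivity),
      eventually_gt_atTop 0] with q h2 hq0
    have hq' : (0 : ℝ) < q := by exact_mod_cast hq0
    refine le_trans (le_of_eq ?_) h2.le
    field_simp
  have hpq : ∀ᶠ q : ℕ in atTop, (nearestNat x q + q : ℝ) + 1 ≤ nearestNat x q * q := by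
    filter_upwards [hp.eventually_const_lt (show x / 2 < x by linarith),
      hq.eventually_ge_atTop (2 * (3 / x) + 4)] with q h1 h2
    have hx2 : 0 < 3 / x := by positivity
    have hq' : (0 : ℝ) < q := by linarith
    rw [lt_div_iff₀ hq'] at h1
    have h3 : 3 ≤ (nearestNat x q : ℝ) := by
      have : 3 / x * x = 3 := by field_simp
      nlinarith
    have h4 : 4 ≤ (q : ℝ) := by linarith
    nlinarith [mul_nonneg (sub_nonneg.2 h3) (sub_nonneg.2 h4)]
  have hbig : ∀ᶠ q : ℕ in atTop, Real.log C - Real.log c < (q : ℝ) / 2 * (γ / 2) :=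
    (((hq.atTop_div_const two_pos)).atTop_mul_const (by positivity)).eventually_gt_atTop _
  obtain ⟨q, ⟨hqd, hcop⟩, ⟨hrateq, hlogq⟩, ⟨hpqq, hbigq⟩, hq1⟩ :=
    ((frequently_distInt_lt_coprime hx hB hBx).and_eventually ((hrate.and hlogpos).and
      ((hpq.and hbig).and (eventually_ge_atTop 1)))).exists
  set p := nearestNat x q with hpdef
  rw [← nearestNat_cast hx0 q] at hcop
  have hqR : (1 : ℝ) ≤ q := by exact_mod_cast hq1
  have hp0 : 0 < p := by
    rcases Nat.eq_zero_or_pos p with h0 | h0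
    · rw [h0] at hpqq
      push_cast at hpqq
      linarith
    · exact h0
  have hpR : (0 : ℝ) < p := by exact_mod_cast hp0
  set lam := slopeDiagram p q hp0 with hlam
  set S := slopeBoxes p q hp0 with hS
  have hSsub : S ⊆ lam.cells := by
    classical
    exact Finset.filter_subset _ _
  have hn1 : 2 * (lam.card : ℝ) ≤ (p + q) ^ 2 * (p * q + 2) := by
    exact_mod_cast two_mul_card_slopeDiagram_le hp0 hq1
  have hb1 : ((p : ℝ) + q) * (p * q - (p + q)) ≤ 2 * S.card := by
    have := le_two_mul_card_slopeBoxes hp0 hq1 hcop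
    exact_mod_cast this
  have hSn : (S.card : ℝ) ≤ lam.card := by exact_mod_cast Finset.card_le_card hSsub
  -- `L` bounds the singular factors: there the denominator is `t (p - x q)` with `t < p + q`.
  set L := Real.exp (B * q) / (2 * (p + q) / M) with hL
  have hL0 : 0 < L := by positivity
  have hlogL : Real.log L = B * q - Real.log (2 * (p + q) / M) := by
    rw [hL, Real.log_div (Real.exp_pos _).ne' (by positivity), Real.log_exp]
  have hLb : ∀ b ∈ S, L ≤
      ‖1 - (m / ε₂) / ((((lam.arm b : ℝ) + 1) - x * lam.leg b : ℝ) : ℂ)‖ := by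
    intro b hb
    classical
    rw [hS, slopeBoxes, Finset.mem_filter] at hb
    obtain ⟨-, t, ht0, ht, harm, hleg⟩ := hb
    have harm' : (lam.arm b : ℝ) + 1 = t * p := by exact_mod_cast harm
    have hleg' : (lam.leg b : ℝ) = t * q := by exact_mod_cast hleg
    have htR : (0 : ℝ) < t := by exact_mod_cast ht0
    have htR' : (t : ℝ) ≤ p + q := by exact_mod_cast ht.le
    have hd : |((lam.arm b : ℝ) + 1) - x * lam.leg b| = t * distInt (q * x) := by
      rw [harm', hleg', ← abs_nearestNat_sub hx0, abs_sub_comm (q * x), ← abs_of_pos htR, ← abs_mul,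
        abs_of_pos htR]
      congr 1
      ring
    have hdpos := distInt_pos hx (q := q) (by omega)
    set d := ((lam.arm b : ℝ) + 1) - x * lam.leg b with hd_def
    have hdd : |d| ≤ (p + q) * Real.exp (-B * q) := by
      rw [hd]
      gcongr
    have hdabs : 0 < |d| := by
      rw [hd]
      positivity
    have h1 : M / |d| - 1 ≤ ‖1 - (m / ε₂) / (d : ℂ)‖ := by
      have := norm_sub_norm_le ((m / ε₂) / (d : ℂ)) 1
      rw [norm_one, norm_div, Complex.norm_real, Real.norm_eq_abs, norm_sub_rev] at this
      exact this
    have h2 : 2 * L ≤ M / |d| := by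
      rw [le_div_iff₀ hdabs]
      calc 2 * L * |d| ≤ 2 * L * ((p + q) * Real.exp (-B * q)) := by gcongr
        _ = M * (Real.exp (B * q) * Real.exp (-B * q)) := by
            rw [hL]
            field_simp
        _ = M := by rw [← Real.exp_add, neg_mul, add_neg_cancel, Real.exp_zero, mul_one]
    have h3 : 1 ≤ L := by
      rw [hL, le_div_iff₀ (by positivity), one_mul, div_le_iff₀ hM]
      have h4 : Real.exp (B * q) * Real.exp (-B * q) = 1 := by
        rw [← Real.exp_add, neg_mul, add_neg_cancel, Real.exp_zero]
      have h5 := mul_le_mul_of_nonneg_left hlogq (Real.exp_pos (B * q)).le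
      have h6 : Real.exp (B * q) * ((p + q) * Real.exp (-B * q)) = p + q := by
        linear_combination ((p : ℝ) + q) * h4
      linarith
    linarith
  have hterm := (mul_le_mul_of_nonneg_left (hlow lam S L hSsub hL0.le hLb)
    (by positivity : 0 ≤ r ^ lam.card)).trans
      (by simpa only [totalSize_singleDiagram] using hC (singleDiagram I lam))
  have hlog := Real.log_le_log (by positivity) hterm
  rw [Real.log_mul (by positivity) (by positivity), Real.log_mul (by positivity) (by positivity),
    Real.log_mul (by positivity) (by positivity), Real.log_pow, Real.log_pow, Real.log_pow,
    Real.log_inv, hlogL] at hlog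
  have hn0 : (0 : ℝ) ≤ lam.card := by positivity
  -- The proportion of singular boxes times their logarithmic size.
  have hkey : (lam.card : ℝ) * (B / (1 + x) - γ / 2) ≤
      S.card * (B * q - Real.log (2 * (p + q) / M)) := by
    have hell : 0 ≤ B * q - Real.log (2 * (p + q) / M) := by
      have h7 : 2 * (p + q) / M ≤ Real.exp (B * q) := by
        rw [div_le_iff₀ hM]
        have h4 : Real.exp (B * q) * Real.exp (-B * q) = 1 := by
          rw [← Real.exp_add, neg_mul, add_neg_cancel, Real.exp_zero]
        have h5 := mul_le_mul_of_nonneg_left hlogq (Real.exp_pos (B * q)).le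
        have h6 : Real.exp (B * q) * ((p + q) * Real.exp (-B * q)) = p + q := by
          linear_combination ((p : ℝ) + q) * h4
        linarith
      have := (Real.log_le_iff_le_exp (by positivity)).2 h7
      linarith
    have hfrac : (lam.card : ℝ) * ((p * q - (p + q)) / ((p + q) * (p * q + 2))) ≤ S.card := by
      rw [← mul_div_assoc, div_le_iff₀ (by positivity)]
      have h8 : (0 : ℝ) ≤ p * q - (p + q) := by linarith
      have h9 : (0 : ℝ) < p * q + 2 := by positivity
      have h10 : (0 : ℝ) < p + q := by positivity
      have h11 := mul_le_mul_of_nonneg_right hn1 h8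
      have h12 := mul_le_mul_of_nonneg_right hb1 (by positivity : 0 ≤ ((p : ℝ) + q) * (p * q + 2))
      nlinarith
    calc (lam.card : ℝ) * (B / (1 + x) - γ / 2)
        ≤ lam.card * ((B * q - Real.log (2 * (p + q) / M)) *
          ((p * q - (p + q)) / ((p + q) * (p * q + 2)))) := by gcongr
      _ = (lam.card * ((p * q - (p + q)) / ((p + q) * (p * q + 2)))) *
          (B * q - Real.log (2 * (p + q) / M)) := by ring
      _ ≤ _ := by gcongr
  have hnq : (q : ℝ) / 2 ≤ lam.card := by
    have : (p + q : ℝ) * 1 ≤ (p + q) * (p * q - (p + q)) := by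
      gcongr
      linarith
    linarith
  have hnγ : (q : ℝ) / 2 * (γ / 2) ≤ lam.card * (γ / 2) := by gcongr
  have hid : (lam.card : ℝ) * Real.log r - lam.card * Real.log U =
      lam.card * γ - lam.card * (B / (1 + x)) := by
    rw [← mul_sub, hγ, mul_sub]
  linarith

end

/-! ### Poles at rational `ε₁ / ε₂` -/

/-- The function `φ` behaves like a nonzero multiple of `t ^ (-e)` as `t → 0`. -/
def HasPoleOrder (φ : ℂ → ℂ) (e : ℤ) : Prop :=
  ∃ c ≠ 0, Tendsto (fun t => φ t * t ^ e) (𝓝[≠] 0) (𝓝 c)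

namespace HasPoleOrder

theorem mul {φ ψ : ℂ → ℂ} {e f : ℤ} (h : HasPoleOrder φ e) (h' : HasPoleOrder ψ f) :
    HasPoleOrder (fun t => φ t * ψ t) (e + f) := by
  obtain ⟨c, hc, h⟩ := h
  obtain ⟨c', hc', h'⟩ := h'
  refine ⟨c * c', mul_ne_zero hc hc', (h.mul h').congr' ?_⟩
  filter_upwards [self_mem_nhdsWithin] with t ht
  rw [zpow_add₀ ht]
  ring

theorem prod {ι : Type*} (s : Finset ι) {φ : ι → ℂ → ℂ} {e : ι → ℤ}
    (h : ∀ i ∈ s, HasPoleOrder (φ i) (e i)) :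
    HasPoleOrder (fun t => ∏ i ∈ s, φ i t) (∑ i ∈ s, e i) := by
  classical
  induction s using Finset.induction_on with
  | empty => exact ⟨1, one_ne_zero, by simp⟩
  | insert i s hi ih =>
    simp only [Finset.prod_insert hi, Finset.sum_insert hi]
    exact (h i (Finset.mem_insert_self _ _)).mul
      (ih fun j hj => h j (Finset.mem_insert_of_mem hj))

theorem inv {φ : ℂ → ℂ} {e : ℤ} (h : HasPoleOrder φ e) :
    HasPoleOrder (fun t => (φ t)⁻¹) (-e) := by
  obtain ⟨c, hc, h⟩ := h
  refine ⟨c⁻¹, inv_ne_zero hc, (h.inv₀ hc).congr fun t => ?_⟩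
  rw [mul_inv, zpow_neg]

theorem congr' {φ ψ : ℂ → ℂ} {e : ℤ} (h : HasPoleOrder φ e) (h' : φ =ᶠ[𝓝[≠] 0] ψ) :
    HasPoleOrder ψ e := by
  obtain ⟨c, hc, h⟩ := h
  refine ⟨c, hc, h.congr' ?_⟩
  filter_upwards [h'] with t ht
  rw [ht]

theorem eventually_ne_zero {φ : ℂ → ℂ} {e : ℤ} (h : HasPoleOrder φ e) :
    ∀ᶠ t in 𝓝[≠] 0, φ t ≠ 0 := by
  obtain ⟨c, hc, h⟩ := h
  filter_upwards [h.eventually_ne hc] with t ht h0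
  exact ht (by rw [h0, zero_mul])

theorem affine {α β : ℂ} (h : β ≠ 0 ∨ α ≠ 0) :
    HasPoleOrder (fun t => α + t * β) (-(if α = 0 then 1 else 0)) := by
  by_cases hα : α = 0
  · refine ⟨β, h.resolve_right (not_not.2 hα), tendsto_const_nhds.congr' ?_⟩
    filter_upwards [self_mem_nhdsWithin] with t ht
    have ht' : t ≠ 0 := ht
    simp only [hα, if_true, zero_add, zpow_neg_one]
    field_simp
  · refine ⟨α, hα, ?_⟩
    have h1 : Tendsto (fun t : ℂ => α + t * β) (𝓝 0) (𝓝 (α + 0 * β)) :=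
      (Continuous.tendsto (by fun_prop) 0)
    simpa [hα] using h1.mono_left nhdsWithin_le_nhds

/-- A factor `1 - m / d` with `d = α + t β` has a pole if `α = 0` and a zero if `α = m`. -/
theorem one_sub_div {α β m : ℂ} (h : β ≠ 0 ∨ (α ≠ 0 ∧ α ≠ m)) :
    HasPoleOrder (fun t => 1 - m / (α + t * β))
      ((if α = 0 then 1 else 0) - (if α = m then 1 else 0)) := by
  have h1 : HasPoleOrder (fun t => α + t * β) _ := affine (h.imp_right And.left)
  have h2 : HasPoleOrder (fun t => (α - m) + t * β) _ :=
    affine (h.imp_right fun h => sub_ne_zero.2 h.2)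
  have h3 := (h1.inv.mul h2).congr' (ψ := fun t => 1 - m / (α + t * β)) (by
    filter_upwards [h1.eventually_ne_zero] with t ht
    field_simp
    ring)
  simpa only [neg_neg, ← sub_eq_add_neg, sub_eq_zero] using h3

theorem tendsto_norm_atTop {φ : ℂ → ℂ} {e : ℤ} (h : HasPoleOrder φ e) (he : 0 < e) :
    Tendsto (fun t => ‖φ t‖) (𝓝[≠] 0) atTop := by
  obtain ⟨c, hc, h⟩ := h
  lift e to ℕ using he.le
  have he' : e ≠ 0 := by omega
  have h1 : Tendsto (fun t : ℂ => ‖t ^ e‖⁻¹) (𝓝[≠] 0) atTop := by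
    refine Tendsto.inv_tendsto_nhdsGT_zero ?_
    refine tendsto_nhdsWithin_iff.2 ⟨?_, ?_⟩
    · have : Tendsto (fun t : ℂ => ‖t ^ e‖) (𝓝 0) (𝓝 ‖(0 : ℂ) ^ e‖) :=
        Continuous.tendsto (by fun_prop) 0
      rw [zero_pow he', norm_zero] at this
      exact this.mono_left nhdsWithin_le_nhds
    · filter_upwards [self_mem_nhdsWithin] with t ht
      exact norm_pos_iff.2 (pow_ne_zero _ ht)
  refine (h.norm.pos_mul_atTop (norm_pos_iff.2 hc) h1).congr' ?_
  filter_upwards [self_mem_nhdsWithin] with t ht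
  have : ‖t ^ e‖ ≠ 0 := norm_ne_zero_iff.2 (pow_ne_zero _ ht)
  rw [zpow_natCast, norm_mul]
  field_simp

end HasPoleOrder

section

variable {ε₁ ε₂ : ℂ} {N : ℕ} {m : ℂ} {a : Fin N → ℂ}

/-- Some vertex `I` is maximal for the relation `a J = a I + m`. -/
theorem exists_forall_sub_ne_neg_mass (hN : 1 ≤ N) (hm : m ≠ 0) : ∃ I, ∀ J, a I - a J ≠ -m := by
  have : Nonempty (Fin N) := ⟨⟨0, hN⟩⟩
  obtain ⟨I, hI⟩ := Finite.exists_max fun I => (a I / m).re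
  refine ⟨I, fun J h => ?_⟩
  have h1 : a J / m = a I / m + 1 := by
    field_simp
    linear_combination -h
  have h2 := hI J
  rw [h1, Complex.add_re, Complex.one_re] at h2
  linarith

theorem add_mul_I_ne_zero {p q : ℤ} (h : p ≠ 0 ∨ q ≠ 0) : (p : ℂ) * Complex.I + q ≠ 0 := by
  intro h0
  have h1 := congrArg Complex.re h0
  have h2 := congrArg Complex.im h0
  simp at h1 h2
  omega

/-- A point has only finitely many representations as a nonnegative combination of `ε₁, ε₂` when
`ε₁ / ε₂ > 0`. -/
theorem exists_finset_of_combination_eq {x : ℝ} (hx : 0 < x) (h0 : ε₂ ≠ 0) (he : ε₁ / ε₂ = (x : ℂ))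
    (w : ℂ) : ∃ F : Finset (ℕ × ℕ), ∀ A i : ℕ, (A : ℂ) * ε₂ + i * ε₁ = w → (A, i) ∈ F := by
  refine ⟨Finset.range (⌊(w / ε₂).re⌋₊ + 1) ×ˢ Finset.range (⌊(w / ε₂).re / x⌋₊ + 1),
    fun A i h => ?_⟩
  have hre : (A : ℝ) + i * x = (w / ε₂).re := by
    have : w / ε₂ = ((A + i * x : ℝ) : ℂ) := by
      rw [← h]
      push_cast
      rw [← he]
      field_simp
    rw [this, Complex.ofReal_re]
  rw [Finset.mem_product, Finset.mem_range, Finset.mem_range, Nat.lt_succ_iff, Nat.lt_succ_iff]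
  constructor
  · refine Nat.le_floor ?_
    have : 0 ≤ (i : ℝ) * x := by positivity
    linarith
  · refine Nat.le_floor ?_
    rw [le_div_iff₀ hx]
    have : (0 : ℝ) ≤ A := by positivity
    linarith

theorem injOn_arm_fst (lam : YoungDiagram) :
    Set.InjOn (fun c => (lam.arm c, c.1)) (lam.cells : Set (ℕ × ℕ)) := by
  intro c hc c' hc' h
  obtain ⟨h1, h2⟩ := Prod.mk.inj h
  have e1 := YoungDiagram.arm_add hc
  have e2 := YoungDiagram.arm_add hc'
  rw [h2] at e1
  exact Prod.ext h2 (by omega)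

/-- Off-diagonal numerators vanish on a number of boxes bounded independently of the diagram. -/
theorem exists_card_zeros_le {x : ℝ} (hx : 0 < x) (h0 : ε₂ ≠ 0) (he : ε₁ / ε₂ = (x : ℂ)) (z m : ℂ) :
    ∃ W : ℕ, ∀ lam : YoungDiagram,
      (lam.cells.filter fun c => boxDenom ε₁ ε₂ lam ⊥ (z + ε₂) c = m).card ≤ W ∧
      (lam.cells.filter fun c => boxDenom ε₁ ε₂ lam ⊥ (z - ε₁) c = m).card ≤ W := by
  obtain ⟨F, hF⟩ := exists_finset_of_combination_eq hx h0 he (m - z - ε₂ - ε₁)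
  obtain ⟨F', hF'⟩ := exists_finset_of_combination_eq hx h0 he (m - z)
  have key : ∀ lam : YoungDiagram, ∀ s ⊆ lam.cells, ∀ G : Finset (ℕ × ℕ),
      (∀ c ∈ s, (lam.arm c, c.1) ∈ G) → s.card ≤ G.card := fun lam s hs G h =>
    Finset.card_le_card_of_injOn _ h ((injOn_arm_fst lam).mono (by exact_mod_cast hs))
  refine ⟨F.card + F'.card, fun lam => ⟨?_, ?_⟩⟩
  · refine (key lam _ (Finset.filter_subset _ _) F fun c hc => ?_).trans (Nat.le_add_right _ _)
    rw [Finset.mem_filter] at hc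
    rw [boxDenom_bot_right hc.1] at hc
    refine hF _ _ ?_
    rw [← hc.2]
    ring
  · refine (key lam _ (Finset.filter_subset _ _) F' fun c hc => ?_).trans (Nat.le_add_left _ _)
    rw [Finset.mem_filter] at hc
    rw [boxDenom_bot_left hc.1] at hc
    refine hF' _ _ ?_
    rw [← hc.2]
    ring

/-- The order of the pole of the factors of `ZLamMu`, given their denominators at `t = 0`. -/
noncomputable def poleOrder (m d : ℂ) : ℤ := (if d = 0 then 1 else 0) - (if d = m then 1 else 0)

theorem hasPoleOrder_ZLamMu {lam mu : YoungDiagram} {e₁ e₂ α : ℂ → ℂ} {m : ℂ}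
    {d : ℕ × ℕ → ℂ}
    (h : ∀ c ∈ lam.cells, ∃ β, (∀ t, boxDenom (e₁ t) (e₂ t) lam mu (α t) c = d c + t * β) ∧
      (β ≠ 0 ∨ (d c ≠ 0 ∧ d c ≠ m))) :
    HasPoleOrder (fun t => ZLamMu (e₁ t) (e₂ t) lam mu (α t) m)
      (∑ c ∈ lam.cells, poleOrder m (d c)) := by
  refine HasPoleOrder.prod _ fun c hc => ?_
  obtain ⟨β, h1, h2⟩ := h c hc
  simp only [h1]
  exact HasPoleOrder.one_sub_div h2


theorem sum_poleOrder_eq {m : ℂ} (s : Finset (ℕ × ℕ)) (d : ℕ × ℕ → ℂ) :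
    ∑ c ∈ s, poleOrder m (d c) = (s.filter fun c => d c = 0).card -
      ((s.filter fun c => d c = m).card : ℤ) := by
  simp only [poleOrder, Finset.sum_sub_distrib, Finset.sum_boole]

/-- The denominators at `(ε₁ + t, ε₂ + i t)` are affine in `t`, and the only ones that do not depend
on `t` equal `z`, at the end of the first row against an empty diagram. -/
theorem exists_slope {lam mu : YoungDiagram} {c : ℕ × ℕ} (hc : c ∈ lam.cells)
    (hmu : mu = lam ∨ mu = ⊥) (z : ℂ) :
    (∃ β, (∀ t : ℂ, boxDenom (ε₁ + t * 1) (ε₂ + t * Complex.I) lam mu (z + (ε₂ + t * Complex.I)) c =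
      boxDenom ε₁ ε₂ lam mu (z + ε₂) c + t * β) ∧ β ≠ 0) ∧
    ∃ β, (∀ t : ℂ, boxDenom (ε₁ + t * 1) (ε₂ + t * Complex.I) lam mu (z - (ε₁ + t * 1)) c =
      boxDenom ε₁ ε₂ lam mu (z - ε₁) c + t * β) ∧
      (β ≠ 0 ∨ (mu = ⊥ ∧ boxDenom ε₁ ε₂ lam mu (z - ε₁) c = z)) := by
  rcases hmu with rfl | rfl
  · simp only [boxDenom_self_right hc, boxDenom_self_left hc]
    refine ⟨⟨((mu.arm c + 1 : ℤ) : ℂ) * Complex.I + (-(mu.leg c : ℤ) : ℤ), fun t => ?_,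
      add_mul_I_ne_zero (by omega)⟩, ((mu.arm c : ℤ) : ℂ) * Complex.I + (-(mu.leg c + 1 : ℤ) : ℤ),
      fun t => ?_, Or.inl (add_mul_I_ne_zero (by omega))⟩
    all_goals
      push_cast
      ring
  · simp only [boxDenom_bot_right hc, boxDenom_bot_left hc]
    refine ⟨⟨((lam.arm c + 1 : ℤ) : ℂ) * Complex.I + (c.1 + 1 : ℤ), fun t => ?_,
      add_mul_I_ne_zero (by omega)⟩, ((lam.arm c : ℤ) : ℂ) * Complex.I + (c.1 : ℤ),
      fun t => ?_, ?_⟩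
    · push_cast
      ring
    · push_cast
      ring
    · by_cases h : (lam.arm c : ℤ) ≠ 0 ∨ (c.1 : ℤ) ≠ 0
      · exact Or.inl (add_mul_I_ne_zero h)
      · push Not at h
        refine Or.inr ⟨trivial, ?_⟩
        rw [Int.natCast_eq_zero.1 h.1, Int.natCast_eq_zero.1 h.2]
        simp

/-- On the rectangle of height `k q + 1` and width `k p`, at least `k` denominators vanish when
`q ε₁ = p ε₂`. -/
theorem le_card_poles {p q : ℕ} (hp : 0 < p) (h : (q : ℂ) * ε₁ = p * ε₂) (k : ℕ) :
    k ≤ ((YoungDiagram.rect (k * q + 1) (k * p)).cells.filter fun c =>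
      boxDenom ε₁ ε₂ (YoungDiagram.rect (k * q + 1) (k * p))
        (YoungDiagram.rect (k * q + 1) (k * p)) (0 + ε₂) c = 0).card := by
  conv_lhs => rw [← Finset.card_range k]
  refine Finset.card_le_card_of_injOn (fun s => (s * q, s * p)) (fun s hs => ?_) ?_
  · have hs' : s < k := Finset.mem_range.1 hs
    have h1 : s * q < k * q + 1 := Nat.lt_succ_of_le (Nat.mul_le_mul_right _ hs'.le)
    have h2 : s * p < k * p := Nat.mul_lt_mul_of_pos_right hs' hp
    rw [Finset.mem_coe, Finset.mem_filter]
    refine ⟨?_, ?_⟩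
    · rw [YoungDiagram.mem_cells, YoungDiagram.mem_rect]
      exact ⟨h1, h2⟩
    · rw [boxDenom, YoungDiagram.rowLen_rect h1, YoungDiagram.colLen_rect h2]
      push_cast
      linear_combination ((s : ℂ) - k) * h
  · intro s _ s' _ h
    exact Nat.eq_of_mul_eq_mul_right hp (Prod.mk.inj h).2

/-- A large rectangle at a vertex `I` for which no `a J` equals `a I + m` is singular: in the direction
`(1, i)` only the denominators equal to `a I - a J` are stationary, and there neither they nor their
numerators vanish. -/
theorem GenericParams.exists_singular (hg : GenericParams m a ε₁ ε₂) (hN : 1 ≤ N) {r : ℚ}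
    (hr : 0 < r) (he : ε₁ / ε₂ = (r : ℂ)) :
    ∃ Y : Fin N → YoungDiagram, ¬ ZTermDefined a ε₁ ε₂ Y ∧
      ∃ u v : ℂ,
        (∀ᶠ t : ℂ in 𝓝[≠] 0, ZTermDefined a (ε₁ + t * u) (ε₂ + t * v) Y) ∧
        Tendsto (fun t : ℂ => ‖ZTerm m a (ε₁ + t * u) (ε₂ + t * v) Y‖) (𝓝[≠] 0) atTop := by
  have h0 := hg.ne_zero₂
  obtain ⟨I, hI⟩ := exists_forall_sub_ne_neg_mass (a := a) hN hg.mass_ne_zero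
  obtain ⟨p, hp⟩ : ∃ p : ℕ, (p : ℤ) = r.num := ⟨r.num.toNat, Int.toNat_of_nonneg (by positivity)⟩
  have hp0 : 0 < p := by
    have := Rat.num_pos.2 hr
    omega
  have hpq : (r.den : ℂ) * ε₁ = p * ε₂ := by
    have h1 : (r : ℂ) = p / r.den := by
      rw [← Int.cast_natCast (R := ℂ) p, hp]
      exact Rat.cast_def r
    have h2 : (r.den : ℂ) ≠ 0 := Nat.cast_ne_zero.2 r.den_ne_zero
    rw [h1, div_eq_iff h0] at he
    rw [he]
    field_simp
  have hr' : (0 : ℝ) < r := by exact_mod_cast hr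
  have he' : ε₁ / ε₂ = ((r : ℝ) : ℂ) := by rw [he]; push_cast; rfl
  choose W hW using fun J => exists_card_zeros_le hr' h0 he' (a I - a J) m
  choose W' hW' using fun J => exists_card_zeros_le hr' h0 he' (a I - a J) (-m)
  -- More poles than the zeros that the empty diagrams can contribute.
  set k := ∑ J, (W J + W' J) + 1 with hk
  set lam := YoungDiagram.rect (k * r.den + 1) (k * p) with hlam
  have hpoles : k ≤ _ := le_card_poles hp0 hpq k
  rw [← hlam] at hpoles
  have hmu : ∀ J, singleDiagram I lam J = lam ∨ singleDiagram I lam J = ⊥ := fun J => by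
    by_cases h : J = I
    · rw [h, singleDiagram_same]; exact Or.inl rfl
    · exact Or.inr (singleDiagram_of_ne h _)
  have hlam0 : lam ≠ ⊥ := by
    intro h
    rw [h] at hpoles
    have : k ≤ 0 := hpoles
    omega
  have hoff : ∀ J, singleDiagram I lam J = ⊥ → J ≠ I := by
    rintro J h rfl
    exact hlam0 ((singleDiagram_same J lam).symm.trans h)
  have hslope := fun J c (hc : c ∈ lam.cells) =>
    exists_slope (ε₁ := ε₁) (ε₂ := ε₂) hc (hmu J) (a I - a J)
  refine ⟨singleDiagram I lam, fun hdef => ?_, 1, Complex.I, ?_, ?_⟩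
  · obtain ⟨c, hc⟩ := Finset.card_pos.1 (lt_of_lt_of_le (by omega : 0 < k) hpoles)
    rw [Finset.mem_filter] at hc
    have := hdef I I c
    rw [singleDiagram_same, sub_self] at this
    exact (this hc.1).1 hc.2
  · simp only [ZTermDefined, Filter.eventually_all]
    intro K J
    by_cases hK : K = I
    · subst hK
      rw [singleDiagram_same, Filter.eventually_all_finset]
      intro c hc
      obtain ⟨⟨β, h1, h2⟩, β', h3, h4⟩ := hslope J c hc
      simp only [h1, h3]
      refine (HasPoleOrder.affine (Or.inl h2)).eventually_ne_zero.and
        (HasPoleOrder.affine (h4.imp_right ?_)).eventually_ne_zero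
      rintro ⟨h5, h6⟩ h7
      rw [h6] at h7
      exact hg.sub_notMem_epsLattice (Ne.symm (hoff J h5)) ⟨0, 0, by simp [h7]⟩
    · rw [singleDiagram_of_ne hK]
      exact Eventually.of_forall fun t c hc => absurd hc (Finset.notMem_empty c)
  · have hne : ∀ J c, c ∈ lam.cells → singleDiagram I lam J = ⊥ →
        boxDenom ε₁ ε₂ lam (singleDiagram I lam J) (a I - a J - ε₁) c = a I - a J →
        boxDenom ε₁ ε₂ lam (singleDiagram I lam J) (a I - a J - ε₁) c ≠ 0 ∧
        boxDenom ε₁ ε₂ lam (singleDiagram I lam J) (a I - a J - ε₁) c ≠ -m := by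
      intro J c _ h1 h2
      rw [h2]
      exact ⟨fun h => hg.sub_notMem_epsLattice (Ne.symm (hoff J h1)) ⟨0, 0, by simp [h]⟩, hI J⟩
    have horder := HasPoleOrder.prod Finset.univ fun J _ =>
      (hasPoleOrder_ZLamMu (lam := lam) (mu := singleDiagram I lam J) (m := m)
        (e₁ := fun t => ε₁ + t * 1) (e₂ := fun t => ε₂ + t * Complex.I)
        (α := fun t => a I - a J + (ε₂ + t * Complex.I))
        (d := boxDenom ε₁ ε₂ lam (singleDiagram I lam J) (a I - a J + ε₂)) fun c hc => by
          obtain ⟨⟨β, h1, h2⟩, -⟩ := hslope J c hc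
          exact ⟨β, h1, Or.inl h2⟩).mul
      (hasPoleOrder_ZLamMu (lam := lam) (mu := singleDiagram I lam J) (m := -m)
        (e₁ := fun t => ε₁ + t * 1) (e₂ := fun t => ε₂ + t * Complex.I)
        (α := fun t => a I - a J - (ε₁ + t * 1))
        (d := boxDenom ε₁ ε₂ lam (singleDiagram I lam J) (a I - a J - ε₁)) fun c hc => by
          obtain ⟨-, β, h1, h2⟩ := hslope J c hc
          exact ⟨β, h1, h2.imp_right fun h => hne J c hc h.1 h.2⟩)
    simp only [ZTerm_singleDiagram]
    refine horder.tendsto_norm_atTop ?_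
    have hJ : ∀ J, (if J = I then (k : ℤ) else 0) - (W J + W' J) ≤
        ∑ c ∈ lam.cells, poleOrder m
          (boxDenom ε₁ ε₂ lam (singleDiagram I lam J) (a I - a J + ε₂) c) +
        ∑ c ∈ lam.cells, poleOrder (-m)
          (boxDenom ε₁ ε₂ lam (singleDiagram I lam J) (a I - a J - ε₁) c) := by
      intro J
      rw [sum_poleOrder_eq, sum_poleOrder_eq]
      by_cases h : J = I
      · subst h
        rw [singleDiagram_same, sub_self, if_pos rfl]
        -- The mass is not a lattice point, so no diagonal numerator vanishes.
        have hz1 : (lam.cells.filter fun c => boxDenom ε₁ ε₂ lam lam (0 + ε₂) c = m) = ∅ := by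
          refine Finset.filter_eq_empty_iff.2 fun c _ h => ?_
          obtain ⟨⟨w, hw, h1⟩, -⟩ := exists_boxDenom_eq (ε₁ := ε₁) (ε₂ := ε₂) lam lam 0 c
          rw [h1, zero_add] at h
          exact hg.mass_notMem (h ▸ hw)
        have hz2 : (lam.cells.filter fun c => boxDenom ε₁ ε₂ lam lam (0 - ε₁) c = -m) = ∅ := by
          refine Finset.filter_eq_empty_iff.2 fun c _ h => ?_
          obtain ⟨-, w, hw, h1⟩ := exists_boxDenom_eq (ε₁ := ε₁) (ε₂ := ε₂) lam lam 0 c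
          rw [h1, zero_add] at h
          have := neg_mem_epsLattice hw
          rw [h, neg_neg] at this
          exact hg.mass_notMem this
        rw [hz1, hz2, Finset.card_empty]
        omega
      · rw [singleDiagram_of_ne h, if_neg h]
        have h1 := (hW J lam).1
        have h2 := (hW' J lam).2
        omega
    refine lt_of_lt_of_le ?_ (Finset.sum_le_sum fun J _ => hJ J)
    rw [Finset.sum_sub_distrib, Finset.sum_ite_eq' Finset.univ I, if_pos (Finset.mem_univ _), hk]
    push_cast
    linarith

end

/-! ### The exponential type and the radius -/

theorem expNeg_top : expNeg ⊤ = 0 := by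
  rw [expNeg, EReal.coe_ennreal_top, EReal.neg_top, EReal.exp_bot]

theorem expNeg_of_ne_top {t : ℝ≥0∞} (ht : t ≠ ⊤) :
    expNeg t = ENNReal.ofReal (Real.exp (-t.toReal)) := by
  lift t to ℝ≥0 using ht
  rw [expNeg, ENNReal.coe_toReal, ← EReal.exp_coe]
  rfl

section

variable {ε₁ ε₂ : ℂ} {N : ℕ} {m : ℂ} {a : Fin N → ℂ} {x : ℝ}

theorem GenericParams.lower_le_Rabs (hg : GenericParams m a ε₁ ε₂) (hx : Irrational x)
    (hx0 : 0 < x) (he : ε₁ / ε₂ = (x : ℂ)) :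
    ENNReal.ofReal (Real.exp (-lowerExponent N (m, a, ε₁, ε₂))) *
      expNeg (8 * expType x / ENNReal.ofReal (max 1 x)) ≤ Rabs m a ε₁ ε₂ := by
  have hmax : 0 < max 1 x := lt_max_of_lt_left one_pos
  by_cases hT : expType x = ⊤
  · rw [hT, ENNReal.mul_top (by norm_num), ENNReal.top_div_of_ne_top ENNReal.ofReal_ne_top,
      expNeg_top, mul_zero]
    exact zero_le
  have hne : 8 * expType x / ENNReal.ofReal (max 1 x) ≠ ⊤ :=
    ENNReal.div_ne_top (ENNReal.mul_ne_top (by norm_num) hT) (ENNReal.ofReal_pos.2 hmax).ne'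
  rw [expNeg_of_ne_top hne, ← ENNReal.ofReal_mul (Real.exp_pos _).le, ← Real.exp_add, ← neg_add,
    ENNReal.toReal_div, ENNReal.toReal_mul, ENNReal.toReal_ofReal hmax.le]
  set β := (expType x).toReal with hβ
  have hlim : Tendsto (fun β' : ℝ => ENNReal.ofReal
      (Real.exp (-(lowerExponent N (m, a, ε₁, ε₂) + 8 * (β' / max 1 x))))) (𝓝[>] β)
      (𝓝 (ENNReal.ofReal (Real.exp (-(lowerExponent N (m, a, ε₁, ε₂) + 8 * (β / max 1 x)))))) := by
    refine ENNReal.tendsto_ofReal ?_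
    exact (Continuous.tendsto (by fun_prop) β).mono_left nhdsWithin_le_nhds
  rw [show ENNReal.toReal 8 = 8 from rfl, mul_div_assoc]
  refine le_of_tendsto hlim ?_
  filter_upwards [self_mem_nhdsWithin] with β' hβ'
  have hβ'' : β < β' := hβ'
  have hβ0 : 0 ≤ β := ENNReal.toReal_nonneg
  refine hg.exp_lowerExponent_le_Rabs hx hx0 he (β := (β + β') / 2) (by linarith) (by linarith)
    (eventually_le_distInt ?_)
  rw [ENNReal.lt_ofReal_iff_toReal_lt hT]
  linarith

theorem GenericParams.nonpos_of_expType_eq_top (hg : GenericParams m a ε₁ ε₂) (hN : 1 ≤ N)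
    (hx : Irrational x) (hx0 : 0 < x) (he : ε₁ / ε₂ = (x : ℂ)) (hT : expType x = ⊤) {r : ℝ}
    (hs : AbsSumConverges m a ε₁ ε₂ r) : r ≤ 0 := by
  have hlim : Tendsto (fun B : ℝ => upperConstant N (m, a, ε₁, ε₂) * Real.exp (-(B / (1 + x))))
      atTop (𝓝 (upperConstant N (m, a, ε₁, ε₂) * 0)) :=
    (Real.tendsto_exp_neg_atTop_nhds_zero.comp
      (tendsto_id.atTop_div_const (by linarith))).const_mul _
  rw [mul_zero] at hlim
  refine ge_of_tendsto hlim ?_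
  filter_upwards [eventually_gt_atTop 0] with B hB
  exact hg.le_of_lt_expType hN hx hx0 he hB (hT ▸ ENNReal.ofReal_lt_top) hs

theorem GenericParams.Rabs_eq_zero (hg : GenericParams m a ε₁ ε₂) (hN : 1 ≤ N)
    (hx : Irrational x) (hx0 : 0 < x) (he : ε₁ / ε₂ = (x : ℂ)) (hT : expType x = ⊤) :
    Rabs m a ε₁ ε₂ = 0 := by
  rw [← nonpos_iff_eq_zero, ← ENNReal.ofReal_zero]
  exact Rabs_le_ofReal fun r _ hs => hg.nonpos_of_expType_eq_top hN hx hx0 he hT hs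

theorem GenericParams.Rabs_le_one_of_irrational (hg : GenericParams m a ε₁ ε₂) (hN : 1 ≤ N)
    (hx : Irrational x) (he : ε₁ / ε₂ = (x : ℂ)) : Rabs m a ε₁ ε₂ ≤ 1 := by
  refine hg.Rabs_le_one hN fun r _ hr => hx ⟨r, ?_⟩
  rw [he, ← Complex.ofReal_ratCast] at hr
  exact (Complex.ofReal_injective hr).symm

theorem GenericParams.Rabs_le_upper (hg : GenericParams m a ε₁ ε₂) (hN : 1 ≤ N)
    (hx : Irrational x) (hx0 : 0 < x) (he : ε₁ / ε₂ = (x : ℂ)) :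
    Rabs m a ε₁ ε₂ ≤ ENNReal.ofReal (upperConstant N (m, a, ε₁, ε₂)) *
      expNeg (expType x / ENNReal.ofReal (1 + x)) := by
  have h1x : 0 < 1 + x := by linarith
  have hU := one_le_upperConstant (hg.mem_positiveDomain hx hx0 he)
  by_cases hT : expType x = ⊤
  · rw [hg.Rabs_eq_zero hN hx hx0 he hT]
    exact zero_le
  have hne : expType x / ENNReal.ofReal (1 + x) ≠ ⊤ :=
    ENNReal.div_ne_top hT (ENNReal.ofReal_pos.2 h1x).ne'
  rw [expNeg_of_ne_top hne, ← ENNReal.ofReal_mul (one_pos.trans_le hU).le,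
    ENNReal.toReal_div, ENNReal.toReal_ofReal h1x.le]
  set β := (expType x).toReal with hβ
  rcases (ENNReal.toReal_nonneg : 0 ≤ β).eq_or_lt with h0 | h0
  · rw [hβ, ← h0, zero_div, neg_zero, Real.exp_zero, mul_one]
    exact (hg.Rabs_le_one_of_irrational hN hx he).trans (ENNReal.one_le_ofReal.2 hU)
  · refine Rabs_le_ofReal fun r _ hs => ?_
    have hlim : Tendsto (fun B : ℝ => upperConstant N (m, a, ε₁, ε₂) * Real.exp (-(B / (1 + x))))
        (𝓝[<] β) (𝓝 (upperConstant N (m, a, ε₁, ε₂) * Real.exp (-(β / (1 + x))))) :=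
      (Continuous.tendsto (by fun_prop) β).mono_left nhdsWithin_le_nhds
    refine ge_of_tendsto hlim ?_
    filter_upwards [Ioo_mem_nhdsLT h0] with B hB
    exact hg.le_of_lt_expType hN hx hx0 he hB.1
      ((ENNReal.ofReal_lt_iff_lt_toReal hB.1.le hT).2 hB.2) hs

theorem GenericParams.Rabs_pos_iff (hg : GenericParams m a ε₁ ε₂) (hN : 1 ≤ N)
    (hx : Irrational x) (hx0 : 0 < x) (he : ε₁ / ε₂ = (x : ℂ)) :
    0 < Rabs m a ε₁ ε₂ ↔ expType x < ⊤ := by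
  refine ⟨fun h => lt_top_iff_ne_top.2 fun hT => h.ne' (hg.Rabs_eq_zero hN hx hx0 he hT),
    fun hT => lt_of_lt_of_le ?_ (hg.lower_le_Rabs hx hx0 he)⟩
  rw [expNeg_of_ne_top (ENNReal.div_ne_top (ENNReal.mul_ne_top (by norm_num) hT.ne)
    (ENNReal.ofReal_pos.2 (lt_max_of_lt_left one_pos)).ne')]
  exact ENNReal.mul_pos (ENNReal.ofReal_pos.2 (Real.exp_pos _)).ne'
    (ENNReal.ofReal_pos.2 (Real.exp_pos _)).ne'

end

theorem theorem1 (N : ℕ) (hN : 1 ≤ N) :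
    (∀ (m : ℂ) (a : Fin N → ℂ) (ε₁ ε₂ : ℂ), GenericParams m a ε₁ ε₂ →
      (¬ ∃ x : ℝ, 0 ≤ x ∧ ε₁ / ε₂ = (x : ℂ)) →
        (∀ Y, ZTermDefined a ε₁ ε₂ Y) ∧ Rabs m a ε₁ ε₂ = 1) ∧
    (∃ A₁ A₂ : ℂ × (Fin N → ℂ) × ℂ × ℂ → ℝ,
      ContinuousOn A₁ (positiveDomain N) ∧ ContinuousOn A₂ (positiveDomain N) ∧
      (∀ p ∈ positiveDomain N, 0 < A₁ p ∧ 0 < A₂ p) ∧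
      ∀ (m : ℂ) (a : Fin N → ℂ) (ε₁ ε₂ : ℂ) (x : ℝ), GenericParams m a ε₁ ε₂ →
        0 < x → Irrational x → ε₁ / ε₂ = (x : ℂ) →
          (∀ Y, ZTermDefined a ε₁ ε₂ Y) ∧
          ENNReal.ofReal (A₁ (m, a, ε₁, ε₂)) *
              expNeg (8 * expType x / ENNReal.ofReal (max 1 x)) ≤ Rabs m a ε₁ ε₂ ∧
          Rabs m a ε₁ ε₂ ≤ min 1 (ENNReal.ofReal (A₂ (m, a, ε₁, ε₂)) *
              expNeg (expType x / ENNReal.ofReal (1 + x))) ∧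
          (0 < Rabs m a ε₁ ε₂ ↔ expType x < ⊤) ∧
          (expType x = ⊤ → Rabs m a ε₁ ε₂ = 0 ∧
            ∀ q : ℂ, q ≠ 0 → ¬ AbsSumConverges m a ε₁ ε₂ ‖q‖)) ∧
    (∀ (m : ℂ) (a : Fin N → ℂ) (ε₁ ε₂ : ℂ) (r : ℚ), GenericParams m a ε₁ ε₂ →
      0 < r → ε₁ / ε₂ = (r : ℂ) →
        ∃ Y : Fin N → YoungDiagram, ¬ ZTermDefined a ε₁ ε₂ Y ∧
          ∃ u v : ℂ,
            (∀ᶠ t : ℂ in 𝓝[≠] 0, ZTermDefined a (ε₁ + t * u) (ε₂ + t * v) Y) ∧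
            Tendsto (fun t : ℂ => ‖ZTerm m a (ε₁ + t * u) (ε₂ + t * v) Y‖) (𝓝[≠] 0) atTop) := by
  refine ⟨fun m a ε₁ ε₂ hg hw => ⟨hg.ZTermDefined_of_not_nonneg hw,
    le_antisymm (hg.Rabs_le_one hN fun r hr h => hw ⟨r, by exact_mod_cast hr, ?_⟩)
      (hg.one_le_Rabs hw)⟩,
    ⟨fun p => Real.exp (-lowerExponent N p), upperConstant N,
      Real.continuous_exp.comp_continuousOn (continuousOn_lowerExponent N).neg,
      continuousOn_upperConstant N,
      fun p hp => ⟨Real.exp_pos _, one_pos.trans_le (one_le_upperConstant hp)⟩,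
      fun m a ε₁ ε₂ x hg hx0 hx he => ⟨hg.ZTermDefined_of_irrational hx he,
        hg.lower_le_Rabs hx hx0 he,
        le_min (hg.Rabs_le_one_of_irrational hN hx he) (hg.Rabs_le_upper hN hx hx0 he),
        hg.Rabs_pos_iff hN hx hx0 he, fun hT => ⟨hg.Rabs_eq_zero hN hx hx0 he hT,
          fun q hq hs => ?_⟩⟩⟩,
    fun m a ε₁ ε₂ r hg hr he => hg.exists_singular hN hr he⟩
  · rw [h]
    push_cast
    rfl
  · exact (norm_pos_iff.2 hq).not_ge (hg.nonpos_of_expType_eq_top hN hx hx0 he hT hs)
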